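/- Let $\Omega\subset\mathbb{R}^2$ be a bounded polygonal domain with $\operatorname{int}\overline\Omega=\Omega$, let $\mu_1,\mu_2>0$, and fix constants $\sigma,d_0,\theta,r_0>0$ and $c,L\ge 0$. **Setting.** Let $\Gamma=\overline\Omega_1\cap\overline\Omega_2$ be a connected interface with $\Omega\setminus\Gamma=\Omega_1\cup\Omega_2$, where $\Omega_1,\Omega_2$ are open and disjoint. Let $(\mathcal T_\ell)_{\ell\ge0}$ be nested conforming triangulations of $\Omega$ with mesh sizes $h_\ell$, quasi-uniform in the sense that every $T\in\mathcal T_\ell$ has diameter at most $h_\ell$ and contains a disc of radius $\sigma h_\ell$. Let $\Gamma_\ell=\overline\Omega_{\ell,1}\cap\overline\Omega_{\ell,2}$ be connected with $\Omega\setminus\Gamma_\ell=\Omega_{\ell,1}\cup\Omega_{\ell,2}$, where $\Omega_{\ell,1},\Omega_{\ell,2}$ are open and disjoint. Let $\Omega^e_{\ell,i}$ be the union of all $T\in\mathcal T_\ell$ with $T\cap\Omega_{\ell,i}\ne\emptyset$. Assume for all $\ell$: 1. the Hausdorff distance of $\Gamma$ and $\Gamma_\ell$ is at most $c\,h_\ell^2$;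 2. $\Omega^e_{\ell+1,i}\subseteq\Omega^e_{\ell,i}$ for $i=1,2$; 3. if $T\in\mathcal T_\ell$ meets $\Gamma_\ell$, then $T\cap\Gamma_\ell$ is not a subsimplex of $T$, and no vertex of $\mathcal T_\ell$ in $\Omega$ lies on $\Gamma_\ell$; 4. (resolution of the interface) if $T\in\mathcal T_\ell$ meets $\Gamma_\ell$, then $T\cap\Gamma_\ell$ is a single arc that meets $\partial T$ in exactly two points $p,q$, not on a common edge, and that is the graph over the chord $[p,q]$ of a function with Lipschitz constant $L$; moreover $\operatorname{diam}\Gamma_\ell\ge d_0h_\ell$; 5. every disc of radius $r\le r_0$ centred on $\Gamma$ contains a disc of radius $\theta r$ disjoint from $\Gamma$ (a property of Lipschitz curves). **Discretization.** Drop the index $\ell$. Let $V$ be the space of continuous, piecewise linear functions on $\mathcal T$ that vanish on $\partial\Omega$, with nodal basis $(\varphi_x)$, $x$ running through the vertices in $\Omega$. Elements $u$ of the unfitted space are given by $u=u_i$ on $\Omega_i$ with $u_i\in V|_{\Omega_i^e}$, $i=1,2$. Let $n$ be the unit normal on $\Gamma$ pointing out of $\Omega_1$, $[u]=u_1-u_2$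 and $\{w\}=\kappa_1w_1+\kappa_2w_2$ on $\Gamma$, with $\kappa_i=|T\cap\Omega_i|/|T|$ on $T$. Define $$a(u,v)=\sum_{i=1}^2\int_{\Omega_i}\mu_i\nabla u_i\cdot\nabla v_i,\quad N^c(u,v)=\int_\Gamma\{-\mu\nabla u\cdot n\}[v],\quad N^s_\lambda(u,v)=\frac{\lambda}{h}\int_\Gamma[u][v],$$ $$a_h(u,v)=a(u,v)+N^c(u,v)+N^c(v,u)+N^s_\lambda(u,v)\quad\text{(Nitsche)},$$ $$\tilde a_h(u,v)=a(u,v)+N^c(u,v)+N^c(v,u)+2a(\mathcal Lu,\mathcal Lv)+N^s_1(u,v)\quad\text{(parameter-free)}.$$ With $a_T,N^c_T$ the contributions of $T$ to $a,N^c$, and $P_T$ the space of functions on $T$ that are affine with mean value zero on each of $T\cap\Omega_1$, $T\cap\Omega_2$, the lifting $\mathcal Lu|_T\in P_T$ is defined on the triangles $T$ cut by $\Gamma$ by $a_T(\mathcal Lu,v)=N^c_T(v,u)$ for all $v\in P_T$, and $\mathcal Lu=0$ on the others. Let $\mathcal V_i$ be the set of vertices in $\Omega_i$ that belong to a triangle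 meeting the other subdomain. The XFEM basis consists of all $\varphi_x$ ($x$ a vertex in $\Omega$) and all $\varphi_x|_{\Omega\setminus\Omega_i}$ ($x\in\mathcal V_i$, $i=1,2$). The local interface matrix $A^\Gamma$ of a bilinear form is the principal submatrix of its stiffness matrix in this basis that belongs to the functions $\varphi_x$ and $\varphi_x|_{\Omega\setminus\Omega_i}$ with $x\in\mathcal V_i$, $i=1,2$. Put $D=\operatorname{diag}(A^\Gamma)$. **Claim.** (a) There is $\lambda_0>0$, depending only on $\Omega,\mu_1,\mu_2,\sigma,L$, such that for every $\lambda\ge\lambda_0$ there is a constant $C$, depending only on $\Omega,\mu_1,\mu_2,\lambda,\sigma,L,c,d_0,\theta,r_0$, such that for all families as above and all levels $\ell$ the matrix $A^\Gamma$ of $a_h$ is symmetric positive definite, $$C^{-1}\langle D\mathbf u,\mathbf u\rangle\le\langle A^\Gamma\mathbf u,\mathbf u\rangle\le C\langle D\mathbf u,\mathbf u\rangle\quad\text{for all }\mathbf u,$$ and the spectral condition number $\lambda_{\max}(D^{-1}A^\Gamma)/\lambda_{\min}(D^{-1}A^\Gamma)$ is at most $C$. (b) The same holds for the matrix $A^\Gamma$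 of $\tilde a_h$, with a constant $C$ depending only on $\Omega,\mu_1,\mu_2,\sigma,L,c,d_0,\theta,r_0$. In particular the bounds are uniform in the level and in the position of the interface. -/

import Mathlib

open scoped MeasureTheory Topology
open MeasureTheory

noncomputable section

namespace CutFEM

/-- The Euclidean plane. -/
abbrev Plane : Type := EuclideanSpace ℝ (Fin 2)

/-- The closed simplex spanned by a finite set of points. -/
abbrev hull (T : Finset Plane) : Set Plane := convexHull ℝ (T : Set Plane)

/-- A (conforming) triangulation of `Ω`: a finite simplicial complex of pure dimension two whose
underlying space is the closure of `Ω`. -/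
structure Triangulation (Ω : Set Plane) where
  complex : Geometry.SimplicialComplex ℝ Plane
  finite_faces : complex.faces.Finite
  pure : ∀ s ∈ complex.faces, ∃ T ∈ complex.faces, s ⊆ T ∧ T.card = 3
  space_eq : complex.space = closure Ω

namespace Triangulation

variable {Ω : Set Plane} (M : Triangulation Ω)

/-- The triangles of the triangulation (each given by its three vertices). -/
def cells : Finset (Finset Plane) := M.finite_faces.toFinset.filter (fun T => T.card = 3)

open Classical in
/-- The vertices of the triangulation. -/
def vertices : Finset Plane := M.cells.biUnion id

/-- The space of continuous, piecewise linear functions that vanish on the boundary of `Ω`.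
(Values outside of the closure of `Ω` are irrelevant.) -/
def feSpace : Set (Plane → ℝ) :=
  {v | ContinuousOn v (closure Ω) ∧ (∀ y ∈ frontier Ω, v y = 0) ∧
    ∀ T ∈ M.cells, ∃ f : Plane →ᵃ[ℝ] ℝ, Set.EqOn v f (hull T)}

open Classical in
/-- `v` is the nodal basis function of the finite element space that belongs to the vertex `x`. -/
def IsNodal (x : Plane) (v : Plane → ℝ) : Prop :=
  v ∈ M.feSpace ∧ ∀ y ∈ M.vertices, v y = if y = x then 1 else 0

/-- The nodal basis function of the vertex `x`; see `isNodal_nodal`. -/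
def nodal (x : Plane) : Plane → ℝ := Classical.epsilon (M.IsNodal x)

/-! ### Existence of the nodal basis functions -/

variable {M}

theorem mem_cells {T : Finset Plane} : T ∈ M.cells ↔ T ∈ M.complex.faces ∧ T.card = 3 := by
  simp [cells]

theorem closure_eq : closure Ω = ⋃ T ∈ M.cells, hull T := by
  rw [← M.space_eq]
  ext y
  simp only [Geometry.SimplicialComplex.mem_space_iff, Set.mem_iUnion, exists_prop]
  constructor
  · rintro ⟨s, hs, hy⟩
    obtain ⟨T, hT, hsT, hc⟩ := M.pure s hs
    exact ⟨T, mem_cells.2 ⟨hT, hc⟩, convexHull_mono (by exact_mod_cast hsT) hy⟩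
  · rintro ⟨T, hT, hy⟩
    exact ⟨T, (mem_cells.1 hT).1, hy⟩

/-- Barycentric coordinates on a triangle. -/
def cellBasis {T : Finset Plane} (hT : T ∈ M.cells) : AffineBasis T ℝ Plane where
  toFun := (↑)
  ind' := M.complex.indep (mem_cells.1 hT).1
  tot' := by
    rw [(M.complex.indep (mem_cells.1 hT).1).affineSpan_eq_top_iff_card_eq_finrank_add_one]
    simp [(mem_cells.1 hT).2]

theorem cellBasis_apply {T : Finset Plane} (hT : T ∈ M.cells) (x : T) :
    cellBasis hT x = (x : Plane) := rfl

theorem mem_hull_iff {T : Finset Plane} (hT : T ∈ M.cells) {y : Plane} :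
    y ∈ hull T ↔ ∀ v : T, 0 ≤ (cellBasis hT).coord v y := by
  have h := (cellBasis hT).convexHull_eq_nonneg_coord
  have h2 : Set.range (cellBasis hT) = (T : Set Plane) := by
    ext z
    simp [cellBasis_apply]
  rw [h2] at h
  rw [hull, h]
  rfl

open Classical in
/-- The barycentric coordinate of the vertex `x` on the triangle `T`, zero if `x` is not in `T`. -/
def bary {T : Finset Plane} (hT : T ∈ M.cells) (x : Plane) : Plane →ᵃ[ℝ] ℝ :=
  if h : x ∈ T then (cellBasis hT).coord ⟨x, h⟩ else 0

open Classical in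
theorem bary_vertex {T : Finset Plane} (hT : T ∈ M.cells) (x : Plane) {v : Plane} (hv : v ∈ T) :
    bary hT x v = if v = x then 1 else 0 := by
  unfold bary
  split_ifs with h h1 h1
  · subst h1
    have := (cellBasis hT).coord_apply_eq ⟨v, h⟩
    simpa [cellBasis_apply] using this
  · have := (cellBasis hT).coord_apply_ne (i := ⟨x, h⟩) (j := ⟨v, hv⟩)
      (by simpa [Subtype.ext_iff] using fun e => h1 e.symm)
    simpa [cellBasis_apply] using this
  · exact absurd (h1 ▸ hv) h
  · rfl

theorem bary_continuous {T : Finset Plane} (hT : T ∈ M.cells) (x : Plane) :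
    Continuous (bary hT x) := (bary hT x).continuous_of_finiteDimensional

theorem affine_eqOn_convexHull {s : Set Plane} {f g : Plane →ᵃ[ℝ] ℝ} (h : Set.EqOn f g s) :
    Set.EqOn f g (convexHull ℝ s) := by
  have hc : Convex ℝ {z : Plane | (f - g) z = 0} :=
    (convex_singleton (𝕜 := ℝ) (0 : ℝ)).affine_preimage (f - g)
  have : convexHull ℝ s ⊆ {z : Plane | (f - g) z = 0} := by
    refine convexHull_min (fun z hz => ?_) hc
    have := h hz
    simp [this]
  intro z hz
  have := this hz
  simpa [sub_eq_zero] using this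

theorem bary_agree {S T : Finset Plane} (hS : S ∈ M.cells) (hT : T ∈ M.cells) (x : Plane)
    {y : Plane} (hyS : y ∈ hull S) (hyT : y ∈ hull T) : bary hS x y = bary hT x y := by
  classical
  have hy := M.complex.inter_subset_convexHull (mem_cells.1 hS).1 (mem_cells.1 hT).1 ⟨hyS, hyT⟩
  refine affine_eqOn_convexHull (s := (S : Set Plane) ∩ T) ?_ hy
  rintro v ⟨hvS, hvT⟩
  rw [bary_vertex hS x hvS, bary_vertex hT x hvT]

theorem mem_of_bary_ne_zero {T : Finset Plane} (hT : T ∈ M.cells) {x y : Plane}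
    (h : bary hT x y ≠ 0) : x ∈ T := by
  by_contra hx
  exact h (by simp [bary, hx])

theorem bary_homothety {T : Finset Plane} (hT : T ∈ M.cells) (v x y : Plane) (t : ℝ) :
    bary hT v (AffineMap.lineMap x y t) = (1 - t) * bary hT v x + t * bary hT v y := by
  rw [AffineMap.apply_lineMap, AffineMap.lineMap_apply_ring]

/-- The open star of a vertex that lies in the interior of the closure of `Ω` stays there. -/
theorem star_mem_interior {T : Finset Plane} (hT : T ∈ M.cells) {x y : Plane}
    (hx : x ∈ interior (closure Ω)) (hy : y ∈ hull T) (hpos : 0 < bary hT x y) :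
    y ∈ interior (closure Ω) := by
  classical
  have hxT : x ∈ T := mem_of_bary_ne_zero hT hpos.ne'
  have hline : Continuous (fun t : ℝ => AffineMap.lineMap (k := ℝ) x y t) :=
    AffineMap.lineMap_continuous
  have hnear : ∀ᶠ t in 𝓝 (0 : ℝ), AffineMap.lineMap (k := ℝ) x y t ∈ interior (closure Ω) := by
    refine hline.continuousAt.eventually_mem ?_
    simpa using isOpen_interior.mem_nhds hx
  obtain ⟨t, ⟨ht1, ht0⟩, htlt⟩ : ∃ t : ℝ,
      (AffineMap.lineMap (k := ℝ) x y t ∈ interior (closure Ω) ∧ 0 < t) ∧ t < 1 := by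
    have h1 : ∀ᶠ t in 𝓝[>] (0 : ℝ), AffineMap.lineMap (k := ℝ) x y t ∈ interior (closure Ω) :=
      nhdsWithin_le_nhds hnear
    have h2 : ∀ᶠ t in 𝓝[>] (0 : ℝ), 0 < t := self_mem_nhdsWithin
    have h3 : ∀ᶠ t in 𝓝[>] (0 : ℝ), t < 1 :=
      nhdsWithin_le_nhds (gt_mem_nhds (by norm_num))
    exact ((h1.and h2).and h3).exists
  set w : Plane := AffineMap.lineMap (k := ℝ) x y t with hw
  have hxhull : x ∈ hull T := subset_convexHull ℝ _ hxT
  have hwT : w ∈ hull T :=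
    (convex_convexHull ℝ _).lineMap_mem hxhull hy ⟨ht0.le, htlt.le⟩
  have hbx : bary hT x x = 1 := by simp [bary_vertex hT x hxT]
  have hcont : ContinuousAt (fun z : Plane => AffineMap.lineMap (k := ℝ) x z t) y := by
    have : Continuous (fun z : Plane => AffineMap.lineMap (k := ℝ) x z t) := by
      simp only [AffineMap.lineMap_apply_module]
      fun_prop
    exact this.continuousAt
  have e1 : ∀ᶠ z in 𝓝 y, AffineMap.lineMap (k := ℝ) x z t ∈ closure Ω :=
    hcont.eventually_mem (Filter.mem_of_superset (isOpen_interior.mem_nhds ht1) interior_subset)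
  have e2 : ∀ S ∈ M.cells, ∀ᶠ z in 𝓝 y,
      AffineMap.lineMap (k := ℝ) x z t ∈ hull S → w ∈ hull S := by
    intro S _
    by_cases hwS : w ∈ hull S
    · exact Filter.Eventually.of_forall fun _ _ => hwS
    · have hcl : IsClosed (hull S) := (S.finite_toSet.isCompact_convexHull ℝ).isClosed
      have := hcont.eventually_mem (hcl.isOpen_compl.mem_nhds hwS)
      filter_upwards [this] with z hz hz2
      exact absurd hz2 hz
  have e3 : ∀ S, ∀ hS : S ∈ M.cells, ∀ᶠ z in 𝓝 y, w ∈ hull S → 0 < bary hS x z ∧ x ∈ S := by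
    intro S hS
    by_cases hwS : w ∈ hull S
    · have hag : bary hS x w = bary hT x w := bary_agree hS hT x hwS hwT
      have hTw : bary hT x w = (1 - t) * 1 + t * bary hT x y := by
        rw [hw, bary_homothety, hbx]
      have hwpos : 0 < bary hT x w := by
        rw [hTw]
        have := mul_pos ht0 hpos
        linarith
      have hxS : x ∈ S := mem_of_bary_ne_zero hS (by rw [hag]; exact hwpos.ne')
      have hSw : bary hS x w = (1 - t) * 1 + t * bary hS x y := by
        rw [hw, bary_homothety]
        simp [bary_vertex hS x hxS]
      have hSy : bary hS x y = bary hT x y := by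
        have : t * bary hS x y = t * bary hT x y := by linarith
        exact mul_left_cancel₀ ht0.ne' this
      have : ∀ᶠ z in 𝓝 y, 0 < bary hS x z :=
        (bary_continuous hS x).continuousAt.eventually (lt_mem_nhds (by rw [hSy]; exact hpos))
      filter_upwards [this] with z hz _
      exact ⟨hz, hxS⟩
    · exact Filter.Eventually.of_forall fun _ h => absurd h hwS
  have e2b := (Filter.eventually_all_finset M.cells).2 e2
  have e3b := (Filter.eventually_all_finset M.cells.attach).2
    (fun S _ => e3 S.1 S.2)
  rw [mem_interior_iff_mem_nhds]
  filter_upwards [e1, e2b, e3b] with z h1 h2 h3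
  rw [closure_eq (M := M)] at h1
  simp only [Set.mem_iUnion, exists_prop] at h1
  obtain ⟨S, hS, hzS⟩ := h1
  obtain ⟨hp, hxS⟩ := h3 ⟨S, hS⟩ (Finset.mem_attach _ _) (h2 S hS hzS)
  have hzz : z ∈ hull S := by
    rw [mem_hull_iff hS] at hzS ⊢
    intro v
    have hv : bary hS v z = (cellBasis hS).coord v z := by simp [bary]
    by_cases hvx : (v : Plane) = x
    · rw [← hv, hvx]
      exact hp.le
    · have h4 := hzS v
      have hv2 : bary hS v (AffineMap.lineMap (k := ℝ) x z t)
          = (cellBasis hS).coord v (AffineMap.lineMap (k := ℝ) x z t) := by simp [bary]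
      rw [← hv2, bary_homothety, bary_vertex hS v hxS, if_neg (fun e => hvx e.symm)] at h4
      rw [← hv]
      have h5 : 0 ≤ t * bary hS v z := by linarith
      exact nonneg_of_mul_nonneg_right h5 ht0
  rw [closure_eq (M := M)]
  simp only [Set.mem_iUnion, exists_prop]
  exact ⟨S, hS, hzz⟩

/-- For a vertex in the (regular open) domain the nodal basis function exists. -/
theorem exists_isNodal (hΩ : interior (closure Ω) = Ω) {x : Plane} (hx : x ∈ Ω) :
    ∃ v, M.IsNodal x v := by
  classical
  let v : Plane → ℝ := fun y =>
    if h : ∃ T, ∃ _ : T ∈ M.cells, y ∈ hull T then bary h.choose_spec.choose x y else 0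
  have hv : ∀ T, ∀ hT : T ∈ M.cells, ∀ y ∈ hull T, v y = bary hT x y := by
    intro T hT y hy
    have h : ∃ T, ∃ _ : T ∈ M.cells, y ∈ hull T := ⟨T, hT, hy⟩
    have : v y = bary h.choose_spec.choose x y := dif_pos h
    rw [this]
    exact bary_agree _ hT x h.choose_spec.choose_spec hy
  refine ⟨v, ⟨?_, ?_, fun T hT => ⟨bary hT x, fun y hy => hv T hT y hy⟩⟩, ?_⟩
  · rw [closure_eq (M := M)]
    have : (⋃ T ∈ M.cells, hull T) = ⋃ T : M.cells, hull T.1 := by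
      rw [Set.iUnion_subtype]
    rw [this]
    refine LocallyFinite.continuousOn_iUnion (locallyFinite_of_finite _) ?_ ?_
    · exact fun T => (T.1.finite_toSet.isCompact_convexHull ℝ).isClosed
    · exact fun T => ((bary_continuous T.2 x).continuousOn).congr (hv T.1 T.2)
  · intro y hy
    have hyc : y ∈ ⋃ T ∈ M.cells, hull T := by
      rw [← closure_eq]
      exact frontier_subset_closure hy
    simp only [Set.mem_iUnion, exists_prop] at hyc
    obtain ⟨T, hT, hyT⟩ := hyc
    rw [hv T hT y hyT]
    have hnn : 0 ≤ bary hT x y := by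
      unfold bary
      split_ifs with h
      · exact (mem_hull_iff hT).1 hyT _
      · simp
    by_contra hne
    have := star_mem_interior hT (by rw [hΩ]; exact hx) hyT (lt_of_le_of_ne hnn (Ne.symm hne))
    rw [hΩ] at this
    have ho : IsOpen Ω := by rw [← hΩ]; exact isOpen_interior
    rw [ho.frontier_eq] at hy
    exact hy.2 this
  · intro y hy
    simp only [vertices, Finset.mem_biUnion, id] at hy
    obtain ⟨T, hT, hyT⟩ := hy
    rw [hv T hT y (subset_convexHull ℝ _ hyT), bary_vertex hT x hyT]

theorem isNodal_nodal (hΩ : interior (closure Ω) = Ω) {x : Plane} (hx : x ∈ Ω) :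
    M.IsNodal x (M.nodal x) :=
  Classical.epsilon_spec (exists_isNodal hΩ hx)

end Triangulation

/-! ### Interfaces -/

/-- `Γ` is a connected interface that separates `Ω` into the subdomains `sub 0` and `sub 1`.
The interface is allowed to reach the boundary of `Ω`. -/
structure IsInterface (Ω : Set Plane) (sub : Fin 2 → Set Plane) (Γ : Set Plane) : Prop where
  isOpen : ∀ i, IsOpen (sub i)
  disjoint : Disjoint (sub 0) (sub 1)
  union_eq : sub 0 ∪ sub 1 = Ω \ Γ
  eq_inter : Γ = closure (sub 0) ∩ closure (sub 1)
  connected : IsConnected Γ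

/-- `n` is the unit normal at `y` of the common boundary of `A` and `B`, pointing from `A` to `B`:
near `y`, the sets `A` and `B` contain the respective halves of every double cone with axis `n`. -/
def IsNormalAt (A B : Set Plane) (y n : Plane) : Prop :=
  ‖n‖ = 1 ∧ ∀ ε > 0, ∃ r > 0, ∀ z : Plane, ‖z - y‖ < r →
    (inner ℝ (z - y) n < -(ε * ‖z - y‖) → z ∈ A) ∧ (ε * ‖z - y‖ < inner ℝ (z - y) n → z ∈ B)

open Classical in
/-- The unit normal field (zero at the points where there is no normal). -/
def normalField (A B : Set Plane) (y : Plane) : Plane :=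
  if h : ∃ n, IsNormalAt A B y n then h.choose else 0

/-- The curve `Γ` cuts the triangle `T` in a single arc that meets the boundary of `T` in exactly
two points `p`, `q`, which do not lie on a common edge, and that is the graph of a function with
Lipschitz constant `L` over the chord from `p` to `q`. -/
def IsGraphOverChord (Γ : Set Plane) (L : ℝ) (T : Finset Plane) : Prop :=
  ∃ (p q ν : Plane) (g : ℝ → ℝ),
    p ∈ frontier (hull T) ∧ q ∈ frontier (hull T) ∧
    (∀ e ⊆ T, e.card = 2 → ¬ (p ∈ hull e ∧ q ∈ hull e)) ∧
    ‖ν‖ = 1 ∧ inner ℝ ν (q - p) = 0 ∧ g 0 = 0 ∧ g 1 = 0 ∧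
    (∀ s ∈ Set.Icc (0 : ℝ) 1, ∀ t ∈ Set.Icc (0 : ℝ) 1, |g s - g t| ≤ L * ‖q - p‖ * |s - t|) ∧
    (∀ t ∈ Set.Ioo (0 : ℝ) 1, p + t • (q - p) + g t • ν ∈ interior (hull T)) ∧
    hull T ∩ Γ = (fun t : ℝ => p + t • (q - p) + g t • ν) '' Set.Icc (0 : ℝ) 1

/-- Every disc of radius `r ≤ r₀` around a point of `Γ` contains a disc of radius `θ * r` that does
not meet `Γ`. Lipschitz curves have this property. -/
def IsUniformlyPorous (Γ : Set Plane) (θ r₀ : ℝ) : Prop :=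
  ∀ y ∈ Γ, ∀ r, 0 < r → r ≤ r₀ → ∃ z, Metric.closedBall z (θ * r) ⊆ Metric.closedBall y r \ Γ

/-! ### The discretization on one level -/

/-- A triangulation with mesh size `h`, together with a (discrete) interface `Γ` and the
corresponding cut subdomains. -/
structure CutMesh (Ω : Set Plane) where
  mesh : Triangulation Ω
  h : ℝ
  sub : Fin 2 → Set Plane
  Γ : Set Plane
  isInterface : IsInterface Ω sub Γ

namespace CutMesh

variable {Ω : Set Plane} (K : CutMesh Ω)

/-- The extended subdomain: the union of all triangles that meet the subdomain `i`. -/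
def extended (i : Fin 2) : Set Plane :=
  ⋃ T ∈ K.mesh.cells, ⋃ _ : (hull T ∩ K.sub i).Nonempty, hull T

/-- The triangle `T` is cut by the interface. -/
def IsCut (T : Finset Plane) : Prop := 0 < μH[1] (hull T ∩ K.Γ)

/-- The unit normal on the interface, pointing from `sub 0` to `sub 1`. -/
def normal (y : Plane) : Plane := normalField (K.sub 0) (K.sub 1) y

/-!
An element of the unfitted finite element space is represented by the pair `u = (u 0, u 1)` of
finite element functions of which `u i` is relevant on the extended subdomain `i`.
-/

/-- The weights `|T_i| / |T|` of the average. -/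
def weight (T : Finset Plane) (i : Fin 2) : ℝ :=
  volume.real (hull T ∩ K.sub i) / volume.real (hull T)

/-- The jump across the interface. -/
def jump (u : Fin 2 → Plane → ℝ) (y : Plane) : ℝ := u 0 y - u 1 y

/-- The average of the flux `- μ ∇u · n` on the part of the interface in `T`. -/
def meanFlux (μ : Fin 2 → ℝ) (T : Finset Plane) (u : Fin 2 → Plane → ℝ) (y : Plane) : ℝ :=
  ∑ i, K.weight T i * (-(μ i * inner ℝ (gradient (u i) y) (K.normal y)))

/-- The contribution of the triangle `T` to `(μ ∇u, ∇v)`. -/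
def aCell (μ : Fin 2 → ℝ) (T : Finset Plane) (u v : Fin 2 → Plane → ℝ) : ℝ :=
  ∑ i, ∫ y in hull T ∩ K.sub i, μ i * inner ℝ (gradient (u i) y) (gradient (v i) y)

/-- The contribution of `T` to the consistency term `({- μ ∇u · n}, [v])_Γ`. -/
def ncCell (μ : Fin 2 → ℝ) (T : Finset Plane) (u v : Fin 2 → Plane → ℝ) : ℝ :=
  ∫ y in hull T ∩ K.Γ, K.meanFlux μ T u y * jump v y ∂μH[1]

/-- The contribution of `T` to the penalty term `(lam / h) ([u], [v])_Γ`. -/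
def nsCell (lam : ℝ) (T : Finset Plane) (u v : Fin 2 → Plane → ℝ) : ℝ :=
  lam / K.h * ∫ y in hull T ∩ K.Γ, jump u y * jump v y ∂μH[1]

/-- The bilinear form `a_h` of the Nitsche CutFEM with penalty parameter `lam`. -/
def nitscheForm (μ : Fin 2 → ℝ) (lam : ℝ) (u v : Fin 2 → Plane → ℝ) : ℝ :=
  ∑ T ∈ K.mesh.cells,
    (K.aCell μ T u v + K.ncCell μ T u v + K.ncCell μ T v u + K.nsCell lam T u v)

/-- The pairs of polynomials of degree one that are orthogonal to the constants on the two parts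
of the triangle `T`. -/
def localSpace (T : Finset Plane) : Set (Fin 2 → Plane → ℝ) :=
  {v | ∀ i, (∃ f : Plane →ᵃ[ℝ] ℝ, v i = f) ∧ ∫ y in hull T ∩ K.sub i, v i y = 0}

/-- `w` solves the local problem `a_T(w, v) = N_T^c(v, u)` for all `v` in the local space. -/
def IsLifting (μ : Fin 2 → ℝ) (T : Finset Plane) (u w : Fin 2 → Plane → ℝ) : Prop :=
  w ∈ K.localSpace T ∧ ∀ v ∈ K.localSpace T, K.aCell μ T w v = K.ncCell μ T v u

open Classical in
/-- The lifting operator: the solution of the local problem on cut triangles, zero otherwise. -/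
def lifting (μ : Fin 2 → ℝ) (T : Finset Plane) (u : Fin 2 → Plane → ℝ) : Fin 2 → Plane → ℝ :=
  if K.IsCut T then Classical.epsilon (K.IsLifting μ T u) else 0

/-- The bilinear form of the parameter-free CutFEM. -/
def paramFreeForm (μ : Fin 2 → ℝ) (u v : Fin 2 → Plane → ℝ) : ℝ :=
  ∑ T ∈ K.mesh.cells,
    (K.aCell μ T u v + K.ncCell μ T u v + K.ncCell μ T v u
      + 2 * K.aCell μ T (K.lifting μ T u) (K.lifting μ T v) + K.nsCell 1 T u v)

open Classical in
/-- The vertices of the triangulation in `Ω` (those that carry degrees of freedom). -/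
def interiorVertices : Finset Plane := K.mesh.vertices.filter (fun x => x ∈ Ω)

open Classical in
/-- The vertices with exactly two degrees of freedom: those in one subdomain `i` which belong to a
triangle that meets the other subdomain. -/
def interfaceVertices : Finset Plane :=
  K.mesh.vertices.filter (fun x => ∃ i j, i ≠ j ∧ x ∈ K.sub i ∧
    ∃ T ∈ K.mesh.cells, x ∈ T ∧ (hull T ∩ K.sub j).Nonempty)

theorem sub_subset (i : Fin 2) : K.sub i ⊆ Ω := by
  intro x hx
  have hmem : x ∈ K.sub 0 ∪ K.sub 1 := by
    fin_cases i
    · exact Or.inl hx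
    · exact Or.inr hx
  rw [K.isInterface.union_eq] at hmem
  exact hmem.1

theorem mem_interior_of_mem_interface {x : Plane} (hx : x ∈ K.interfaceVertices) :
    x ∈ K.interiorVertices := by
  simp only [interfaceVertices, Finset.mem_filter] at hx
  obtain ⟨hv, i, _, _, hi, _⟩ := hx
  simp only [interiorVertices, Finset.mem_filter]
  exact ⟨hv, K.sub_subset i hi⟩

/-- Indices of the XFEM basis: one nodal function for each vertex in `Ω` and one cut function for
each vertex with two degrees of freedom. -/
abbrev DofIndex : Type := {x // x ∈ K.interiorVertices} ⊕ {x // x ∈ K.interfaceVertices}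

/-- Indices of the degrees of freedom that belong to the vertices at the interface. -/
abbrev LocalIndex : Type := {x // x ∈ K.interfaceVertices} ⊕ {x // x ∈ K.interfaceVertices}

open Classical in
/-- The XFEM basis: the nodal functions, and the cut functions, that is, for a vertex in the
subdomain `i`, the restriction of its nodal function to the complement of the subdomain `i`. -/
def xfemBasis : K.DofIndex → Fin 2 → Plane → ℝ
  | .inl x => fun _ => K.mesh.nodal x
  | .inr x => fun i => if (x : Plane) ∈ K.sub i then 0 else K.mesh.nodal x

/-- The stiffness matrix of a bilinear form with respect to the XFEM basis. -/
def stiffness (b : (Fin 2 → Plane → ℝ) → (Fin 2 → Plane → ℝ) → ℝ) :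
    Matrix K.DofIndex K.DofIndex ℝ :=
  Matrix.of fun r s => b (K.xfemBasis s) (K.xfemBasis r)

/-- The inclusion of the interface degrees of freedom in all degrees of freedom. -/
def localToGlobal : K.LocalIndex → K.DofIndex :=
  Sum.map (fun x => ⟨x.1, K.mem_interior_of_mem_interface x.2⟩) id

/-- The local interface matrix. -/
def interfaceMatrix (b : (Fin 2 → Plane → ℝ) → (Fin 2 → Plane → ℝ) → ℝ) :
    Matrix K.LocalIndex K.LocalIndex ℝ :=
  (K.stiffness b).submatrix K.localToGlobal K.localToGlobal

end CutMesh

/-! ### Families of discretizations -/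

/-- An interface `Γ` in `Ω` and a sequence of triangulations and discrete interfaces. -/
structure UnfittedFamily (Ω : Set Plane) where
  sub : Fin 2 → Set Plane
  Γ : Set Plane
  isInterface : IsInterface Ω sub Γ
  level : ℕ → CutMesh Ω

/-- The standing assumptions on the triangulations and on the interfaces. -/
structure UnfittedFamily.Admissible {Ω : Set Plane} (F : UnfittedFamily Ω)
    (σ L c d₀ θ r₀ : ℝ) : Prop where
  /-- the triangulations are nested -/
  nested : ∀ l, ∀ S ∈ (F.level (l + 1)).mesh.cells, ∃ T ∈ (F.level l).mesh.cells, hull S ⊆ hull T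
  /-- the triangulations are quasi-uniform (hence shape regular) -/
  quasiUniform : ∀ l, ∀ T ∈ (F.level l).mesh.cells, Metric.diam (hull T) ≤ (F.level l).h ∧
    ∃ z, Metric.closedBall z (σ * (F.level l).h) ⊆ hull T
  /-- the discrete interfaces are second order accurate -/
  dist_le : ∀ l, Metric.hausdorffDist F.Γ (F.level l).Γ ≤ c * (F.level l).h ^ 2
  /-- the extended subdomains are nested -/
  extended_subset : ∀ l i, (F.level (l + 1)).extended i ⊆ (F.level l).extended i
  /-- the intersection of a triangle and the interface is not a subsimplex -/
  not_subsimplex : ∀ l, ∀ T ∈ (F.level l).mesh.cells, (hull T ∩ (F.level l).Γ).Nonempty →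
    ∀ s ⊆ T, s.Nonempty → hull T ∩ (F.level l).Γ ≠ hull s
  /-- every vertex in `Ω` lies in one of the two subdomains -/
  vertex_notMem : ∀ l, ∀ x ∈ (F.level l).interiorVertices, x ∉ (F.level l).Γ
  /-- the discrete interface is resolved by the triangulation -/
  graph : ∀ l, ∀ T ∈ (F.level l).mesh.cells, (hull T ∩ (F.level l).Γ).Nonempty →
    IsGraphOverChord (F.level l).Γ L T
  /-- the discrete interface is not small compared with the mesh size -/
  diam_ge : ∀ l, d₀ * (F.level l).h ≤ Metric.diam (F.level l).Γ
  /-- the interface is nowhere dense in a uniform way -/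
  porous : IsUniformlyPorous F.Γ θ r₀

/-! ### Conditioning -/

open Classical in
/-- The spectral condition number of a matrix with positive real eigenvalues: the quotient of the
largest and the smallest eigenvalue. -/
def spectralCond {ι : Type*} [Fintype ι] (B : Matrix ι ι ℝ) : ℝ :=
  sSup (spectrum ℝ B) / sInf (spectrum ℝ B)

open Classical in
/-- The matrix `A` is symmetric positive definite, it is spectrally equivalent to its diagonal `D`
with constants `C⁻¹` and `C`, and the spectral condition number of `D⁻¹ A` is at most `C`. -/
def WellConditioned {ι : Type*} [Fintype ι] (A : Matrix ι ι ℝ) (C : ℝ) : Prop :=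
  A.PosDef ∧
  (∀ v : ι → ℝ,
    C⁻¹ * (v ⬝ᵥ (Matrix.diagonal A.diag).mulVec v) ≤ v ⬝ᵥ A.mulVec v ∧
    v ⬝ᵥ A.mulVec v ≤ C * (v ⬝ᵥ (Matrix.diagonal A.diag).mulVec v)) ∧
  spectralCond ((Matrix.diagonal A.diag)⁻¹ * A) ≤ C

end CutFEM

end

noncomputable section
namespace CutFEM

/-! The link between the matrix and its diagonal is the local energy `CutMesh.energy` of a pair of
affine functions on a triangle T: the squared gradients, weighted with h² and with the fraction κ_i
of T in the subdomain i, plus the squared L² norm of the jump on Γ ∩ T divided by h. Two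
equivalences are shown, with constants that do not see the position of Γ: the forms are equivalent
to the energy, and the energy of a function is equivalent to the sum of its squared coefficients
times the energies of the basis functions. `WellConditioned.of_bounds` turns this into the claim.

The first equivalence is local (`le_cellForm`, `cellForm_le`). Gradients are constant on T, so the
consistency terms only involve the vector J = ∫ [f] n over Γ ∩ T. The flux carries the same weight
κ_i as the gradient energy; hence Young's inequality absorbs it and leaves a multiple of κ_i
|J|²/|T|, without any inverse estimate on a small part of T. As Γ ∩ T has length at most (1 + L)h,
the Cauchy-Schwarz inequality bounds |J|²/|T| by the jump term, and a large λ pays for it. In the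
parameter-free form the lifting has the gradient -J/|T| on each part of positive area, so twice its
energy cancels exactly what Young's inequality leaves.

In the second equivalence one direction is a count of overlaps (`totalEnergy_le`). For the other,
the coefficient of a nodal function is the value U(x) of the function on the own side of x, because
the cut function of x vanishes there. Nodal functions have bounded energy in two dimensions, so the
sum of U(x)² has to be bounded by the energy. Within one triangle the values U are compared by means
of `Regular.integral_edge_le`, which controls an affine function on an edge by its trace on Γ and by
its gradient on the region in between. This fails only if Γ cuts off a small corner x. But Γ is
connected and not small compared with h, so it does not do this in all triangles around x
(`abs_sub_le_of_shortAt`). By porosity there is a triangle with a vertex off the interface layer,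
where U vanishes, within a bounded number of mesh sizes (`Admissible.reaches`), and a chain of
triangles leads there (`abs_le_of_reaches`).

After the nodal part has been subtracted, each component vanishes at the vertices in its own
subdomain, and `energy_single_le` splits the rest into single cut functions, triangle by triangle.
The critical case is a small part with two free values, at y and z: near the corner x, on an arc of
relative size e, the coordinate of z has a trace energy of order e³, and the edge estimate bounds
precisely e³ times the squared value at z (`ifc_split_le`). -/

/-! ### Affine functions on the plane -/

/-- The gradient of an affine function. -/
def agrad : (Plane →ᵃ[ℝ] ℝ) →ₗ[ℝ] Plane :=
  ((InnerProductSpace.toDual ℝ Plane).symm.toLinearEquiv.toLinearMap ∘ₗ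
    (LinearMap.toContinuousLinearMap (𝕜 := ℝ) (E := Plane) (F' := ℝ)).toLinearMap) ∘ₗ
    { toFun := fun f => f.linear
      map_add' := fun _ _ => rfl
      map_smul' := fun _ _ => rfl }

theorem inner_agrad (f : Plane →ᵃ[ℝ] ℝ) (v : Plane) : inner ℝ (agrad f) v = f.linear v := by
  simp [agrad]

theorem apply_sub_apply (f : Plane →ᵃ[ℝ] ℝ) (x y : Plane) :
    f x - f y = inner ℝ (agrad f) (x - y) := by
  rw [inner_agrad]
  have := f.linearMap_vsub x y
  simpa using this.symm

theorem abs_apply_sub_le (f : Plane →ᵃ[ℝ] ℝ) (x y : Plane) :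
    |f x - f y| ≤ ‖agrad f‖ * dist x y := by
  rw [apply_sub_apply, dist_eq_norm]
  exact abs_real_inner_le_norm _ _

theorem sq_apply_sub_le (f : Plane →ᵃ[ℝ] ℝ) {x y : Plane} {h : ℝ} (hd : dist x y ≤ h) :
    (f x - f y) ^ 2 ≤ h ^ 2 * ‖agrad f‖ ^ 2 := by
  rw [← sq_abs (f x - f y), ← mul_pow, mul_comm h]
  have h1 := abs_apply_sub_le f x y
  have h2 : ‖agrad f‖ * dist x y ≤ ‖agrad f‖ * h := by gcongr
  exact pow_le_pow_left₀ (abs_nonneg _) (h1.trans h2) 2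

theorem continuous_affine (f : Plane →ᵃ[ℝ] ℝ) : Continuous f := f.continuous_of_finiteDimensional

theorem hasGradientAt_affine (f : Plane →ᵃ[ℝ] ℝ) (y : Plane) : HasGradientAt f (agrad f) y := by
  have h : (f : Plane → ℝ) = fun z => inner ℝ (agrad f) z + f 0 := by
    ext z
    have := apply_sub_apply f z 0
    rw [sub_zero] at this
    linarith
  rw [h, hasGradientAt_iff_hasFDerivAt]
  have h2 := ((InnerProductSpace.toDual ℝ Plane (agrad f)).hasFDerivAt (x := y)).add_const (f 0)
  exact h2

theorem gradient_eq_agrad {s : Set Plane} {u : Plane → ℝ} {f : Plane →ᵃ[ℝ] ℝ}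
    (hu : Set.EqOn u f s) {y : Plane} (hy : y ∈ interior s) : gradient u y = agrad f := by
  have h : u =ᶠ[𝓝 y] f := Filter.mem_of_superset (isOpen_interior.mem_nhds hy)
    (fun z hz => hu (interior_subset hz))
  exact ((hasGradientAt_affine f y).congr_of_eventuallyEq h).gradient

/-- The affine function with given gradient that vanishes at a given point. -/
def linAt (G m : Plane) : Plane →ᵃ[ℝ] ℝ :=
  (innerₛₗ ℝ G).toAffineMap.comp (AffineMap.id ℝ Plane - AffineMap.const ℝ Plane m)

theorem linAt_apply (G m y : Plane) : linAt G m y = inner ℝ G (y - m) := by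
  simp [linAt]

theorem agrad_linAt (G m : Plane) : agrad (linAt G m) = G := by
  refine ext_inner_right ℝ fun v => ?_
  have := apply_sub_apply (linAt G m) (m + v) m
  rw [linAt_apply, linAt_apply] at this
  simpa using this.symm

/-- An affine function on a ball with values in an interval of length `b` has a small gradient. -/
theorem norm_agrad_le {f : Plane →ᵃ[ℝ] ℝ} {z : Plane} {r b : ℝ} (hr : 0 < r)
    (hf : ∀ y ∈ Metric.closedBall z r, |f y| ≤ b) : ‖agrad f‖ ≤ b / r := by
  have hb : 0 ≤ b := (abs_nonneg _).trans (hf z (Metric.mem_closedBall_self hr.le))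
  by_cases h0 : agrad f = 0
  · rw [h0, norm_zero]
    positivity
  have hn : 0 < ‖agrad f‖ := norm_pos_iff.2 h0
  set e : Plane := (r / ‖agrad f‖) • agrad f with he
  have hen : ‖e‖ = r := by
    rw [he, norm_smul, Real.norm_of_nonneg (by positivity)]
    field_simp
  have h1 := hf (z + e) (by simp [hen])
  have h2 := hf (z - e) (by simp [hen])
  have h3 := apply_sub_apply f (z + e) (z - e)
  have h4 : z + e - (z - e) = (2 : ℝ) • e := by rw [two_smul]; abel
  have h5 : inner ℝ (agrad f) ((2 : ℝ) • e) = 2 * (r * ‖agrad f‖) := by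
    rw [he, inner_smul_right, inner_smul_right, real_inner_self_eq_norm_sq]
    field_simp
  rw [h4, h5] at h3
  rw [le_div_iff₀ hr]
  have := abs_le.1 h1
  have := abs_le.1 h2
  linarith

/-! ### The normal field -/

/-- If the two normals differed, a short step along `n - n'` would lie in the cone of `B` for `n`
and in the cone of `A` for `n'`, hence in two disjoint sets. -/
theorem IsNormalAt.unique {A B : Set Plane} (hAB : Disjoint A B) {y n n' : Plane}
    (h : IsNormalAt A B y n) (h' : IsNormalAt A B y n') : n = n' := by
  by_contra hne
  -- a direction that is positive for one and negative for the other
  obtain ⟨h1, h2⟩ := h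
  obtain ⟨h1', h2'⟩ := h'
  set d : Plane := n - n' with hd
  have hd0 : 0 < ‖d‖ := norm_pos_iff.2 (sub_ne_zero.2 hne)
  have hin : inner ℝ n n' = 1 - ‖d‖ ^ 2 / 2 := by
    have := norm_sub_sq_real n n'
    rw [h1, h1', ← hd] at this
    linarith
  have e1 : inner ℝ d n = ‖d‖ ^ 2 / 2 := by
    rw [hd, inner_sub_left, real_inner_self_eq_norm_sq, h1, real_inner_comm, hin]
    ring
  have e2 : inner ℝ d n' = -(‖d‖ ^ 2 / 2) := by
    rw [hd, inner_sub_left, real_inner_self_eq_norm_sq, h1', hin]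
    ring
  obtain ⟨r, hr, H⟩ := h2 (‖d‖ / 4) (by positivity)
  obtain ⟨r', hr', H'⟩ := h2' (‖d‖ / 4) (by positivity)
  set t : ℝ := min r r' / (2 * ‖d‖) with ht
  have hm : 0 < min r r' := lt_min hr hr'
  have htp : 0 < t := by positivity
  have hz : y + t • d - y = t • d := by simp
  have hn : ‖t • d‖ = min r r' / 2 := by
    rw [norm_smul, Real.norm_of_nonneg htp.le, ht]
    field_simp
  have hn2 : ‖t • d‖ = t * ‖d‖ := by rw [norm_smul, Real.norm_of_nonneg htp.le]
  have hpos : 0 < t * ‖d‖ ^ 2 := by positivity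
  have k1 := (H (y + t • d) (by rw [hz, hn]; linarith [min_le_left r r'])).2 (by
    rw [hz, inner_smul_left, e1, hn2]
    simp only [conj_trivial]
    linarith)
  have k2 := (H' (y + t • d) (by rw [hz, hn]; linarith [min_le_right r r'])).1 (by
    rw [hz, inner_smul_left, e2, hn2]
    simp only [conj_trivial]
    linarith)
  exact Set.disjoint_left.1 hAB k2 k1

/-- The tolerance and the radius may be restricted to reciprocals of integers. For fixed ones the
condition on each `z` is closed in the point and the normal, so that the intersection over
uncountably many `z` is still closed. -/
theorem measurableSet_isNormalAt {A B : Set Plane} :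
    MeasurableSet {w : Plane × Plane | IsNormalAt A B w.1 w.2} := by
  have key : {w : Plane × Plane | IsNormalAt A B w.1 w.2} = {w | ‖w.2‖ = 1} ∩
      ⋂ k : ℕ, ⋃ m : ℕ, ⋂ z : Plane,
        {w | ‖z - w.1‖ < 1 / (m + 1 : ℝ) →
          (inner ℝ (z - w.1) w.2 < -(1 / (k + 1 : ℝ) * ‖z - w.1‖) → z ∈ A) ∧
          (1 / (k + 1 : ℝ) * ‖z - w.1‖ < inner ℝ (z - w.1) w.2 → z ∈ B)} := by
    ext ⟨y, n⟩
    simp only [IsNormalAt, Set.mem_ofPred_eq, Set.mem_inter_iff, Set.mem_iInter, Set.mem_iUnion]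
    refine and_congr_right fun _ => ⟨fun h k => ?_, fun h ε hε => ?_⟩
    · obtain ⟨r, hr, H⟩ := h (1 / (k + 1 : ℝ)) (by positivity)
      obtain ⟨m, hm⟩ := exists_nat_one_div_lt hr
      exact ⟨m, fun z hz => H z (hz.trans hm)⟩
    · obtain ⟨k, hk⟩ := exists_nat_one_div_lt hε
      obtain ⟨m, H⟩ := h k
      refine ⟨1 / (m + 1 : ℝ), by positivity, fun z hz => ?_⟩
      have h3 : 1 / (k + 1 : ℝ) * ‖z - y‖ ≤ ε * ‖z - y‖ := by gcongr
      exact ⟨fun h4 => (H z hz).1 (by linarith), fun h4 => (H z hz).2 (by linarith)⟩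
  rw [key]
  refine MeasurableSet.inter (measurableSet_eq_fun (by fun_prop) (by fun_prop)) ?_
  refine MeasurableSet.iInter fun k => MeasurableSet.iUnion fun m => IsClosed.measurableSet ?_
  refine isClosed_iInter fun z => ?_
  have e : {w : Plane × Plane | ‖z - w.1‖ < 1 / (m + 1 : ℝ) →
          (inner ℝ (z - w.1) w.2 < -(1 / (k + 1 : ℝ) * ‖z - w.1‖) → z ∈ A) ∧
          (1 / (k + 1 : ℝ) * ‖z - w.1‖ < inner ℝ (z - w.1) w.2 → z ∈ B)} =
      ({w | 1 / (m + 1 : ℝ) ≤ ‖z - w.1‖} ∪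
        ({w | -(1 / (k + 1 : ℝ) * ‖z - w.1‖) ≤ inner ℝ (z - w.1) w.2} ∪ {_w | z ∈ A}) ∩
        ({w | inner ℝ (z - w.1) w.2 ≤ 1 / (k + 1 : ℝ) * ‖z - w.1‖} ∪ {_w | z ∈ B})) := by
    ext w
    simp only [Set.mem_ofPred_eq, Set.mem_union, Set.mem_inter_iff, ← not_lt, ← imp_iff_not_or]
  rw [e]
  refine IsClosed.union (isClosed_le (by fun_prop) (by fun_prop)) (IsClosed.inter ?_ ?_)
  · exact IsClosed.union (isClosed_le (by fun_prop) (by fun_prop)) isClosed_const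
  · exact IsClosed.union (isClosed_le (by fun_prop) (by fun_prop)) isClosed_const

/-- By uniqueness the Borel set of pairs of a point and its normal projects injectively to the
points, so the Lusin-Souslin theorem applies. Measurability is what makes the jump times the normal
integrable on Γ. -/
theorem measurable_normalField {A B : Set Plane} (hAB : Disjoint A B) :
    Measurable (normalField A B) := by
  set R : Set (Plane × Plane) := {w | IsNormalAt A B w.1 w.2} with hR
  have hinj : Set.InjOn Prod.fst R := by
    rintro ⟨y, n⟩ h ⟨y', n'⟩ h' (rfl : y = y')
    exact Prod.ext rfl (IsNormalAt.unique hAB h h')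
  have hspec : ∀ y n, IsNormalAt A B y n → normalField A B y = n := by
    intro y n h
    have hex : ∃ n, IsNormalAt A B y n := ⟨n, h⟩
    rw [normalField, dif_pos hex]
    exact IsNormalAt.unique hAB hex.choose_spec h
  intro S hS
  have e : normalField A B ⁻¹' S = Prod.fst '' (R ∩ Prod.snd ⁻¹' S) ∪
      ((Prod.fst '' R)ᶜ ∩ {_y | (0 : Plane) ∈ S}) := by
    ext y
    simp only [Set.mem_preimage, Set.mem_union, Set.mem_image, Set.mem_inter_iff, Prod.exists,
      exists_and_right, exists_eq_right, Set.mem_compl_iff, Set.mem_ofPred_eq, hR]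
    by_cases hex : ∃ n, IsNormalAt A B y n
    · obtain ⟨n, hn⟩ := hex
      rw [hspec y n hn]
      constructor
      · exact fun h => Or.inl ⟨n, hn, h⟩
      · rintro (⟨n', hn', h⟩ | ⟨h, -⟩)
        · rwa [IsNormalAt.unique hAB hn hn']
        · exact absurd ⟨n, hn⟩ h
    · rw [normalField, dif_neg hex]
      constructor
      · exact fun h => Or.inr ⟨hex, h⟩
      · rintro (⟨n', hn', h⟩ | ⟨-, h⟩)
        · exact absurd ⟨n', hn'⟩ hex
        · exact h
  rw [e]
  have hRm : MeasurableSet R := measurableSet_isNormalAt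
  refine MeasurableSet.union ?_ (MeasurableSet.inter (MeasurableSet.compl ?_) (.const _))
  · exact (hRm.inter (measurable_snd hS)).image_of_measurable_injOn measurable_fst
      (hinj.mono Set.inter_subset_left)
  · exact hRm.image_of_measurable_injOn measurable_fst hinj

theorem norm_normalField_le (A B : Set Plane) (y : Plane) : ‖normalField A B y‖ ≤ 1 := by
  rw [normalField]
  split_ifs with h
  · exact h.choose_spec.1.le
  · simp

/-! ### Conditioning -/

/-- The bounds place all eigenvalues of D⁻¹A in [C⁻¹, C]. Their quotient is at most C / C⁻¹, hence
the square. -/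
theorem WellConditioned.of_bounds {ι : Type*} [Fintype ι] {A : Matrix ι ι ℝ} {C : ℝ} (hC : 1 ≤ C)
    (hsymm : A.IsSymm) (hpos : ∀ r, 0 < A r r)
    (hlow : ∀ v : ι → ℝ, ∑ r, A r r * v r ^ 2 ≤ C * (v ⬝ᵥ A.mulVec v))
    (hup : ∀ v : ι → ℝ, v ⬝ᵥ A.mulVec v ≤ C * ∑ r, A r r * v r ^ 2) :
    WellConditioned A (C ^ 2) := by
  classical
  have hC0 : 0 < C := by linarith
  have hCC : C ≤ C ^ 2 := by nlinarith
  have hD : ∀ v : ι → ℝ, v ⬝ᵥ (Matrix.diagonal A.diag).mulVec v = ∑ r, A r r * v r ^ 2 := by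
    intro v
    simp only [dotProduct, Matrix.mulVec_diagonal, Matrix.diag_apply]
    exact Finset.sum_congr rfl fun r _ => by ring
  have hDnn : ∀ v : ι → ℝ, 0 ≤ ∑ r, A r r * v r ^ 2 := fun v =>
    Finset.sum_nonneg fun r _ => mul_nonneg (hpos r).le (sq_nonneg _)
  have hDpos : ∀ v : ι → ℝ, v ≠ 0 → 0 < ∑ r, A r r * v r ^ 2 := by
    intro v hv
    obtain ⟨r, hr⟩ := Function.ne_iff.1 hv
    refine Finset.sum_pos' (fun r _ => mul_nonneg (hpos r).le (sq_nonneg _)) ⟨r, Finset.mem_univ _, ?_⟩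
    exact mul_pos (hpos r) (by have : v r ≠ 0 := hr; positivity)
  have hspec : ∀ t ∈ spectrum ℝ ((Matrix.diagonal A.diag)⁻¹ * A), C⁻¹ ≤ t ∧ t ≤ C := by
    intro t ht
    rw [← Matrix.spectrum_toLin', ← Module.End.hasEigenvalue_iff_mem_spectrum] at ht
    obtain ⟨v, hv⟩ := ht.exists_hasEigenvector
    have h1 := hv.apply_eq_smul
    have hv0 := hv.2
    rw [Matrix.toLin'_apply] at h1
    have hdet : IsUnit (Matrix.diagonal A.diag).det := by
      rw [Matrix.det_diagonal, isUnit_iff_ne_zero, Finset.prod_ne_zero_iff]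
      exact fun r _ => (hpos r).ne'
    -- Multiplication by D gives the generalised eigenvalue equation A v = t D v, which can be
    -- tested with v.
    have h2 : A.mulVec v = t • (Matrix.diagonal A.diag).mulVec v := by
      have := congrArg (Matrix.diagonal A.diag).mulVec h1
      rw [Matrix.mulVec_mulVec, ← mul_assoc, Matrix.mul_nonsing_inv _ hdet, one_mul,
        Matrix.mulVec_smul] at this
      exact this
    have h3 : v ⬝ᵥ A.mulVec v = t * ∑ r, A r r * v r ^ 2 := by
      rw [h2, dotProduct_smul, hD, smul_eq_mul]
    have h4 := hDpos v hv0
    have h5 := hlow v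
    have h6 := hup v
    rw [h3] at h5 h6
    constructor
    · rw [inv_le_iff_one_le_mul₀ hC0]
      by_contra hlt
      push Not at hlt
      nlinarith
    · by_contra hlt
      push Not at hlt
      nlinarith
  refine ⟨Matrix.PosDef.of_dotProduct_mulVec_pos ?_ ?_, fun v => ⟨?_, ?_⟩, ?_⟩
  · rw [Matrix.IsHermitian, Matrix.conjTranspose_eq_transpose_of_trivial]
    exact hsymm
  · intro v hv
    have h1 := hlow v
    have h2 := hDpos v hv
    simp only [star_trivial]
    by_contra hlt
    push Not at hlt
    nlinarith
  · rw [hD, inv_mul_le_iff₀ (by positivity)]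
    have h1 := hlow v
    have h2 := hDnn v
    have h3 : 0 ≤ v ⬝ᵥ A.mulVec v := by
      by_contra hlt
      push Not at hlt
      nlinarith
    nlinarith
  · rw [hD]
    have h1 := hup v
    have h2 := hDnn v
    nlinarith
  · unfold spectralCond
    by_cases hne : (spectrum ℝ ((Matrix.diagonal A.diag)⁻¹ * A)).Nonempty
    · have h1 : sSup (spectrum ℝ ((Matrix.diagonal A.diag)⁻¹ * A)) ≤ C :=
        csSup_le hne fun t ht => (hspec t ht).2
      have h2 : C⁻¹ ≤ sInf (spectrum ℝ ((Matrix.diagonal A.diag)⁻¹ * A)) :=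
        le_csInf hne fun t ht => (hspec t ht).1
      have h3 : 0 < C⁻¹ := inv_pos.2 hC0
      rw [div_le_iff₀ (h3.trans_le h2)]
      calc _ ≤ C := h1
        _ = C ^ 2 * C⁻¹ := by field_simp
        _ ≤ _ := by gcongr
    -- An empty spectrum, as for an empty index type, has supremum and infimum 0 by convention, and
    -- the quotient is 0 as well.
    · rw [Set.not_nonempty_iff_eq_empty.1 hne]
      simp
      positivity

/-- Chains in a finite set can be shortened, hence small steps add up to a bounded change. -/
theorem abs_sub_le_of_reflTransGen {α : Type*} (s : Finset α) (R : α → α → Prop) (f : α → ℝ)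
    {ε : ℝ} (hε : 0 ≤ ε) (hs : ∀ a b, R a b → a ∈ s ∧ b ∈ s)
    (hR : ∀ a b, R a b → |f a - f b| ≤ ε) {a b : α} (h : Relation.ReflTransGen R a b) :
    |f a - f b| ≤ s.card * ε := by
  classical
  -- the values along a chain, sorted: induct on the set of allowed points
  induction s using Finset.strongInduction generalizing R a with
  | H s ih =>
    rcases h.cases_head with rfl | ⟨c, hac, hcb⟩
    · simpa using by positivity
    · by_cases hab : a = b
      · subst hab
        simpa using by positivity
      -- take the last visit of `a`
      have key : ∀ c, Relation.ReflTransGen R c b →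
          Relation.ReflTransGen (fun p q => R p q ∧ p ≠ a ∧ q ≠ a) c b ∨
          ∃ c', R a c' ∧ Relation.ReflTransGen (fun p q => R p q ∧ p ≠ a ∧ q ≠ a) c' b := by
        intro c hc
        induction hc using Relation.ReflTransGen.head_induction_on with
        | refl => exact Or.inl .refl
        | head h' _ ih' =>
          rename_i p q _
          rcases ih' with ih' | ih'
          · by_cases hpa : p = a
            · subst hpa
              exact Or.inr ⟨_, h', ih'⟩
            · by_cases hqa : q = a
              · subst hqa
                rcases ih'.cases_head with h0 | ⟨d, ⟨-, hd, -⟩, -⟩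
                · exact absurd h0 hab
                · exact absurd rfl hd
              · exact Or.inl (.head ⟨h', hpa, hqa⟩ ih')
          · exact Or.inr ih'
      have h2 : ∃ c', R a c' ∧ Relation.ReflTransGen (fun p q => R p q ∧ p ≠ a ∧ q ≠ a) c' b := by
        rcases key c hcb with h3 | h3
        · exact ⟨c, hac, h3⟩
        · exact h3
      obtain ⟨c', hac', hcb'⟩ := h2
      have has := (hs _ _ hac').1
      have := ih (s.erase a) (Finset.erase_ssubset has) (fun p q => R p q ∧ p ≠ a ∧ q ≠ a)
        (fun p q hpq => ⟨Finset.mem_erase.2 ⟨hpq.2.1, (hs _ _ hpq.1).1⟩,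
          Finset.mem_erase.2 ⟨hpq.2.2, (hs _ _ hpq.1).2⟩⟩) (fun p q hpq => hR p q hpq.1) hcb'
      have h4 := hR _ _ hac'
      have h5 : (s.card : ℝ) = (s.erase a).card + 1 := by
        rw [Finset.card_erase_of_mem has, Nat.cast_sub (Finset.card_pos.2 ⟨a, has⟩)]
        simp
      rw [h5]
      calc |f a - f b| ≤ |f a - f c'| + |f c' - f b| := abs_sub_le _ _ _
        _ ≤ ε + (s.erase a).card * ε := by linarith
        _ = _ := by ring

/-! ### Affine functions of one variable -/

theorem integral_sq_affine (α β e : ℝ) :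
    ∫ t in (0 : ℝ)..e, (α + t * β) ^ 2 = e * α ^ 2 + e ^ 2 * α * β + e ^ 3 * β ^ 2 / 3 := by
  have h : ∀ t ∈ Set.uIcc 0 e, HasDerivAt
      (fun t : ℝ => t * α ^ 2 + t ^ 2 * (α * β) + t ^ 3 * (β ^ 2 / 3)) ((α + t * β) ^ 2) t := by
    intro t _
    have h1 := (hasDerivAt_id t).mul_const (α ^ 2)
    have h2 := (hasDerivAt_pow 2 t).mul_const (α * β)
    have h3 := (hasDerivAt_pow 3 t).mul_const (β ^ 2 / 3)
    refine ((h1.add h2).add h3).congr_deriv ?_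
    norm_num
    ring
  rw [intervalIntegral.integral_eq_sub_of_hasDerivAt h
    (Continuous.intervalIntegrable (by fun_prop) _ _)]
  ring

/-- Here and for the slope below, the difference of the two sides is a complete square. The power of
`e` is what an interval of length `e` can see: `e` for the value at 0, `e ^ 3` for the slope. -/
theorem sq_left_le_integral (α β : ℝ) {e : ℝ} (he : 0 ≤ e) :
    e * α ^ 2 ≤ 4 * ∫ t in (0 : ℝ)..e, (α + t * β) ^ 2 := by
  rw [integral_sq_affine]
  have : 0 ≤ e * (3 * α + 2 * (e * β)) ^ 2 := by positivity
  nlinarith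

theorem sq_slope_le_integral (α β : ℝ) {e : ℝ} (he : 0 ≤ e) :
    e ^ 3 * β ^ 2 ≤ 12 * ∫ t in (0 : ℝ)..e, (α + t * β) ^ 2 := by
  rw [integral_sq_affine]
  have : 0 ≤ e * (2 * α + e * β) ^ 2 := by positivity
  nlinarith

/-- The value at 1 is extrapolated from [0, e] by means of the slope, which costs the factor `e ^
3`. -/
theorem sq_right_le_integral (α β : ℝ) {e : ℝ} (he : 0 ≤ e) (he1 : e ≤ 1) :
    e ^ 3 * (α + β) ^ 2 ≤ 32 * ∫ t in (0 : ℝ)..e, (α + t * β) ^ 2 := by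
  have h1 := sq_left_le_integral α β he
  have h2 := sq_slope_le_integral α β he
  have h3 : e ^ 3 * α ^ 2 ≤ e * α ^ 2 := by
    have : e ^ 3 ≤ e := by nlinarith [mul_nonneg he he]
    gcongr
  have h4 : e ^ 3 * (α + β) ^ 2 ≤ 2 * (e ^ 3 * α ^ 2) + 2 * (e ^ 3 * β ^ 2) := by
    have : 0 ≤ e ^ 3 * (α - β) ^ 2 := by positivity
    nlinarith
  linarith

/-! ### Barycentric coordinates on the triangles -/

namespace Triangulation

variable {Ω : Set Plane} {M : Triangulation Ω} {T : Finset Plane}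

theorem bary_of_mem (hT : T ∈ M.cells) {v : Plane} (hv : v ∈ T) :
    bary hT v = (cellBasis hT).coord ⟨v, hv⟩ := by
  simp [bary, hv]

theorem bary_self (hT : T ∈ M.cells) {v : Plane} (hv : v ∈ T) : bary hT v v = 1 := by
  simp [bary_vertex hT v hv]

theorem bary_of_ne (hT : T ∈ M.cells) {v w : Plane} (hw : w ∈ T) (h : w ≠ v) :
    bary hT v w = 0 := by
  simp [bary_vertex hT v hw, h]

theorem sum_bary (hT : T ∈ M.cells) (y : Plane) : ∑ v ∈ T, bary hT v y = 1 := by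
  have h := (cellBasis hT).sum_coord_apply_eq_one y
  rw [← h, ← Finset.sum_coe_sort]
  exact Finset.sum_congr rfl fun v _ => by rw [bary_of_mem hT v.2]

theorem sum_bary_smul (hT : T ∈ M.cells) (y : Plane) : ∑ v ∈ T, bary hT v y • v = y := by
  have h := (cellBasis hT).linear_combination_coord_eq_self y
  conv_rhs => rw [← h]
  rw [← Finset.sum_coe_sort]
  exact Finset.sum_congr rfl fun v _ => by rw [bary_of_mem hT v.2]; rfl

theorem eq_sum_bary (hT : T ∈ M.cells) (f : Plane →ᵃ[ℝ] ℝ) (y : Plane) :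
    f y = ∑ v ∈ T, bary hT v y * f v := by
  have h : ∀ z, f z = f.linear z + f 0 := fun z => by
    have := f.linearMap_vsub z 0
    simp only [vsub_eq_sub, sub_zero] at this
    linarith
  calc f y = f.linear (∑ v ∈ T, bary hT v y • v) + (∑ v ∈ T, bary hT v y) * f 0 := by
        rw [sum_bary_smul, sum_bary, one_mul, h y]
    _ = _ := by
        rw [map_sum, Finset.sum_mul, ← Finset.sum_add_distrib]
        refine Finset.sum_congr rfl fun v _ => ?_
        rw [h v, map_smul, smul_eq_mul]
        ring

theorem affine_ext (hT : T ∈ M.cells) {f g : Plane →ᵃ[ℝ] ℝ} (h : ∀ v ∈ T, f v = g v) : f = g := by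
  ext y
  rw [eq_sum_bary hT f, eq_sum_bary hT g]
  exact Finset.sum_congr rfl fun v hv => by rw [h v hv]

theorem eq_of_bary_eq (hT : T ∈ M.cells) {y z : Plane}
    (h : ∀ v ∈ T, bary hT v y = bary hT v z) : y = z := by
  rw [← sum_bary_smul hT y, ← sum_bary_smul hT z]
  exact Finset.sum_congr rfl fun v hv => by rw [h v hv]

theorem mem_hull (hT : T ∈ M.cells) {y : Plane} : y ∈ hull T ↔ ∀ v ∈ T, 0 ≤ bary hT v y := by
  rw [mem_hull_iff hT]
  exact ⟨fun h v hv => by rw [bary_of_mem hT hv]; exact h ⟨v, hv⟩,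
    fun h v => by rw [← bary_of_mem hT v.2]; exact h v v.2⟩

theorem mem_interior_hull (hT : T ∈ M.cells) {y : Plane} :
    y ∈ interior (hull T) ↔ ∀ v ∈ T, 0 < bary hT v y := by
  have h := (cellBasis hT).interior_convexHull
  have h2 : Set.range (cellBasis hT) = (T : Set Plane) := by
    ext z
    simp [cellBasis_apply]
  rw [h2] at h
  rw [hull, h]
  exact ⟨fun h v hv => by rw [bary_of_mem hT hv]; exact h ⟨v, hv⟩,
    fun h v => by rw [← bary_of_mem hT v.2]; exact h v v.2⟩

theorem isCompact_hull (T : Finset Plane) : IsCompact (hull T) := T.finite_toSet.isCompact_convexHull ℝ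

theorem isClosed_hull (T : Finset Plane) : IsClosed (hull T) := (isCompact_hull T).isClosed

theorem convex_hull (T : Finset Plane) : Convex ℝ (hull T) := convex_convexHull ℝ _

theorem mem_hull_of_mem {v : Plane} (hv : v ∈ T) : v ∈ hull T := subset_convexHull ℝ _ hv

theorem mem_frontier_hull (hT : T ∈ M.cells) {y : Plane} :
    y ∈ frontier (hull T) ↔ y ∈ hull T ∧ ∃ v ∈ T, bary hT v y = 0 := by
  rw [(isClosed_hull T).frontier_eq, Set.mem_sdiff, mem_interior_hull hT]
  refine and_congr_right fun hy => ?_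
  rw [mem_hull hT] at hy
  push Not
  exact ⟨fun ⟨v, hv, h⟩ => ⟨v, hv, le_antisymm h (hy v hv)⟩, fun ⟨v, hv, h⟩ => ⟨v, hv, h.le⟩⟩

theorem bary_nonneg (hT : T ∈ M.cells) (v : Plane) {y : Plane} (hy : y ∈ hull T) :
    0 ≤ bary hT v y := by
  by_cases hv : v ∈ T
  · exact (mem_hull hT).1 hy v hv
  · simp [bary, hv]

theorem bary_le_one (hT : T ∈ M.cells) (v : Plane) {y : Plane} (hy : y ∈ hull T) :
    bary hT v y ≤ 1 := by
  by_cases hv : v ∈ T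
  · rw [← sum_bary hT y]
    exact Finset.single_le_sum (f := fun v => bary hT v y) (fun w _ => bary_nonneg hT w hy) hv
  · simp [bary, hv]

theorem mem_hull_erase (hT : T ∈ M.cells) {v y : Plane} (hy : y ∈ hull T)
    (h0 : bary hT v y = 0) [DecidableEq Plane] : y ∈ hull (T.erase v) := by
  rw [hull, Finset.mem_convexHull']
  have e : ∀ g : Plane → Plane, (bary hT v y • g v = 0) := fun g => by rw [h0, zero_smul]
  by_cases hv : v ∈ T
  · refine ⟨fun w => bary hT w y, fun w _ => bary_nonneg hT w hy, ?_, ?_⟩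
    · have := sum_bary hT y
      rw [← Finset.add_sum_erase _ _ hv, h0, zero_add] at this
      exact this
    · have := sum_bary_smul hT y
      rw [← Finset.add_sum_erase _ _ hv, h0, zero_smul, zero_add] at this
      exact this
  · rw [Finset.erase_eq_of_notMem hv]
    exact ⟨fun w => bary hT w y, fun w _ => bary_nonneg hT w hy, sum_bary hT y, sum_bary_smul hT y⟩

theorem hull_subset_closure (hT : T ∈ M.cells) : hull T ⊆ closure Ω := by
  rw [closure_eq (M := M)]
  exact Set.subset_biUnion_of_mem (u := fun T => hull T) hT

theorem exists_cell_of_mem_closure {y : Plane} (hy : y ∈ closure Ω) :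
    ∃ T ∈ M.cells, y ∈ hull T := by
  rw [closure_eq (M := M)] at hy
  simpa using hy

theorem interior_hull_subset (hΩ : interior (closure Ω) = Ω) (hT : T ∈ M.cells) :
    interior (hull T) ⊆ Ω := by
  rw [← hΩ]
  exact interior_mono (hull_subset_closure hT)

theorem mem_of_bary_pos (hΩ : interior (closure Ω) = Ω) (hT : T ∈ M.cells) {x y : Plane}
    (hx : x ∈ Ω) (hy : y ∈ hull T) (hpos : 0 < bary hT x y) : y ∈ Ω := by
  rw [← hΩ] at hx ⊢
  exact star_mem_interior hT hx hy hpos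

/-- Some coordinate of `y` is positive; if its vertex were in Ω, so would be `y`, because the open
star of a vertex in Ω stays in Ω. -/
theorem exists_vertex_notMem (hΩ : interior (closure Ω) = Ω) (hT : T ∈ M.cells) {y : Plane}
    (hy : y ∈ hull T) (hyΩ : y ∉ Ω) : ∃ v ∈ T, v ∉ Ω := by
  by_contra! h
  have h0 : ∀ v ∈ T, bary hT v y = 0 := fun v hv => by
    by_contra hne
    exact hyΩ (mem_of_bary_pos hΩ hT (h v hv) hy (lt_of_le_of_ne (bary_nonneg hT v hy) (Ne.symm hne)))
  have := sum_bary hT y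
  rw [Finset.sum_eq_zero h0] at this
  exact zero_ne_one this

theorem mem_vertices {v : Plane} (hT : T ∈ M.cells) (hv : v ∈ T) : v ∈ M.vertices := by
  simp only [vertices, Finset.mem_biUnion, id]
  exact ⟨T, hT, hv⟩

theorem exists_cell_of_mem_vertices {v : Plane} (hv : v ∈ M.vertices) : ∃ T ∈ M.cells, v ∈ T := by
  simpa [vertices] using hv

theorem nodal_eqOn (hΩ : interior (closure Ω) = Ω) (hT : T ∈ M.cells) {x : Plane} (hx : x ∈ Ω) :
    Set.EqOn (M.nodal x) (bary hT x) (hull T) := by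
  classical
  obtain ⟨⟨-, -, hf⟩, hv⟩ := isNodal_nodal (M := M) hΩ hx
  obtain ⟨f, hf⟩ := hf T hT
  have : f = bary hT x := affine_ext hT fun v hvT => by
    rw [← hf (mem_hull_of_mem hvT), hv v (mem_vertices hT hvT), bary_vertex hT x hvT]
  rw [← this]
  exact hf

/-- The coordinate of a vertex of `S` that is not in `T` vanishes on the intersection, which
therefore lies in the frontier of a convex set. -/
theorem aedisjoint_hull {S : Finset Plane} (hS : S ∈ M.cells) (hT : T ∈ M.cells) (h : S ≠ T) :
    AEDisjoint volume (hull S) (hull T) := by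
  obtain ⟨v, hvS, hvT⟩ : ∃ v ∈ S, v ∉ T := by
    by_contra! hc
    exact h (Finset.eq_of_subset_of_card_le hc (by rw [(mem_cells.1 hS).2, (mem_cells.1 hT).2]))
  refine measure_mono_null ?_ ((convex_hull S).addHaar_frontier volume)
  intro y hy
  rw [mem_frontier_hull hS]
  refine ⟨hy.1, v, hvS, ?_⟩
  rw [bary_agree hS hT v hy.1 hy.2]
  by_contra hne
  exact hvT (mem_of_bary_ne_zero hT hne)

theorem cells_nonempty (M : Triangulation Ω) (h : Ω.Nonempty) : M.cells.Nonempty := by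
  obtain ⟨y, hy⟩ := h
  obtain ⟨T, hT, -⟩ := exists_cell_of_mem_closure (M := M) (subset_closure hy)
  exact ⟨T, hT⟩

theorem isCompact_closure (M : Triangulation Ω) : IsCompact (closure Ω) := by
  rw [closure_eq (M := M)]
  exact M.cells.isCompact_biUnion fun T _ => isCompact_hull T

/-- Labels for the vertices of a triangle. -/
theorem exists_third (hT : T ∈ M.cells) {y z : Plane} (hy : y ∈ T) (hz : z ∈ T) (h : y ≠ z)
    [DecidableEq Plane] : ∃ x, x ≠ y ∧ x ≠ z ∧ T = {x, y, z} := by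
  have hc : ((T.erase y).erase z).card = 1 := by
    rw [Finset.card_erase_of_mem (Finset.mem_erase.2 ⟨h.symm, hz⟩), Finset.card_erase_of_mem hy,
      (mem_cells.1 hT).2]
  obtain ⟨x, hx⟩ := Finset.card_eq_one.1 hc
  have hxm : x ∈ (T.erase y).erase z := by simp [hx]
  rw [Finset.mem_erase, Finset.mem_erase] at hxm
  refine ⟨x, hxm.2.1, hxm.1, ?_⟩
  ext w
  have hw : w ∈ (T.erase y).erase z ↔ w = x := by rw [hx, Finset.mem_singleton]
  rw [Finset.mem_erase, Finset.mem_erase] at hw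
  rw [Finset.mem_insert, Finset.mem_insert, Finset.mem_singleton]
  constructor
  · intro hwT
    by_cases h1 : w = y
    · exact Or.inr (Or.inl h1)
    · by_cases h2 : w = z
      · exact Or.inr (Or.inr h2)
      · exact Or.inl (hw.1 ⟨h2, h1, hwT⟩)
  · rintro (rfl | rfl | rfl)
    exacts [hxm.2.2, hy, hz]

end Triangulation

/-! ### Consequences of quasi-uniformity -/

namespace CutMesh

open Triangulation

variable {Ω : Set Plane} {K : CutMesh Ω} {σ L : ℝ} {T : Finset Plane}

/-- The assumptions on one level that matter locally. -/
structure Regular (K : CutMesh Ω) (σ L : ℝ) : Prop where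
  reg : interior (closure Ω) = Ω
  σ_pos : 0 < σ
  L_nonneg : 0 ≤ L
  h_pos : 0 < K.h
  diam_le : ∀ T ∈ K.mesh.cells, ∀ x ∈ hull T, ∀ y ∈ hull T, dist x y ≤ K.h
  disc : ∀ T ∈ K.mesh.cells, ∃ z, Metric.closedBall z (σ * K.h) ⊆ hull T
  vertex_notMem : ∀ x ∈ K.interiorVertices, x ∉ K.Γ
  graph : ∀ T ∈ K.mesh.cells, (hull T ∩ K.Γ).Nonempty → IsGraphOverChord K.Γ L T

namespace Regular

/-- The coordinate stays in [0, 1] on the inscribed disc of radius σh. -/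
theorem norm_agrad_bary_le (R : K.Regular σ L) (hT : T ∈ K.mesh.cells) (v : Plane) :
    ‖agrad (bary hT v)‖ ≤ 1 / (σ * K.h) := by
  obtain ⟨z, hz⟩ := R.disc T hT
  refine norm_agrad_le (z := z) (mul_pos R.σ_pos R.h_pos) fun y hy => ?_
  rw [abs_of_nonneg (bary_nonneg hT v (hz hy))]
  exact bary_le_one hT v (hz hy)

theorem abs_bary_sub_le (R : K.Regular σ L) (hT : T ∈ K.mesh.cells) (v x y : Plane) :
    |bary hT v x - bary hT v y| ≤ dist x y / (σ * K.h) := by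
  refine (abs_apply_sub_le _ _ _).trans ?_
  rw [div_eq_mul_one_div, mul_comm]
  exact mul_le_mul_of_nonneg_left (R.norm_agrad_bary_le hT v) dist_nonneg

/-- The heights of the triangle are at least σh: the coordinate of `v` drops from 1 to 0 with a
slope of at most 1/(σh). -/
theorem le_dist_vertices (R : K.Regular σ L) (hT : T ∈ K.mesh.cells) {v y : Plane} (hv : v ∈ T)
    (hy : bary hT v y = 0) : σ * K.h ≤ dist v y := by
  have h := R.abs_bary_sub_le hT v v y
  rw [bary_self hT hv, hy, sub_zero, abs_one, le_div_iff₀ (mul_pos R.σ_pos R.h_pos), one_mul] at h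
  exact h

theorem volume_hull_ge (R : K.Regular σ L) (hT : T ∈ K.mesh.cells) :
    (σ * K.h) ^ 2 ≤ volume.real (hull T) := by
  obtain ⟨z, hz⟩ := R.disc T hT
  have h1 : volume.real (Metric.closedBall z (σ * K.h)) ≤ volume.real (hull T) :=
    measureReal_mono hz (isCompact_hull T).measure_lt_top.ne
  have hp := mul_pos R.σ_pos R.h_pos
  have h2 : volume.real (Metric.closedBall z (σ * K.h)) = (σ * K.h) ^ 2 * Real.pi := by
    rw [Measure.real, EuclideanSpace.volume_closedBall_fin_two, ENNReal.toReal_mul,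
      ENNReal.toReal_pow, ENNReal.toReal_ofReal hp.le,
      ENNReal.toReal_ofReal Real.pi_pos.le]
  rw [h2] at h1
  have := Real.pi_gt_three
  nlinarith [sq_nonneg (σ * K.h)]

theorem volume_hull_pos (R : K.Regular σ L) (hT : T ∈ K.mesh.cells) : 0 < volume.real (hull T) :=
  lt_of_lt_of_le (pow_pos (mul_pos R.σ_pos R.h_pos) 2) (R.volume_hull_ge hT)

theorem volume_closedBall_le (z : Plane) {r : ℝ} (hr : 0 ≤ r) :
    volume.real (Metric.closedBall z r) ≤ 4 * r ^ 2 := by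
  rw [Measure.real, EuclideanSpace.volume_closedBall_fin_two, ENNReal.toReal_mul,
      ENNReal.toReal_pow, ENNReal.toReal_ofReal hr,
      ENNReal.toReal_ofReal Real.pi_pos.le]
  have := Real.pi_le_four
  nlinarith [sq_nonneg r]

theorem volume_hull_le (R : K.Regular σ L) (hT : T ∈ K.mesh.cells) :
    volume.real (hull T) ≤ 4 * K.h ^ 2 := by
  obtain ⟨v, hv⟩ : T.Nonempty := Finset.card_pos.1 (by rw [(mem_cells.1 hT).2]; norm_num)
  refine (measureReal_mono (fun y hy => ?_) measure_closedBall_lt_top.ne).trans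
    (volume_closedBall_le v R.h_pos.le)
  exact R.diam_le T hT y hy v (mem_hull_of_mem hv)

open Classical in
/-- The number of triangles near a point is bounded. -/
theorem card_near_le (R : K.Regular σ L) (x : Plane) {m : ℝ} (hm : 0 ≤ m) :
    ((K.mesh.cells.filter fun T => (hull T ∩ Metric.closedBall x (m * K.h)).Nonempty).card : ℝ)
      ≤ 4 * (m + 1) ^ 2 / σ ^ 2 := by
  set s := K.mesh.cells.filter fun T => (hull T ∩ Metric.closedBall x (m * K.h)).Nonempty with hs
  have hmem : ∀ T ∈ s, T ∈ K.mesh.cells := fun T hT => (Finset.mem_filter.1 hT).1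
  -- The count compares areas: triangles of area at least (σh)² with null overlaps fit in a disc of
  -- radius (m + 1)h.
  have hsub : (⋃ T ∈ s, hull T) ⊆ Metric.closedBall x ((m + 1) * K.h) := by
    intro y hy
    simp only [Set.mem_iUnion, exists_prop] at hy
    obtain ⟨T, hT, hy⟩ := hy
    obtain ⟨hT1, z, hz, hzx⟩ := Finset.mem_filter.1 hT
    have h1 := R.diam_le T hT1 y hy z hz
    have h2 := dist_triangle y z x
    rw [Metric.mem_closedBall] at hzx ⊢
    linarith
  have hsum : volume.real (⋃ T ∈ s, hull T) = ∑ T ∈ s, volume.real (hull T) := by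
    rw [measureReal_def, measure_biUnion_finset₀ (fun S hS T hT h => aedisjoint_hull (hmem S hS) (hmem T hT) h)
      (fun T _ => (isClosed_hull T).nullMeasurableSet), ENNReal.toReal_sum
      (fun T _ => (isCompact_hull T).measure_lt_top.ne)]
    rfl
  have hp := R.h_pos
  have hσ := R.σ_pos
  have h1 : volume.real (⋃ T ∈ s, hull T) ≤ 4 * ((m + 1) * K.h) ^ 2 :=
    (measureReal_mono hsub measure_closedBall_lt_top.ne).trans
      (volume_closedBall_le x (by positivity))
  have h2 : (s.card : ℝ) * (σ * K.h) ^ 2 ≤ ∑ T ∈ s, volume.real (hull T) := by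
    rw [← nsmul_eq_mul]
    exact Finset.card_nsmul_le_sum _ _ _ fun T hT => R.volume_hull_ge (hmem T hT)
  rw [← hsum] at h2
  rw [le_div_iff₀ (by positivity)]
  have h3 : (s.card * σ ^ 2) * K.h ^ 2 ≤ (4 * (m + 1) ^ 2) * K.h ^ 2 := by nlinarith
  exact le_of_mul_le_mul_right h3 (by positivity)

end Regular

end CutMesh
-- Elementary facts on segments and orthogonality
theorem exists_first_exit {U : Set Plane} (hU : IsOpen U) {x z : Plane} (hx : x ∈ U) (hz : z ∉ U) :
    ∃ t ∈ Set.Ioc (0 : ℝ) 1, AffineMap.lineMap (k := ℝ) x z t ∉ U ∧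
      ∀ s ∈ Set.Ico (0 : ℝ) t, AffineMap.lineMap (k := ℝ) x z s ∈ U := by
  have hc : Continuous (fun t : ℝ => AffineMap.lineMap (k := ℝ) x z t) :=
    AffineMap.lineMap_continuous
  have hK : IsCompact (Set.Icc (0 : ℝ) 1 ∩ (fun t : ℝ => AffineMap.lineMap (k := ℝ) x z t) ⁻¹' Uᶜ) :=
    isCompact_Icc.inter_right (hU.isClosed_compl.preimage hc)
  obtain ⟨t, ⟨ht, htU⟩, hmin⟩ := hK.exists_isLeast ⟨1, by simp, by simpa using hz⟩
  refine ⟨t, ⟨lt_of_le_of_ne ht.1 fun h => ?_, ht.2⟩, htU, fun s hs => ?_⟩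
  · rw [← h] at htU
    simp at htU
    exact htU hx
  · by_contra hsU
    exact absurd (hmin ⟨⟨hs.1, hs.2.le.trans ht.2⟩, hsU⟩) (not_le.2 hs.2)

/-- There is no room in the plane for three nonzero, pairwise orthogonal vectors. This makes the
chord and its normal a coordinate system. -/
theorem eq_zero_of_inner_eq_zero {e ν d : Plane} (he : e ≠ 0) (hν : ν ≠ 0)
    (h : inner ℝ ν e = (0 : ℝ)) (h1 : inner ℝ d e = (0 : ℝ)) (h2 : inner ℝ d ν = (0 : ℝ)) :
    d = 0 := by
  by_contra hd
  have h' : inner ℝ e ν = (0 : ℝ) := by rw [real_inner_comm, h]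
  have h1' : inner ℝ e d = (0 : ℝ) := by rw [real_inner_comm, h1]
  have h2' : inner ℝ ν d = (0 : ℝ) := by rw [real_inner_comm, h2]
  have hon : LinearIndependent ℝ ![e, ν, d] := by
    refine linearIndependent_of_ne_zero_of_inner_eq_zero (𝕜 := ℝ) ?_ ?_
    · intro i
      fin_cases i
      exacts [he, hν, hd]
    · intro i j hij
      fin_cases i <;> fin_cases j
      exacts [absurd rfl hij, h', h1', h, absurd rfl hij, h2', h1, h2, absurd rfl hij]
  have := hon.fintype_card_le_finrank
  simp at this

theorem fin_two_eq_of_ne {i k : Fin 2} (h : i ≠ k) : i = 1 - k := by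
  revert i k; decide

theorem fin_two_ne (k : Fin 2) : 1 - k ≠ k := by
  revert k; decide

/-! ### The two sides of the interface -/

namespace CutMesh

open Triangulation

variable {Ω : Set Plane} {K : CutMesh Ω} {σ L : ℝ} {T : Finset Plane}

theorem sub_disjoint (K : CutMesh Ω) {i k : Fin 2} (h : i ≠ k) : Disjoint (K.sub i) (K.sub k) := by
  have h0 := K.isInterface.disjoint
  fin_cases i <;> fin_cases k
  · exact absurd rfl h
  · exact h0
  · exact h0.symm
  · exact absurd rfl h

theorem mem_interface_of_mem_closure {i k : Fin 2} (h : i ≠ k) {y : Plane}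
    (hi : y ∈ closure (K.sub i)) (hk : y ∈ closure (K.sub k)) : y ∈ K.Γ := by
  rw [K.isInterface.eq_inter]
  fin_cases i <;> fin_cases k
  · exact absurd rfl h
  · exact ⟨hi, hk⟩
  · exact ⟨hk, hi⟩
  · exact absurd rfl h

theorem interface_subset_closure (k : Fin 2) : K.Γ ⊆ closure (K.sub k) := by
  intro y hy
  rw [K.isInterface.eq_inter] at hy
  fin_cases k
  exacts [hy.1, hy.2]

theorem isClosed_interface (K : CutMesh Ω) : IsClosed K.Γ := by
  rw [K.isInterface.eq_inter]
  exact isClosed_closure.inter isClosed_closure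

theorem interface_subset (K : CutMesh Ω) : K.Γ ⊆ closure Ω :=
  (interface_subset_closure 0).trans (closure_mono (K.sub_subset 0))

theorem closure_subset_union (K : CutMesh Ω) :
    closure Ω ⊆ closure (K.sub 0) ∪ closure (K.sub 1) := by
  rw [← closure_union]
  refine closure_minimal (fun y hy => ?_) isClosed_closure
  by_cases h : y ∈ K.Γ
  · rw [closure_union]
    exact Or.inl (interface_subset_closure 0 h)
  · refine subset_closure ?_
    rw [K.isInterface.union_eq]
    exact ⟨hy, h⟩

theorem notMem_interface_of_mem_sub {k : Fin 2} {y : Plane} (h : y ∈ K.sub k) : y ∉ K.Γ := by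
  have : y ∈ K.sub 0 ∪ K.sub 1 := by
    fin_cases k
    exacts [Or.inl h, Or.inr h]
  rw [K.isInterface.union_eq] at this
  exact this.2

theorem exists_mem_sub {y : Plane} (h : y ∈ Ω) (hΓ : y ∉ K.Γ) : ∃ k, y ∈ K.sub k := by
  have : y ∈ K.sub 0 ∪ K.sub 1 := by
    rw [K.isInterface.union_eq]
    exact ⟨h, hΓ⟩
  rcases this with h | h
  exacts [⟨0, h⟩, ⟨1, h⟩]

theorem mem_sub_of_mem_closure {k : Fin 2} {y : Plane} (h : y ∈ Ω) (hΓ : y ∉ K.Γ)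
    (hk : y ∈ closure (K.sub k)) : y ∈ K.sub k := by
  obtain ⟨i, hi⟩ := exists_mem_sub h hΓ
  by_cases hik : i = k
  · exact hik ▸ hi
  · exact absurd (mem_interface_of_mem_closure hik (subset_closure hi) hk) hΓ

theorem eq_of_mem_closure {i k : Fin 2} {y : Plane} (hΓ : y ∉ K.Γ)
    (hi : y ∈ closure (K.sub i)) (hk : y ∈ closure (K.sub k)) : i = k := by
  by_contra h
  exact hΓ (mem_interface_of_mem_closure h hi hk)

theorem exists_side (K : CutMesh Ω) {y : Plane} (h : y ∈ closure Ω) :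
    ∃ k, y ∈ closure (K.sub k) := by
  rcases K.closure_subset_union h with h | h
  exacts [⟨0, h⟩, ⟨1, h⟩]

/-- Off Γ the closures of the subdomains are disjoint, and they cover the closure of Ω, so a
connected set cannot change sides. Sides are defined by closures since triangles may touch the
boundary of Ω, which has no points of the open subdomains. -/
theorem side_of_preconnected {S : Set Plane} (hS : IsPreconnected S) (hsub : S ⊆ closure Ω)
    (hΓ : ∀ y ∈ S, y ∉ K.Γ) {k : Fin 2} {s : Plane} (hs : s ∈ S) (hk : s ∈ closure (K.sub k)) :
    S ⊆ closure (K.sub k) := by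
  intro y hy
  obtain ⟨i, hi⟩ := K.exists_side (hsub hy)
  by_cases hik : i = k
  · exact hik ▸ hi
  exfalso
  have hcover : S ⊆ closure (K.sub i) ∪ closure (K.sub k) := by
    intro w hw
    obtain ⟨j, hj⟩ := K.exists_side (hsub hw)
    by_cases hjk : j = k
    · exact Or.inr (hjk ▸ hj)
    · have : j = i := by rw [fin_two_eq_of_ne hjk, fin_two_eq_of_ne hik]
      exact Or.inl (this ▸ hj)
  obtain ⟨w, hw, hwi, hwk⟩ := isPreconnected_closed_iff.1 hS _ _ isClosed_closure isClosed_closure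
    hcover ⟨y, hy, hi⟩ ⟨s, hs, hk⟩
  exact hΓ w hw (mem_interface_of_mem_closure hik hwi hwk)

theorem side_of_lineMap {a b : Plane} {k : Fin 2}
    (h : ∀ t ∈ Set.Icc (0 : ℝ) 1, AffineMap.lineMap (k := ℝ) a b t ∈ closure Ω ∧
      AffineMap.lineMap (k := ℝ) a b t ∉ K.Γ) (ha : a ∈ closure (K.sub k)) :
    b ∈ closure (K.sub k) := by
  have hS : IsPreconnected ((fun t : ℝ => AffineMap.lineMap (k := ℝ) a b t) '' Set.Icc 0 1) :=
    isPreconnected_Icc.image _ AffineMap.lineMap_continuous.continuousOn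
  refine side_of_preconnected hS ?_ ?_ ⟨0, by simp, by simp⟩ ha ⟨1, by simp, by simp⟩
  · rintro _ ⟨t, ht, rfl⟩
    exact (h t ht).1
  · rintro _ ⟨t, ht, rfl⟩
    exact (h t ht).2

/-! ### The position of the arc in a triangle -/

theorem lineMap_mem_hull {a b : Plane} (ha : a ∈ hull T) (hb : b ∈ hull T) {t : ℝ}
    (ht : t ∈ Set.Icc (0 : ℝ) 1) : AffineMap.lineMap (k := ℝ) a b t ∈ hull T :=
  (convex_hull T).lineMap_mem ha hb ht

/-- The position of the endpoints of the arc in which the interface cuts the triangle `T`, whose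
vertices are `x`, `y`, `z`: the point `p` lies on the edge `xy`, the point `q` on the edge `xz`. -/
structure Endpoints (K : CutMesh Ω) (hT : T ∈ K.mesh.cells) (x y z p q : Plane) : Prop where
  mem_iff : ∀ v, v ∈ T ↔ v = x ∨ v = y ∨ v = z
  xy : x ≠ y
  xz : x ≠ z
  yz : y ≠ z
  p_mem : p ∈ hull T ∩ K.Γ
  q_mem : q ∈ hull T ∩ K.Γ
  p_zero : bary hT z p = 0
  q_zero : bary hT y q = 0
  p_pos : 0 < bary hT y p
  q_pos : 0 < bary hT z q
  not_both : ¬ (bary hT x p = 0 ∧ bary hT x q = 0)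
  interior_or : ∀ w ∈ hull T ∩ K.Γ, w ∈ interior (hull T) ∨ w = p ∨ w = q

namespace Endpoints

variable {hT : T ∈ K.mesh.cells} {x y z p q : Plane}

theorem swap (E : K.Endpoints hT x y z p q) : K.Endpoints hT x z y q p where
  mem_iff v := by rw [E.mem_iff]; tauto
  xy := E.xz
  xz := E.xy
  yz := E.yz.symm
  p_mem := E.q_mem
  q_mem := E.p_mem
  p_zero := E.q_zero
  q_zero := E.p_zero
  p_pos := E.q_pos
  q_pos := E.p_pos
  not_both := fun h => E.not_both h.symm
  interior_or w hw := by have := E.interior_or w hw; tauto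

theorem hx (E : K.Endpoints hT x y z p q) : x ∈ T := (E.mem_iff x).2 (Or.inl rfl)
theorem hy (E : K.Endpoints hT x y z p q) : y ∈ T := (E.mem_iff y).2 (Or.inr (Or.inl rfl))
theorem hz (E : K.Endpoints hT x y z p q) : z ∈ T := (E.mem_iff z).2 (Or.inr (Or.inr rfl))

theorem eq_insert (E : K.Endpoints hT x y z p q) [DecidableEq Plane] : T = {x, y, z} := by
  ext v
  rw [E.mem_iff]
  simp

theorem sum_eq (E : K.Endpoints hT x y z p q) (f : Plane → ℝ) :
    ∑ v ∈ T, f v = f x + f y + f z := by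
  classical
  rw [E.eq_insert, Finset.sum_insert (by simp [E.xy, E.xz]), Finset.sum_pair E.yz]
  ring

theorem bary_add (E : K.Endpoints hT x y z p q) (w : Plane) :
    bary hT x w + bary hT y w + bary hT z w = 1 := by
  rw [← E.sum_eq (fun v => bary hT v w), sum_bary]

theorem eq_of_bary (E : K.Endpoints hT x y z p q) {v w : Plane} (h1 : bary hT y v = bary hT y w)
    (h2 : bary hT z v = bary hT z w) : v = w := by
  refine eq_of_bary_eq hT fun u hu => ?_
  have hv := E.bary_add v
  have hw := E.bary_add w
  rcases (E.mem_iff u).1 hu with rfl | rfl | rfl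
  · linarith
  · exact h1
  · exact h2

theorem eq_or_of_bary_eq_zero (E : K.Endpoints hT x y z p q) {w : Plane} (hw : w ∈ hull T)
    (hΓ : w ∈ K.Γ) {v : Plane} (hv : v ∈ T) (h0 : bary hT v w = 0) : w = p ∨ w = q := by
  rcases E.interior_or w ⟨hw, hΓ⟩ with h | h
  · exact absurd h0 ((mem_interior_hull hT).1 h v hv).ne'
  · exact h

theorem bary_y_z (E : K.Endpoints hT x y z p q) : bary hT y z = 0 := bary_of_ne hT E.hz E.yz.symm
theorem bary_z_y (E : K.Endpoints hT x y z p q) : bary hT z y = 0 := bary_of_ne hT E.hy E.yz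
theorem bary_y_x (E : K.Endpoints hT x y z p q) : bary hT y x = 0 := bary_of_ne hT E.hx E.xy
theorem bary_z_x (E : K.Endpoints hT x y z p q) : bary hT z x = 0 := bary_of_ne hT E.hx E.xz
theorem bary_x_y (E : K.Endpoints hT x y z p q) : bary hT x y = 0 := bary_of_ne hT E.hy E.xy.symm
theorem bary_x_z (E : K.Endpoints hT x y z p q) : bary hT x z = 0 := bary_of_ne hT E.hz E.xz.symm

/-- The part of the edge `xy` before `p` is on the same side as `x`. -/
theorem side_edge (E : K.Endpoints hT x y z p q) {k : Fin 2} (hk : x ∈ closure (K.sub k))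
    {b : Plane} (hb : b ∈ hull T) (h0 : bary hT z b = 0) (hlt : bary hT y b < bary hT y p) :
    b ∈ closure (K.sub k) ∧ b ∉ K.Γ := by
  have key : ∀ t ∈ Set.Icc (0 : ℝ) 1, AffineMap.lineMap (k := ℝ) x b t ∉ K.Γ := by
    intro t ht hΓ
    have hm := lineMap_mem_hull (mem_hull_of_mem E.hx) hb ht
    have e1 := bary_homothety hT z x b t
    have e2 := bary_homothety hT y x b t
    rw [E.bary_z_x, h0] at e1
    rw [E.bary_y_x] at e2
    have e3 := bary_nonneg hT y hb
    rcases E.eq_or_of_bary_eq_zero hm hΓ E.hz (by linarith) with h | h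
    · rw [h] at e2
      nlinarith [ht.2]
    · rw [h] at e1
      have := E.q_pos
      linarith
  refine ⟨side_of_lineMap (fun t ht => ⟨hull_subset_closure hT
    (lineMap_mem_hull (mem_hull_of_mem E.hx) hb ht), key t ht⟩) hk, ?_⟩
  simpa using key 1 (by simp)

/-- The opposite edge, without the interface, lies on one side. -/
theorem side_opposite (E : K.Endpoints hT x y z p q) :
    ∃ k, ∀ b ∈ hull T, b ∉ K.Γ → bary hT x b = 0 → b ∈ closure (K.sub k) := by
  set c : Plane := AffineMap.lineMap (k := ℝ) y z (1 / 2 : ℝ) with hc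
  have hcT : c ∈ hull T := lineMap_mem_hull (mem_hull_of_mem E.hy) (mem_hull_of_mem E.hz)
    (by norm_num)
  have hcx : bary hT x c = 0 := by rw [hc, bary_homothety, E.bary_x_y, E.bary_x_z]; ring
  have hcy : bary hT y c = 1 / 2 := by
    rw [hc, bary_homothety, bary_self hT E.hy, E.bary_y_z]; ring
  have hcz : bary hT z c = 1 / 2 := by
    rw [hc, bary_homothety, bary_self hT E.hz, E.bary_z_y]; ring
  obtain ⟨k, hk⟩ := K.exists_side (hull_subset_closure hT hcT)
  refine ⟨k, fun b hb hbΓ hbx => side_of_lineMap (a := c) (fun t ht => ?_) hk⟩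
  have hm := lineMap_mem_hull hcT hb ht
  refine ⟨hull_subset_closure hT hm, fun hΓ => hbΓ ?_⟩
  have e1 := bary_homothety hT x c b t
  have e2 := bary_homothety hT y c b t
  have e3 := bary_homothety hT z c b t
  rw [hcx, hbx] at e1
  rw [hcy] at e2
  rw [hcz] at e3
  have n2 := mul_nonneg ht.1 (bary_nonneg hT y hb)
  have n3 := mul_nonneg ht.1 (bary_nonneg hT z hb)
  have ht1 : t = 1 := by
    rcases E.eq_or_of_bary_eq_zero hm hΓ E.hx (by linarith) with h | h
    · rw [h, E.p_zero] at e3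
      exact le_antisymm ht.2 (by linarith)
    · rw [h, E.q_zero] at e2
      exact le_antisymm ht.2 (by linarith)
  rw [ht1, AffineMap.lineMap_apply_one] at hΓ
  exact hΓ

/-- Beyond `p` the edge can be followed back to `y` without meeting the arc, which touches this edge
only at `p`. So `y` is off Γ and takes its side from the opposite edge. -/
theorem side_far (E : K.Endpoints hT x y z p q) {k : Fin 2}
    (hk : ∀ b ∈ hull T, b ∉ K.Γ → bary hT x b = 0 → b ∈ closure (K.sub k))
    {b : Plane} (hb : b ∈ hull T) (h0 : bary hT z b = 0) (hlt : bary hT y p < bary hT y b) :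
    b ∈ closure (K.sub k) := by
  have key : ∀ t ∈ Set.Icc (0 : ℝ) 1, AffineMap.lineMap (k := ℝ) y b t ∉ K.Γ := by
    intro t ht hΓ
    have hm := lineMap_mem_hull (mem_hull_of_mem E.hy) hb ht
    have e1 := bary_homothety hT z y b t
    have e2 := bary_homothety hT y y b t
    rw [E.bary_z_y, h0] at e1
    rw [bary_self hT E.hy] at e2
    have e3 := bary_le_one hT y hb
    rcases E.eq_or_of_bary_eq_zero hm hΓ E.hz (by linarith) with h | h
    · rw [h] at e2
      nlinarith [ht.2]
    · rw [h] at e1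
      have := E.q_pos
      linarith
  refine side_of_lineMap (fun t ht => ⟨hull_subset_closure hT
    (lineMap_mem_hull (mem_hull_of_mem E.hy) hb ht), key t ht⟩)
    (hk y (mem_hull_of_mem E.hy) ?_ E.bary_x_y)
  simpa using key 0 (by simp)

end Endpoints

/-- The labels of an arc, a parametrization of the arc and the sides of the three vertices. -/
structure ArcCut (K : CutMesh Ω) (L : ℝ) (hT : T ∈ K.mesh.cells) (x y z p q : Plane) (k : Fin 2) :
    Prop extends K.Endpoints hT x y z p q where
  param : ∃ γ : ℝ → Plane, γ 0 = p ∧ γ 1 = q ∧ hull T ∩ K.Γ = γ '' Set.Icc 0 1 ∧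
    ∀ s ∈ Set.Icc (0 : ℝ) 1, ∀ t ∈ Set.Icc (0 : ℝ) 1,
      dist (γ s) (γ t) ≤ (1 + L) * dist p q * |s - t|
  side_x : x ∈ closure (K.sub k)
  side_yz : ∀ b ∈ hull T, b ∉ K.Γ → bary hT x b = 0 → b ∈ closure (K.sub (1 - k))

theorem ArcCut.swap {hT : T ∈ K.mesh.cells} {x y z p q : Plane} {k : Fin 2}
    (A : K.ArcCut L hT x y z p q k) : K.ArcCut L hT x z y q p k where
  toEndpoints := A.toEndpoints.swap
  param := by
    obtain ⟨γ, h0, h1, hΓ, hL⟩ := A.param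
    refine ⟨fun t => γ (1 - t), by simpa using h1, by simpa using h0, ?_, fun s hs t ht => ?_⟩
    · rw [hΓ]
      ext w
      constructor
      · rintro ⟨t, ht, rfl⟩
        exact ⟨1 - t, ⟨by linarith [ht.2], by linarith [ht.1]⟩, by simp⟩
      · rintro ⟨t, ht, rfl⟩
        exact ⟨1 - t, ⟨by linarith [ht.2], by linarith [ht.1]⟩, rfl⟩
    · have := hL (1 - s) ⟨by linarith [hs.2], by linarith [hs.1]⟩ (1 - t)
        ⟨by linarith [ht.2], by linarith [ht.1]⟩
      rw [dist_comm q p]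
      rwa [show 1 - s - (1 - t) = -(s - t) by ring, abs_neg] at this
  side_x := A.side_x
  side_yz := A.side_yz

/-- Let `z` and `y` be vertices opposite to edges with `p` and `q`, respectively. They differ
because the endpoints have no common edge, and `x` is the remaining vertex. -/
theorem exists_labels (hT : T ∈ K.mesh.cells) {p q : Plane} (hp : p ∈ frontier (hull T))
    (hq : q ∈ frontier (hull T))
    (hne : ∀ e ⊆ T, e.card = 2 → ¬ (p ∈ hull e ∧ q ∈ hull e)) (hpΓ : p ∈ K.Γ) (hqΓ : q ∈ K.Γ)
    (hint : ∀ w ∈ hull T ∩ K.Γ, w ∈ interior (hull T) ∨ w = p ∨ w = q) :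
    ∃ x y z, K.Endpoints hT x y z p q := by
  classical
  obtain ⟨hpT, z, hz, hpz⟩ := (mem_frontier_hull hT).1 hp
  obtain ⟨hqT, y, hy, hqy⟩ := (mem_frontier_hull hT).1 hq
  have hnot : ∀ v ∈ T, ¬ (bary hT v p = 0 ∧ bary hT v q = 0) := by
    rintro v hv ⟨h1, h2⟩
    refine hne (T.erase v) (T.erase_subset v) ?_ ⟨mem_hull_erase hT hpT h1, mem_hull_erase hT hqT h2⟩
    rw [Finset.card_erase_of_mem hv, (mem_cells.1 hT).2]
  have hyz : y ≠ z := by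
    rintro rfl
    exact hnot y hy ⟨hpz, hqy⟩
  obtain ⟨x, hxy, hxz, hxyz⟩ := exists_third hT hy hz hyz
  have hx : x ∈ T := by rw [hxyz]; simp
  refine ⟨x, y, z, ⟨fun v => by rw [hxyz]; simp, hxy, hxz, hyz, ⟨hpT, hpΓ⟩, ⟨hqT, hqΓ⟩, hpz, hqy, ?_, ?_,
    hnot x hx, hint⟩⟩
  · exact lt_of_le_of_ne (bary_nonneg hT y hpT) fun h => hnot y hy ⟨h.symm, hqy⟩
  · exact lt_of_le_of_ne (bary_nonneg hT z hqT) fun h => hnot z hz ⟨hpz, h.symm⟩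

set_option maxHeartbeats 1000000 in
/-- An interface triangle is cut in a single arc; the vertices at both ends are on different
sides. -/
theorem Regular.exists_arcCut (R : K.Regular σ L) (hT : T ∈ K.mesh.cells)
    (hne : (hull T ∩ K.Γ).Nonempty) :
    volume (hull T ∩ K.Γ) = 0 ∧ ∃ x y z p q k, K.ArcCut L hT x y z p q k := by
  obtain ⟨p, q, ν, g, hp, hq, hpq, hν, hνq, hg0, hg1, hgL, hint, hΓ⟩ := R.graph T hT hne
  set γ : ℝ → Plane := fun t => p + t • (q - p) + g t • ν with hγ
  have hγ0 : γ 0 = p := by simp [hγ, hg0]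
  have hγ1 : γ 1 = q := by simp [hγ, hg1]
  have hpΓ : p ∈ hull T ∩ K.Γ := by rw [hΓ, ← hγ0]; exact ⟨0, by simp, rfl⟩
  have hqΓ : q ∈ hull T ∩ K.Γ := by rw [hΓ, ← hγ1]; exact ⟨1, by simp, rfl⟩
  have hor : ∀ w ∈ hull T ∩ K.Γ, w ∈ interior (hull T) ∨ w = p ∨ w = q := by
    intro w hw
    rw [hΓ] at hw
    obtain ⟨t, ht, rfl⟩ := hw
    rcases eq_or_lt_of_le ht.1 with h0 | h0
    · right; left
      rw [← h0]
      exact hγ0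
    rcases eq_or_lt_of_le ht.2 with h1 | h1
    · right; right
      rw [h1]
      exact hγ1
    · exact Or.inl (hint t ⟨h0, h1⟩)
  obtain ⟨x, y, z, E⟩ := exists_labels hT hp hq hpq hpΓ.2 hqΓ.2 hor
  have hne' : q - p ≠ 0 := by
    intro h
    have h1 : q = p := sub_eq_zero.1 h
    have := E.p_pos
    rw [← h1, E.q_zero] at this
    exact lt_irrefl _ this
  have hn2 : 0 < ‖q - p‖ ^ 2 := by positivity
  -- coordinates along and across the chord
  set τ : Plane → ℝ := fun w => inner ℝ (w - p) (q - p) / ‖q - p‖ ^ 2 with hτ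
  set s : Plane → ℝ := fun w => inner ℝ (w - p) ν with hs
  have hτγ : ∀ t, τ (γ t) = t := by
    intro t
    simp only [hτ, hγ]
    rw [show p + t • (q - p) + g t • ν - p = t • (q - p) + g t • ν by abel, inner_add_left,
      inner_smul_left, inner_smul_left, hνq, real_inner_self_eq_norm_sq]
    simp only [conj_trivial, mul_zero, add_zero]
    field_simp
  have hνν : inner ℝ ν ν = (1 : ℝ) := by rw [real_inner_self_eq_norm_sq, hν]; norm_num
  have hsγ : ∀ t, s (γ t) = g t := by
    intro t
    simp only [hs, hγ]
    rw [show p + t • (q - p) + g t • ν - p = t • (q - p) + g t • ν by abel, inner_add_left,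
      inner_smul_left, inner_smul_left, hνν, real_inner_comm, hνq]
    simp
  have hτadd : ∀ (w : Plane) (r : ℝ), τ (w + r • ν) = τ w := by
    intro w r
    simp only [hτ]
    rw [show w + r • ν - p = (w - p) + r • ν by abel, inner_add_left, inner_smul_left, hνq]
    simp
  have hsadd : ∀ (w : Plane) (r : ℝ), s (w + r • ν) = s w + r := by
    intro w r
    simp only [hs]
    rw [show w + r • ν - p = (w - p) + r • ν by abel, inner_add_left, inner_smul_left, hνν]
    simp
  have hmemΓ : ∀ w ∈ hull T ∩ K.Γ, s w = g (τ w) := by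
    intro w hw
    rw [hΓ] at hw
    obtain ⟨t, -, rfl⟩ := hw
    rw [hsγ, hτγ]
  refine ⟨?_, x, y, z, p, q, ?_⟩
  -- A graph over the chord is disjoint from its translates along ν. Infinitely many disjoint
  -- translates by bounded vectors force the area to be zero.
  · refine Measure.addHaar_eq_zero_of_disjoint_translates volume
      (fun n : ℕ => (1 / (n + 1 : ℝ)) • ν) ?_ ?_
      ((isClosed_hull T).inter K.isClosed_interface).measurableSet
    · refine (Metric.isBounded_closedBall (x := (0 : Plane)) (r := 1)).subset ?_
      rintro _ ⟨n, rfl⟩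
      simp only [mem_closedBall_zero_iff]
      rw [norm_smul, hν, mul_one, Real.norm_of_nonneg (by positivity), div_le_one (by positivity)]
      linarith [(Nat.cast_nonneg n : (0 : ℝ) ≤ n)]
    · intro m n hmn
      refine Set.disjoint_left.2 ?_
      rintro _ ⟨_, rfl, w, hw, rfl⟩ ⟨_, rfl, w', hw', h⟩
      simp only at h
      have e1 := hmemΓ w hw
      have e2 := hmemΓ w' hw'
      rw [add_comm, add_comm ((1 / (m + 1 : ℝ)) • ν)] at h
      have e3 := congrArg τ h
      have e4 := congrArg s h
      rw [hτadd, hτadd] at e3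
      rw [hsadd, hsadd, e1, e2, e3] at e4
      have e5 : (1 / (n + 1 : ℝ)) = 1 / (m + 1 : ℝ) := by linarith
      rw [one_div, one_div, inv_inj] at e5
      apply hmn
      exact_mod_cast (by linarith : (m : ℝ) = n)
  -- a point off the arc over the chord can be joined to the boundary
  have hray : ∀ w ∈ interior (hull T), w ∉ K.Γ → ∀ k, w ∈ closure (K.sub k) →
      ∃ b ∈ frontier (hull T), b ∉ K.Γ ∧ b ∈ closure (K.sub k) := by
    intro w hw hwΓ k hk
    by_cases hlt : s w = g (τ w) ∧ τ w ∈ Set.Icc (0 : ℝ) 1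
    · exfalso
      apply hwΓ
      have hw2 : w ∈ hull T ∩ K.Γ := by
        rw [hΓ]
        refine ⟨τ w, hlt.2, ?_⟩
        -- orthogonal decomposition
        have hd : w - p - (τ w • (q - p) + s w • ν) = 0 := by
          set d := w - p - (τ w • (q - p) + s w • ν) with hd
          have d1 : inner ℝ d (q - p) = (0 : ℝ) := by
            rw [hd, inner_sub_left, inner_add_left, inner_smul_left, inner_smul_left, hνq,
              real_inner_self_eq_norm_sq]
            simp only [conj_trivial, hτ]
            field_simp
            ring
          have d2 : inner ℝ d ν = (0 : ℝ) := by
            rw [hd, inner_sub_left, inner_add_left, inner_smul_left, inner_smul_left, hνν,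
              real_inner_comm ν (q - p), hνq]
            simp [hs]
          exact eq_zero_of_inner_eq_zero hne' (fun h => by simp [h] at hν) hνq d1 d2
        have e : w = p + (τ w • (q - p) + s w • ν) := by
          have h2 := sub_eq_zero.1 hd
          rw [← h2]
          abel
        rw [hlt.1, ← add_assoc] at e
        exact e.symm
      exact hw2.2
    -- go up or down
    obtain ⟨a, ha0, ha⟩ : ∃ a : ℝ, (a = 1 ∨ a = -1) ∧
        (τ w ∈ Set.Icc (0 : ℝ) 1 → 0 < a * (s w - g (τ w))) := by
      rcases lt_trichotomy (s w) (g (τ w)) with h | h | h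
      · exact ⟨-1, Or.inr rfl, fun _ => by linarith⟩
      · exact ⟨1, Or.inl rfl, fun h2 => absurd ⟨h, h2⟩ hlt⟩
      · exact ⟨1, Or.inl rfl, fun _ => by linarith⟩
    have haa : a * a = 1 := by rcases ha0 with rfl | rfl <;> norm_num
    obtain ⟨r, hr⟩ := (isCompact_hull T).isBounded.subset_closedBall w
    set w' : Plane := w + (a * (|r| + 1)) • ν with hw'
    have hw'T : w' ∉ interior (hull T) := by
      intro h
      have := hr (interior_subset h)
      rw [Metric.mem_closedBall, dist_eq_norm, hw', add_sub_cancel_left, norm_smul, hν, mul_one,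
        Real.norm_eq_abs, abs_mul, abs_of_pos (by positivity : 0 < |r| + 1)] at this
      have h2 : |a| = 1 := by rcases ha0 with rfl | rfl <;> norm_num
      rw [h2] at this
      linarith [le_abs_self r]
    obtain ⟨t, ht, hb, hbefore⟩ := exists_first_exit isOpen_interior hw hw'T
    have hline : ∀ t : ℝ, AffineMap.lineMap (k := ℝ) w w' t = w + (t * (a * (|r| + 1))) • ν := by
      intro t
      rw [AffineMap.lineMap_apply, hw']
      simp only [vsub_eq_sub, vadd_eq_add, add_sub_cancel_left, smul_smul]
      rw [add_comm]
    -- Along the ray `τ` is constant, and if it lies in [0, 1] the signed distance from the graph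
    -- only grows from its positive initial value.
    have hnotΓ : ∀ t ≥ 0, AffineMap.lineMap (k := ℝ) w w' t ∈ hull T →
        AffineMap.lineMap (k := ℝ) w w' t ∉ K.Γ := by
      intro t ht hm hmΓ
      have e1 := hmemΓ _ ⟨hm, hmΓ⟩
      have e2 : τ (AffineMap.lineMap (k := ℝ) w w' t) ∈ Set.Icc (0 : ℝ) 1 := by
        have : AffineMap.lineMap (k := ℝ) w w' t ∈ hull T ∩ K.Γ := ⟨hm, hmΓ⟩
        rw [hΓ] at this
        obtain ⟨t', ht', h'⟩ := this
        rw [← h', hτγ]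
        exact ht'
      rw [hline, hsadd, hτadd] at e1
      rw [hline, hτadd] at e2
      have e3 := ha e2
      have e4 : a * (s w - g (τ w)) = -(t * (|r| + 1)) := by
        have : s w - g (τ w) = -(t * (a * (|r| + 1))) := by linarith
        rw [this]
        linear_combination (-(t * (|r| + 1))) * haa
      have e5 : 0 ≤ t * (|r| + 1) := by positivity
      linarith
    have hbT : AffineMap.lineMap (k := ℝ) w w' t ∈ hull T := by
      have hcl : AffineMap.lineMap (k := ℝ) w w' t ∈ closure (hull T) := by
        have h1 : Filter.Tendsto (fun u : ℝ => AffineMap.lineMap (k := ℝ) w w' u) (𝓝[<] t)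
            (𝓝 (AffineMap.lineMap (k := ℝ) w w' t)) :=
          (AffineMap.lineMap_continuous (R := ℝ)).continuousAt.tendsto.mono_left nhdsWithin_le_nhds
        refine mem_closure_of_tendsto h1 ?_
        filter_upwards [Ioo_mem_nhdsLT ht.1] with u hu
        exact interior_subset (hbefore u ⟨hu.1.le, hu.2⟩)
      rwa [(isClosed_hull T).closure_eq] at hcl
    set b := AffineMap.lineMap (k := ℝ) w w' t with hbdef
    refine ⟨b, ?_, hnotΓ t ht.1.le hbT, ?_⟩
    · rw [(isClosed_hull T).frontier_eq]
      exact ⟨hbT, hb⟩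
    · refine side_of_lineMap (a := w) (fun u hu => ?_) hk
      have hm := lineMap_mem_hull (interior_subset hw) hbT hu
      have e : AffineMap.lineMap (k := ℝ) w b u = AffineMap.lineMap (k := ℝ) w w' (t * u) := by
        rw [hbdef, AffineMap.lineMap_lineMap_right, mul_comm]
      refine ⟨hull_subset_closure hT hm, ?_⟩
      rw [e] at hm ⊢
      exact hnotΓ _ (mul_nonneg ht.1.le hu.1) hm
  obtain ⟨k, hk⟩ := K.exists_side (hull_subset_closure hT (mem_hull_of_mem E.hx))
  obtain ⟨k', hk'⟩ := E.side_opposite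
  -- If `x` and the opposite edge were on the same side, so would be the whole boundary of the
  -- triangle off Γ. But near the midpoint of the arc there are points of the other subdomain, and a
  -- ray joins such a point to the boundary without crossing Γ.
  have hkk : k' ≠ k := by
    rintro rfl
    -- the whole boundary is on one side
    have hall : ∀ b ∈ frontier (hull T), b ∉ K.Γ → b ∈ closure (K.sub k') := by
      intro b hb hbΓ
      obtain ⟨hbT, v, hv, hv0⟩ := (mem_frontier_hull hT).1 hb
      rcases (E.mem_iff v).1 hv with rfl | rfl | rfl
      · exact hk' b hbT hbΓ hv0
      · rcases lt_trichotomy (bary hT z b) (bary hT z q) with h | h | h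
        · exact (E.swap.side_edge hk hbT hv0 h).1
        · exact absurd (E.eq_of_bary (hv0.trans E.q_zero.symm) h ▸ hqΓ.2) hbΓ
        · exact E.swap.side_far hk' hbT hv0 h
      · rcases lt_trichotomy (bary hT y b) (bary hT y p) with h | h | h
        · exact (E.side_edge hk hbT hv0 h).1
        · exact absurd (E.eq_of_bary h (hv0.trans E.p_zero.symm) ▸ hpΓ.2) hbΓ
        · exact E.side_far hk' hbT hv0 h
    have hm := hint (1 / 2) (by norm_num)
    have hmΓ : γ (1 / 2) ∈ K.Γ := by
      have : γ (1 / 2) ∈ hull T ∩ K.Γ := by rw [hΓ]; exact ⟨1 / 2, by norm_num, rfl⟩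
      exact this.2
    obtain ⟨w, hw, hws⟩ := mem_closure_iff.1 (interface_subset_closure (1 - k') hmΓ) _
      isOpen_interior hm
    obtain ⟨b, hb, hbΓ, hbs⟩ := hray w hw (notMem_interface_of_mem_sub hws) _ (subset_closure hws)
    exact fin_two_ne k' (eq_of_mem_closure hbΓ hbs (hall b hb hbΓ))
  refine ⟨k, ⟨E, ⟨γ, hγ0, hγ1, hΓ, fun a ha b hb => ?_⟩, hk, ?_⟩⟩
  · have e : γ a - γ b = (a - b) • (q - p) + (g a - g b) • ν := by
      simp only [hγ, sub_smul]
      abel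
    rw [dist_eq_norm, e, dist_comm, dist_eq_norm]
    refine (norm_add_le _ _).trans ?_
    rw [norm_smul, norm_smul, hν, mul_one, Real.norm_eq_abs, Real.norm_eq_abs]
    have := hgL a ha b hb
    linarith
  · rw [← fin_two_eq_of_ne hkk]
    exact hk'

/-! ### Length of the interface, areas of the parts of a triangle -/

theorem ArcCut.measure_le {hT : T ∈ K.mesh.cells} {x y z p q : Plane} {k : Fin 2}
    (A : K.ArcCut L hT x y z p q k) (hL : 0 ≤ L) :
    μH[1] (hull T ∩ K.Γ) ≤ ENNReal.ofReal ((1 + L) * dist p q) := by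
  obtain ⟨γ, -, -, hΓ, hγ⟩ := A.param
  have hl : LipschitzOnWith (Real.toNNReal ((1 + L) * dist p q)) γ (Set.Icc 0 1) := by
    refine LipschitzOnWith.of_dist_le_mul fun s hs t ht => ?_
    rw [Real.coe_toNNReal _ (by positivity), Real.dist_eq]
    exact hγ s hs t ht
  have h := hl.hausdorffMeasure_image_le (d := 1) zero_le_one
  rw [← hΓ, hausdorffMeasure_real, Real.volume_Icc] at h
  simpa [ENNReal.ofReal] using h

theorem Regular.measure_interface_le (R : K.Regular σ L) (hT : T ∈ K.mesh.cells) :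
    μH[1] (hull T ∩ K.Γ) ≤ ENNReal.ofReal ((1 + L) * K.h) := by
  by_cases hne : (hull T ∩ K.Γ).Nonempty
  · obtain ⟨-, x, y, z, p, q, k, A⟩ := R.exists_arcCut hT hne
    refine (A.measure_le R.L_nonneg).trans (ENNReal.ofReal_le_ofReal ?_)
    have := R.diam_le T hT p A.p_mem.1 q A.q_mem.1
    have := R.L_nonneg
    gcongr
  · rw [Set.not_nonempty_iff_eq_empty.1 hne]
    simp

theorem Regular.measure_interface_lt_top (R : K.Regular σ L) (hT : T ∈ K.mesh.cells) :
    μH[1] (hull T ∩ K.Γ) < ⊤ :=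
  (R.measure_interface_le hT).trans_lt ENNReal.ofReal_lt_top

theorem isCompact_hull_inter (K : CutMesh Ω) (T : Finset Plane) : IsCompact (hull T ∩ K.Γ) :=
  (isCompact_hull T).inter_right K.isClosed_interface

theorem Regular.integrableOn_bounded (R : K.Regular σ L) (hT : T ∈ K.mesh.cells)
    {E : Type*} [NormedAddCommGroup E] {f : Plane → E} {b : ℝ}
    (hf : AEStronglyMeasurable f μH[1]) (hb : ∀ y ∈ hull T, ‖f y‖ ≤ b) :
    IntegrableOn f (hull T ∩ K.Γ) μH[1] :=
  Measure.integrableOn_of_bounded (R.measure_interface_lt_top hT).ne hf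
    (M := b) ((ae_restrict_iff' (K.isCompact_hull_inter T).measurableSet).2
      (Filter.Eventually.of_forall fun y hy => hb y hy.1))

theorem Regular.integrableOn_continuous (R : K.Regular σ L) (hT : T ∈ K.mesh.cells)
    {f : Plane → ℝ} (hf : Continuous f) : IntegrableOn f (hull T ∩ K.Γ) μH[1] := by
  obtain ⟨b, hb⟩ := (isCompact_hull T).exists_bound_of_continuousOn hf.continuousOn
  exact R.integrableOn_bounded hT hf.aestronglyMeasurable hb

theorem Regular.volume_interface (R : K.Regular σ L) (hT : T ∈ K.mesh.cells) :
    volume (hull T ∩ K.Γ) = 0 := by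
  by_cases hne : (hull T ∩ K.Γ).Nonempty
  · exact (R.exists_arcCut hT hne).1
  · rw [Set.not_nonempty_iff_eq_empty.1 hne, measure_empty]

theorem measurableSet_hull_inter_sub (K : CutMesh Ω) (T : Finset Plane) (k : Fin 2) :
    MeasurableSet (hull T ∩ K.sub k) :=
  (isClosed_hull T).measurableSet.inter (K.isInterface.isOpen k).measurableSet

theorem volume_hull_inter_ne_top (T : Finset Plane) (S : Set Plane) :
    volume (hull T ∩ S) ≠ ⊤ :=
  ((measure_mono Set.inter_subset_left).trans_lt (isCompact_hull T).measure_lt_top).ne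

/-- The two parts exhaust the triangle up to its frontier and Γ, both of which are null sets. -/
theorem Regular.weight_add (R : K.Regular σ L) (hT : T ∈ K.mesh.cells) :
    K.weight T 0 + K.weight T 1 = 1 := by
  have h1 : volume.real ((hull T ∩ K.sub 0) ∪ (hull T ∩ K.sub 1)) = volume.real (hull T) := by
    refine measureReal_congr (Filter.eventuallyLE_antisymm_iff.2 ⟨?_, ?_⟩)
    · exact (Set.union_subset Set.inter_subset_left Set.inter_subset_left).eventuallyLE
    · rw [ae_le_set]
      refine measure_mono_null (t := frontier (hull T) ∪ (hull T ∩ K.Γ)) ?_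
        (measure_union_null ((convex_hull T).addHaar_frontier volume) (R.volume_interface hT))
      rintro y ⟨hy, hn⟩
      by_cases hyi : y ∈ interior (hull T)
      · right
        refine ⟨hy, by_contra fun hΓ => hn ?_⟩
        obtain ⟨k, hk⟩ := exists_mem_sub (interior_hull_subset R.reg hT hyi) hΓ
        fin_cases k
        exacts [Or.inl ⟨hy, hk⟩, Or.inr ⟨hy, hk⟩]
      · left
        rw [(isClosed_hull T).frontier_eq]
        exact ⟨hy, hyi⟩
  rw [measureReal_union (K.isInterface.disjoint.mono Set.inter_subset_right Set.inter_subset_right)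
    (K.measurableSet_hull_inter_sub T 1) (volume_hull_inter_ne_top _ _)
    (volume_hull_inter_ne_top _ _)] at h1
  rw [weight, weight, ← add_div, h1, div_self (R.volume_hull_pos hT).ne']

theorem weight_nonneg (K : CutMesh Ω) (T : Finset Plane) (k : Fin 2) : 0 ≤ K.weight T k :=
  div_nonneg measureReal_nonneg measureReal_nonneg

theorem Regular.weight_le_one (R : K.Regular σ L) (hT : T ∈ K.mesh.cells) (k : Fin 2) :
    K.weight T k ≤ 1 := by
  have h := R.weight_add hT
  have h0 := K.weight_nonneg T 0
  have h1 := K.weight_nonneg T 1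
  fin_cases k
  · change K.weight T 0 ≤ 1
    linarith
  · change K.weight T 1 ≤ 1
    linarith

/-! ### The part of an edge up to the interface -/

/-- The values of an affine function on a part of an edge are controlled by its values on the
interface and by its gradient on the part of the triangle between the edge and the interface. -/
theorem Regular.integral_edge_le (R : K.Regular σ L) (hT : T ∈ K.mesh.cells) {A B C : Plane}
    (hmem : ∀ v, v ∈ T ↔ v = A ∨ v = B ∨ v = C) (hAB : A ≠ B) (hAC : A ≠ C) (hBC : B ≠ C)
    {e : ℝ} (he : 0 ≤ e) {k : Fin 2}
    (hside : ∀ ζ ∈ Set.Ioo 0 e, AffineMap.lineMap (k := ℝ) A C ζ ∈ closure (K.sub k) ∧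
      AffineMap.lineMap (k := ℝ) A C ζ ∉ K.Γ)
    (hcross : ∀ ζ ∈ Set.Ioo 0 e, ∃ y ∈ hull T ∩ K.Γ, bary hT C y = ζ)
    (f : Plane →ᵃ[ℝ] ℝ) :
    ∫ ζ in (0 : ℝ)..e, (f A + ζ * (f C - f A)) ^ 2 ≤
      2 / σ * (K.h⁻¹ * ∫ y in hull T ∩ K.Γ, f y ^ 2 ∂μH[1]) +
      2 * (K.weight T k * K.h ^ 2 * ‖agrad f‖ ^ 2) := by
  classical
  have hA : A ∈ T := (hmem A).2 (Or.inl rfl)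
  have hB : B ∈ T := (hmem B).2 (Or.inr (Or.inl rfl))
  have hC : C ∈ T := (hmem C).2 (Or.inr (Or.inr rfl))
  have hsum3 : ∀ g : Plane → ℝ, ∑ v ∈ T, g v = g A + g B + g C := by
    intro g
    have : T = {A, B, C} := by ext v; rw [hmem]; simp
    rw [this, Finset.sum_insert (by simp [hAB, hAC]), Finset.sum_pair hBC]
    ring
  have hadd : ∀ w, bary hT A w + bary hT B w + bary hT C w = 1 := fun w => by
    rw [← hsum3 (fun v => bary hT v w), sum_bary]
  -- Coordinates adapted to the edge: `ζ` runs along it from `A` to `C`, and `η` leads away from it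
  -- in the direction from `A` to `B`.
  set P : ℝ → ℝ → Plane := fun ζ η => A + (η • (B - A) + ζ • (C - A)) with hP
  have hPlin : ∀ (g : Plane →ᵃ[ℝ] ℝ) ζ η, g (P ζ η) = g A + η * (g B - g A) + ζ * (g C - g A) := by
    intro g ζ η
    have h1 := apply_sub_apply g (P ζ η) A
    rw [hP, add_sub_cancel_left, inner_add_right, inner_smul_right, inner_smul_right,
      ← apply_sub_apply, ← apply_sub_apply] at h1
    simp only [hP]
    linarith
  have hPB : ∀ ζ η, bary hT B (P ζ η) = η := fun ζ η => by
    rw [hPlin, bary_self hT hB, bary_of_ne hT hA hAB, bary_of_ne hT hC hBC.symm]; ring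
  have hPC : ∀ ζ η, bary hT C (P ζ η) = ζ := fun ζ η => by
    rw [hPlin, bary_self hT hC, bary_of_ne hT hA hAC, bary_of_ne hT hB hBC]; ring
  have hPA : ∀ ζ η, bary hT A (P ζ η) = 1 - ζ - η := fun ζ η => by
    have := hadd (P ζ η)
    rw [hPB, hPC] at this
    linarith
  have hPself : ∀ w, P (bary hT C w) (bary hT B w) = w := by
    intro w
    refine eq_of_bary_eq hT fun v hv => ?_
    rcases (hmem v).1 hv with rfl | rfl | rfl
    · rw [hPA]; linarith [hadd w]
    · rw [hPB]
    · rw [hPC]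
  have hP0 : ∀ ζ, P ζ 0 = AffineMap.lineMap (k := ℝ) A C ζ := by
    intro ζ
    simp only [hP, zero_smul, zero_add, AffineMap.lineMap_apply, vsub_eq_sub, vadd_eq_add]
    rw [add_comm]
  -- the coordinates of the points of the interface
  set Λ : Plane → ℝ × ℝ := fun w => (bary hT C w, bary hT B w) with hΛ
  have hΛc : Continuous Λ := (bary_continuous hT C).prodMk (bary_continuous hT B)
  have hKc : IsCompact (Λ '' (hull T ∩ K.Γ)) := (K.isCompact_hull_inter T).image hΛc
  -- On each fibre there is a first point of the interface, by compactness; its height will be `ρ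
  -- ζ`.
  have hfib : ∀ ζ ∈ Set.Ioo 0 e, ∃ η, IsLeast {η | P ζ η ∈ hull T ∩ K.Γ} η := by
    intro ζ hζ
    have hPc : Continuous (P ζ) := by simp only [hP]; fun_prop
    have hc : IsCompact (P ζ ⁻¹' (hull T ∩ K.Γ)) := by
      have hcl := (K.isCompact_hull_inter T).isClosed.preimage hPc
      refine (isCompact_Icc (a := (0 : ℝ)) (b := 1)).of_isClosed_subset hcl fun η hη => ?_
      have h1 := bary_nonneg hT B hη.1
      have h2 := bary_le_one hT B hη.1
      rw [hPB] at h1 h2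
      exact ⟨h1, h2⟩
    obtain ⟨y, hy, hyζ⟩ := hcross ζ hζ
    refine hc.exists_isLeast ⟨bary hT B y, ?_⟩
    rw [Set.mem_preimage, ← hyζ, hPself]
    exact hy
  choose! ρ₀ hρ₀ using hfib
  set ρ : ℝ → ℝ := (Set.Ioo 0 e).indicator ρ₀ with hρ
  have hρeq : ∀ ζ ∈ Set.Ioo 0 e, ρ ζ = ρ₀ ζ := fun ζ hζ => Set.indicator_of_mem hζ _
  -- Within (0, e) a sublevel set of the first height is the projection of a compact set.
  have hρm : Measurable ρ := by
    refine measurable_of_Iic fun c => ?_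
    have hcl : IsCompact (Prod.fst '' (Λ '' (hull T ∩ K.Γ) ∩ {w | w.2 ≤ c})) :=
      (hKc.inter_right (isClosed_le continuous_snd continuous_const)).image continuous_fst
    have : ρ ⁻¹' Set.Iic c = (Set.Ioo 0 e ∩ Prod.fst '' (Λ '' (hull T ∩ K.Γ) ∩ {w | w.2 ≤ c})) ∪
        ((Set.Ioo 0 e)ᶜ ∩ {_ζ | 0 ≤ c}) := by
      ext ζ
      by_cases hζ : ζ ∈ Set.Ioo 0 e
      · simp only [Set.mem_preimage, Set.mem_Iic, hρeq ζ hζ, Set.mem_union, Set.mem_inter_iff, hζ,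
          true_and, Set.mem_compl_iff, not_true_eq_false, false_and, or_false]
        constructor
        · intro h
          refine ⟨Λ (P ζ (ρ₀ ζ)), ⟨⟨_, (hρ₀ ζ hζ).1, rfl⟩, ?_⟩, ?_⟩
          · simpa [hΛ, hPB] using h
          · simp [hΛ, hPC]
        · rintro ⟨_, ⟨⟨w, hw, rfl⟩, hwc⟩, rfl⟩
          refine (mem_lowerBounds.1 (hρ₀ _ hζ).2 (bary hT B w) ?_).trans hwc
          simp only [hΛ, Set.mem_ofPred_eq, hPself]
          exact hw
      · simp only [Set.mem_preimage, Set.mem_Iic, hρ, Set.indicator_of_notMem hζ, Set.mem_union,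
          Set.mem_inter_iff, hζ, false_and, Set.mem_compl_iff, not_false_eq_true, true_and,
          false_or, Set.mem_ofPred_eq]
    rw [this]
    exact (measurableSet_Ioo.inter hcl.measurableSet).union
      (measurableSet_Ioo.compl.inter (.const _))
  have hhit : ∀ ζ ∈ Set.Ioo 0 e, P ζ (ρ ζ) ∈ hull T ∩ K.Γ := fun ζ hζ => by
    rw [hρeq ζ hζ]
    exact (hρ₀ ζ hζ).1
  have hρ01 : ∀ ζ ∈ Set.Ioo 0 e, 0 ≤ ρ ζ ∧ ρ ζ ≤ 1 := fun ζ hζ => by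
    have h1 := bary_nonneg hT B (hhit ζ hζ).1
    have h2 := bary_le_one hT B (hhit ζ hζ).1
    rw [hPB] at h1 h2
    exact ⟨h1, h2⟩
  have hρint : IntegrableOn ρ (Set.Ioo 0 e) := by
    refine Measure.integrableOn_of_bounded (M := 1) (by simp) hρm.aestronglyMeasurable ?_
    refine (ae_restrict_iff' measurableSet_Ioo).2 (Filter.Eventually.of_forall fun ζ hζ => ?_)
    rw [Real.norm_of_nonneg (hρ01 ζ hζ).1]
    exact (hρ01 ζ hζ).2
  -- the area between the edge and the interface
  have harea : ∫ ζ in Set.Ioo 0 e, ρ ζ ≤ K.weight T k := by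
    -- A point below the first height is joined to the edge along its fibre without meeting Γ, so it
    -- has the side of the edge.
    have hregion : ∀ w, Λ w ∈ regionBetween (fun _ => 0) ρ (Set.Ioo 0 e) →
        w ∈ hull T ∩ K.sub k := by
      rintro w ⟨hζ, hη⟩
      set ζ := bary hT C w with hζdef
      set η := bary hT B w with hηdef
      have hζ : ζ ∈ Set.Ioo 0 e := hζ
      have hη : η ∈ Set.Ioo 0 (ρ ζ) := hη
      have hApos : ∀ η' < ρ ζ, 0 < bary hT A (P ζ η') := by
        intro η' hη'
        have := bary_nonneg hT A (hhit ζ hζ).1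
        rw [hPA] at this ⊢
        linarith
      have hmemT : ∀ η', 0 ≤ η' → η' < ρ ζ → P ζ η' ∈ hull T := by
        intro η' h0 h1
        refine (mem_hull hT).2 fun v hv => ?_
        rcases (hmem v).1 hv with rfl | rfl | rfl
        · exact (hApos η' h1).le
        · rw [hPB]; exact h0
        · rw [hPC]; exact hζ.1.le
      have hnot : ∀ η', 0 ≤ η' → η' < ρ ζ → P ζ η' ∉ K.Γ := by
        intro η' h0 h1 hΓ
        have := mem_lowerBounds.1 (hρ₀ ζ hζ).2 η' ⟨hmemT η' h0 h1, hΓ⟩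
        rw [← hρeq ζ hζ] at this
        linarith
      have hw : w = P ζ η := (hPself w).symm
      have hwint : w ∈ interior (hull T) := by
        refine (mem_interior_hull hT).2 fun v hv => ?_
        rcases (hmem v).1 hv with rfl | rfl | rfl
        · rw [hw]; exact hApos η hη.2
        · exact hη.1
        · exact hζ.1
      refine ⟨interior_subset hwint, mem_sub_of_mem_closure (interior_hull_subset R.reg hT hwint)
        (by rw [hw]; exact hnot η hη.1.le hη.2) ?_⟩
      refine side_of_lineMap (a := P ζ 0) (fun t ht => ?_) (by rw [hP0]; exact (hside ζ hζ).1)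
      have e1 : AffineMap.lineMap (k := ℝ) (P ζ 0) w t = P ζ (t * η) := by
        rw [hw]
        simp only [hP, AffineMap.lineMap_apply, vsub_eq_sub, vadd_eq_add, zero_smul, mul_smul]
        rw [show A + (η • (B - A) + ζ • (C - A)) - (A + (0 + ζ • (C - A))) = η • (B - A) by abel]
        abel
      have h0 : 0 ≤ t * η := mul_nonneg ht.1 hη.1.le
      have h1 : t * η < ρ ζ := lt_of_le_of_lt (mul_le_of_le_one_left hη.1.le ht.2) hη.2
      rw [e1]
      exact ⟨hull_subset_closure hT (hmemT _ h0 h1), hnot _ h0 h1⟩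
    have hunit : ∀ w ∈ hull T, Λ w ∈ Set.Icc (0 : ℝ) 1 ×ˢ Set.Icc (0 : ℝ) 1 := fun w hw =>
      ⟨⟨bary_nonneg hT C hw, bary_le_one hT C hw⟩, ⟨bary_nonneg hT B hw, bary_le_one hT B hw⟩⟩
    -- The coordinates transform the area by a constant factor `c`. No determinant is computed: the
    -- triangle is mapped into the unit square, hence its area is at most `c`, and this suffices.
    obtain ⟨c, hc⟩ : ∃ c : ENNReal, Measure.map Λ volume = c • volume := by
      set l : Plane →ₗ[ℝ] ℝ × ℝ := (bary hT C).linear.prod (bary hT B).linear with hl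
      have hlv : ∀ v, l v = (inner ℝ (agrad (bary hT C)) v, inner ℝ (agrad (bary hT B)) v) := by
        intro v
        simp [hl, inner_agrad]
      have hsurj : Function.Surjective l := by
        rintro ⟨s, t⟩
        refine ⟨t • (B - A) + s • (C - A), ?_⟩
        have k1 := hPC s t
        have k2 := hPB s t
        have k3 := apply_sub_apply (bary hT C) (P s t) A
        have k4 := apply_sub_apply (bary hT B) (P s t) A
        rw [hP, add_sub_cancel_left] at k3 k4
        rw [hlv, ← k3, ← k4]
        simp only [hP] at k1 k2
        rw [k1, k2, bary_of_ne hT hA hAC, bary_of_ne hT hA hAB]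
        simp
      obtain ⟨c, -, hc⟩ := l.exists_map_addHaar_eq_smul_addHaar volume volume hsurj
      refine ⟨c, ?_⟩
      have e1 : Λ = (fun u => u + Λ 0) ∘ l := by
        ext w
        · have := apply_sub_apply (bary hT C) w 0
          rw [sub_zero] at this
          simp only [hΛ, Function.comp, hlv, Prod.fst_add]
          linarith
        · have := apply_sub_apply (bary hT B) w 0
          rw [sub_zero] at this
          simp only [hΛ, Function.comp, hlv, Prod.snd_add]
          linarith
      rw [e1, ← Measure.map_map (by fun_prop) l.continuous_of_finiteDimensional.measurable, hc,
        Measure.map_smul, map_add_right_eq_self]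
    have hreg0 : MeasurableSet (regionBetween (fun _ => (0 : ℝ)) ρ (Set.Ioo 0 e)) :=
      measurableSet_regionBetween measurable_const hρm measurableSet_Ioo
    have hvr : volume (regionBetween (fun _ => (0 : ℝ)) ρ (Set.Ioo 0 e)) =
        ENNReal.ofReal (∫ ζ in Set.Ioo 0 e, ρ ζ) := by
      have := volume_regionBetween_eq_integral (μ := volume) (f := fun _ => (0 : ℝ)) (g := ρ)
        (s := Set.Ioo 0 e) integrableOn_zero hρint measurableSet_Ioo (fun ζ hζ => (hρ01 ζ hζ).1)
      rw [Measure.volume_eq_prod, this]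
      simp
    have h1 : c * ENNReal.ofReal (∫ ζ in Set.Ioo 0 e, ρ ζ) ≤ volume (hull T ∩ K.sub k) := by
      have := congrArg (fun m => m (regionBetween (fun _ => (0 : ℝ)) ρ (Set.Ioo 0 e))) hc
      simp only [Measure.smul_apply, smul_eq_mul] at this
      rw [Measure.map_apply hΛc.measurable hreg0, hvr] at this
      rw [← this]
      exact measure_mono hregion
    have h2 : volume (hull T) ≤ c := by
      have := congrArg (fun m => m (Set.Icc (0 : ℝ) 1 ×ˢ Set.Icc (0 : ℝ) 1)) hc
      simp only [Measure.smul_apply, smul_eq_mul] at this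
      rw [Measure.map_apply hΛc.measurable (measurableSet_Icc.prod measurableSet_Icc),
        Measure.volume_eq_prod, Measure.prod_prod, Real.volume_Icc] at this
      simp only [sub_zero, ENNReal.ofReal_one, mul_one] at this
      rw [← this]
      exact measure_mono hunit
    have h3 : volume (hull T) * ENNReal.ofReal (∫ ζ in Set.Ioo 0 e, ρ ζ) ≤
        volume (hull T ∩ K.sub k) := (mul_le_mul_left h2 _).trans h1
    have h4 := ENNReal.toReal_mono (volume_hull_inter_ne_top _ _) h3
    rw [ENNReal.toReal_mul, ENNReal.toReal_ofReal
      (setIntegral_nonneg measurableSet_Ioo fun ζ hζ => (hρ01 ζ hζ).1)] at h4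
    rw [weight, le_div_iff₀ (R.volume_hull_pos hT), mul_comm]
    exact h4
  -- the values at the first points of the interface
  have hYm : Measurable (fun ζ => P ζ (ρ ζ)) := by
    simp only [hP]
    fun_prop
  have hσh : 0 < σ * K.h := mul_pos R.σ_pos R.h_pos
  have hhits : ∫ ζ in Set.Ioo 0 e, f (P ζ (ρ ζ)) ^ 2 ≤
      (σ * K.h)⁻¹ * ∫ y in hull T ∩ K.Γ, f y ^ 2 ∂μH[1] := by
    -- The parameter ζ is recovered from the hitting point by the coordinate of `C`, which is
    -- Lipschitz with constant 1/(σh). So the hitting points are distributed with at most this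
    -- density with respect to length.
    have hle : Measure.map (fun ζ => P ζ (ρ ζ)) (volume.restrict (Set.Ioo 0 e)) ≤
        (Real.toNNReal (σ * K.h)⁻¹ : ENNReal) • (μH[1].restrict (hull T ∩ K.Γ)) := by
      refine Measure.le_iff.2 fun S hS => ?_
      rw [Measure.map_apply hYm hS, Measure.restrict_apply (hYm hS), Measure.smul_apply,
        Measure.restrict_apply hS, smul_eq_mul]
      have hlip : LipschitzWith (Real.toNNReal (σ * K.h)⁻¹) (bary hT C) := by
        refine LipschitzWith.of_dist_le_mul fun v w => ?_
        rw [Real.coe_toNNReal _ (by positivity), Real.dist_eq, ← div_eq_inv_mul]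
        exact R.abs_bary_sub_le hT C v w
      have h1 := hlip.hausdorffMeasure_image_le (d := 1) zero_le_one (S ∩ (hull T ∩ K.Γ))
      rw [hausdorffMeasure_real] at h1
      simp only [ENNReal.rpow_one] at h1
      refine (measure_mono ?_).trans h1
      rintro ζ ⟨hζS, hζ⟩
      exact ⟨P ζ (ρ ζ), ⟨hζS, hhit ζ hζ⟩, hPC _ _⟩
    have hcont : Continuous (fun y => f y ^ 2) := (continuous_affine f).pow 2
    have hint : Integrable (fun y => f y ^ 2)
        ((Real.toNNReal (σ * K.h)⁻¹ : ENNReal) • (μH[1].restrict (hull T ∩ K.Γ))) :=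
      Integrable.smul_measure (R.integrableOn_continuous hT hcont) ENNReal.coe_ne_top
    have h1 := integral_mono_measure hle (Filter.Eventually.of_forall fun y => sq_nonneg _) hint
    rw [integral_map hYm.aemeasurable hcont.aestronglyMeasurable, integral_smul_measure] at h1
    rwa [ENNReal.coe_toReal, Real.coe_toNNReal _ (inv_pos.2 hσh).le, smul_eq_mul] at h1
  -- conclusion
  have hdist : dist B A ≤ K.h := R.diam_le T hT B (mem_hull_of_mem hB) A (mem_hull_of_mem hA)
  have hg := sq_apply_sub_le f hdist
  have hpt : ∀ ζ ∈ Set.Ioo 0 e, (f A + ζ * (f C - f A)) ^ 2 ≤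
      2 * f (P ζ (ρ ζ)) ^ 2 + 2 * (K.h ^ 2 * ‖agrad f‖ ^ 2) * ρ ζ := by
    intro ζ hζ
    have h1 := hPlin f ζ (ρ ζ)
    obtain ⟨r0, r1⟩ := hρ01 ζ hζ
    have h2 : f A + ζ * (f C - f A) = f (P ζ (ρ ζ)) - ρ ζ * (f B - f A) := by rw [h1]; ring
    -- As ρ ≤ 1, its square is at most ρ, and the integral of ρ is bounded by the weight of the
    -- part.
    have h3 : (ρ ζ * (f B - f A)) ^ 2 ≤ ρ ζ * (K.h ^ 2 * ‖agrad f‖ ^ 2) := by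
      have : ρ ζ ^ 2 ≤ ρ ζ := by nlinarith
      rw [mul_pow]
      exact mul_le_mul this hg (sq_nonneg _) r0
    rw [h2]
    nlinarith [sq_nonneg (f (P ζ (ρ ζ)) + ρ ζ * (f B - f A))]
  have hi1 : IntegrableOn (fun ζ => f (P ζ (ρ ζ)) ^ 2) (Set.Ioo 0 e) := by
    obtain ⟨b, hb⟩ := (isCompact_hull T).exists_bound_of_continuousOn
      ((continuous_affine f).pow 2).continuousOn
    refine Measure.integrableOn_of_bounded (M := b) (by simp)
      (((continuous_affine f).pow 2).measurable.comp hYm).aestronglyMeasurable ?_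
    exact (ae_restrict_iff' measurableSet_Ioo).2 (Filter.Eventually.of_forall fun ζ hζ =>
      hb _ (hhit ζ hζ).1)
  rw [intervalIntegral.integral_of_le he, integral_Ioc_eq_integral_Ioo]
  calc ∫ ζ in Set.Ioo 0 e, (f A + ζ * (f C - f A)) ^ 2
      ≤ ∫ ζ in Set.Ioo 0 e, (2 * f (P ζ (ρ ζ)) ^ 2 + 2 * (K.h ^ 2 * ‖agrad f‖ ^ 2) * ρ ζ) := by
        refine setIntegral_mono_on ?_ ((hi1.const_mul 2).add (hρint.const_mul _))
          measurableSet_Ioo hpt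
        exact (Continuous.integrableOn_Icc (a := 0) (b := e) (by fun_prop)).mono_set
          Set.Ioo_subset_Icc_self
    _ = 2 * (∫ ζ in Set.Ioo 0 e, f (P ζ (ρ ζ)) ^ 2) +
        2 * (K.h ^ 2 * ‖agrad f‖ ^ 2) * ∫ ζ in Set.Ioo 0 e, ρ ζ := by
        rw [integral_add (hi1.const_mul 2) (hρint.const_mul _), integral_const_mul,
          integral_const_mul]
    _ ≤ 2 * ((σ * K.h)⁻¹ * ∫ y in hull T ∩ K.Γ, f y ^ 2 ∂μH[1]) +
        2 * (K.h ^ 2 * ‖agrad f‖ ^ 2) * K.weight T k := by gcongr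
    _ = _ := by
        rw [mul_inv]
        ring

/-! ### The local energy -/

/-- The scaled square of the `L²` norm on the part of the interface in `T`. -/
def ifc (K : CutMesh Ω) (T : Finset Plane) (w : Plane →ᵃ[ℝ] ℝ) : ℝ :=
  K.h⁻¹ * ∫ y in hull T ∩ K.Γ, w y ^ 2 ∂μH[1]

/-- The local energy of a pair of affine functions. -/
def energy (K : CutMesh Ω) (T : Finset Plane) (f : Fin 2 → Plane →ᵃ[ℝ] ℝ) : ℝ :=
  ∑ i, K.weight T i * (K.h ^ 2 * ‖agrad (f i)‖ ^ 2) + K.ifc T (f 0 - f 1)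

namespace Regular

theorem ifc_nonneg (R : K.Regular σ L) (T : Finset Plane) (w : Plane →ᵃ[ℝ] ℝ) : 0 ≤ K.ifc T w :=
  mul_nonneg (inv_nonneg.2 R.h_pos.le) (integral_nonneg fun _ => sq_nonneg _)

theorem integrableOn_sq (R : K.Regular σ L) (hT : T ∈ K.mesh.cells) (w : Plane →ᵃ[ℝ] ℝ) :
    IntegrableOn (fun y => w y ^ 2) (hull T ∩ K.Γ) μH[1] :=
  R.integrableOn_continuous hT ((continuous_affine w).pow 2)

theorem ifc_add_le (R : K.Regular σ L) (hT : T ∈ K.mesh.cells) (v w : Plane →ᵃ[ℝ] ℝ) :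
    K.ifc T (v + w) ≤ 2 * K.ifc T v + 2 * K.ifc T w := by
  have h1 : ∫ y in hull T ∩ K.Γ, (v + w) y ^ 2 ∂μH[1] ≤
      ∫ y in hull T ∩ K.Γ, (2 * v y ^ 2 + 2 * w y ^ 2) ∂μH[1] := by
    refine integral_mono (R.integrableOn_sq hT _)
      (((R.integrableOn_sq hT v).const_mul 2).add ((R.integrableOn_sq hT w).const_mul 2)) fun y => ?_
    simp only [AffineMap.coe_add, Pi.add_apply]
    nlinarith [sq_nonneg (v y - w y)]
  rw [integral_add ((R.integrableOn_sq hT v).const_mul 2) ((R.integrableOn_sq hT w).const_mul 2),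
    integral_const_mul, integral_const_mul] at h1
  have := mul_le_mul_of_nonneg_left h1 (inv_nonneg.2 R.h_pos.le)
  unfold ifc
  linarith

theorem ifc_le (R : K.Regular σ L) {w : Plane →ᵃ[ℝ] ℝ} {l b : ℝ}
    (hl : 0 ≤ l) (hm : μH[1] (hull T ∩ K.Γ) ≤ ENNReal.ofReal l)
    (hb : ∀ y ∈ hull T ∩ K.Γ, |w y| ≤ b) : K.ifc T w ≤ K.h⁻¹ * (l * b ^ 2) := by
  refine mul_le_mul_of_nonneg_left ?_ (inv_nonneg.2 R.h_pos.le)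
  have h1 := norm_setIntegral_le_of_norm_le_const (μ := μH[1]) (f := fun y => w y ^ 2)
    (hm.trans_lt ENNReal.ofReal_lt_top) (C := b ^ 2) (fun y hy => by
      rw [Real.norm_of_nonneg (sq_nonneg _), ← sq_abs]
      exact pow_le_pow_left₀ (abs_nonneg _) (hb y hy) 2)
  have h2 : (μH[1] : Measure Plane).real (hull T ∩ K.Γ) ≤ l := by
    rw [measureReal_def, ← ENNReal.toReal_ofReal hl]
    exact ENNReal.toReal_mono ENNReal.ofReal_ne_top hm
  calc _ ≤ _ := (le_abs_self _).trans h1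
    _ ≤ _ := by
      rw [mul_comm]
      gcongr

theorem ifc_bary_le (R : K.Regular σ L) (hT : T ∈ K.mesh.cells) (v : Plane) :
    K.ifc T (bary hT v) ≤ 1 + L := by
  have hL := R.L_nonneg
  have hh := R.h_pos
  have h := R.ifc_le (w := bary hT v) (by positivity) (R.measure_interface_le hT) (b := 1)
    (fun y hy => by
      rw [abs_of_nonneg (bary_nonneg hT v hy.1)]
      exact bary_le_one hT v hy.1)
  calc _ ≤ _ := h
    _ = 1 + L := by field_simp

theorem energy_nonneg (R : K.Regular σ L) (T : Finset Plane) (f : Fin 2 → Plane →ᵃ[ℝ] ℝ) :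
    0 ≤ K.energy T f :=
  add_nonneg (Finset.sum_nonneg fun i _ => mul_nonneg (K.weight_nonneg T i) (by positivity))
    (R.ifc_nonneg T _)

theorem weight_grad_le (R : K.Regular σ L) (T : Finset Plane) (f : Fin 2 → Plane →ᵃ[ℝ] ℝ)
    (i : Fin 2) : K.weight T i * (K.h ^ 2 * ‖agrad (f i)‖ ^ 2) ≤ K.energy T f := by
  have h1 := Finset.single_le_sum
    (f := fun i => K.weight T i * (K.h ^ 2 * ‖agrad (f i)‖ ^ 2))
    (fun i _ => mul_nonneg (K.weight_nonneg T i) (by positivity)) (Finset.mem_univ i)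
  have h2 := R.ifc_nonneg T (f 0 - f 1)
  unfold energy
  linarith

theorem ifc_le_energy (T : Finset Plane) (f : Fin 2 → Plane →ᵃ[ℝ] ℝ) :
    K.ifc T (f 0 - f 1) ≤ K.energy T f := by
  have h1 : 0 ≤ ∑ i, K.weight T i * (K.h ^ 2 * ‖agrad (f i)‖ ^ 2) :=
    Finset.sum_nonneg fun i _ => mul_nonneg (K.weight_nonneg T i) (by positivity)
  unfold energy
  linarith

/-- The smaller weight is a lower bound of both weights, so it can be put in front of both
gradients. -/
theorem weight_jump_le (R : K.Regular σ L) (T : Finset Plane) (f : Fin 2 → Plane →ᵃ[ℝ] ℝ)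
    {k : Fin 2} (hk : K.weight T k ≤ K.weight T (1 - k)) :
    K.weight T k * (K.h ^ 2 * ‖agrad (f 0 - f 1)‖ ^ 2) ≤ 4 * K.energy T f := by
  have h0 := R.weight_grad_le T f 0
  have h1 := R.weight_grad_le T f 1
  have hw := K.weight_nonneg T k
  have hn : ‖agrad (f 0 - f 1)‖ ^ 2 ≤ 2 * ‖agrad (f 0)‖ ^ 2 + 2 * ‖agrad (f 1)‖ ^ 2 := by
    rw [map_sub]
    have := norm_sub_le (agrad (f 0)) (agrad (f 1))
    nlinarith [norm_nonneg (agrad (f 0) - agrad (f 1)), sq_nonneg (‖agrad (f 0)‖ - ‖agrad (f 1)‖)]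
  have hk0 : K.weight T k ≤ K.weight T 0 ∧ K.weight T k ≤ K.weight T 1 := by
    fin_cases k
    · exact ⟨le_rfl, hk⟩
    · exact ⟨hk, le_rfl⟩
  calc _ ≤ K.weight T k * (K.h ^ 2 * (2 * ‖agrad (f 0)‖ ^ 2 + 2 * ‖agrad (f 1)‖ ^ 2)) := by gcongr
    _ = 2 * (K.weight T k * (K.h ^ 2 * ‖agrad (f 0)‖ ^ 2)) +
        2 * (K.weight T k * (K.h ^ 2 * ‖agrad (f 1)‖ ^ 2)) := by ring
    _ ≤ 2 * (K.weight T 0 * (K.h ^ 2 * ‖agrad (f 0)‖ ^ 2)) +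
        2 * (K.weight T 1 * (K.h ^ 2 * ‖agrad (f 1)‖ ^ 2)) := by
      have := hk0.1
      have := hk0.2
      gcongr
    _ ≤ _ := by linarith

/-- On a triangle of which a substantial part belongs to the subdomain `m` the function `f m`
is constant up to the energy. -/
theorem sq_sub_le_of_weight (R : K.Regular σ L) (hT : T ∈ K.mesh.cells)
    (f : Fin 2 → Plane →ᵃ[ℝ] ℝ) {m : Fin 2} {c : ℝ} (hc : 0 < c) (hm : c ≤ K.weight T m)
    {v w : Plane} (hv : v ∈ hull T) (hw : w ∈ hull T) :
    (f m v - f m w) ^ 2 ≤ c⁻¹ * K.energy T f := by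
  have h1 := sq_apply_sub_le (f m) (R.diam_le T hT v hv w hw)
  have h2 := R.weight_grad_le T f m
  rw [inv_mul_eq_div, le_div_iff₀ hc]
  calc _ ≤ K.h ^ 2 * ‖agrad (f m)‖ ^ 2 * K.weight T m := by gcongr
    _ ≤ _ := by linarith

theorem exists_major (R : K.Regular σ L) (hT : T ∈ K.mesh.cells) :
    ∃ m, 1 / 2 ≤ K.weight T m ∧ K.weight T (1 - m) ≤ K.weight T m := by
  have h := R.weight_add hT
  rcases le_total (K.weight T 0) (K.weight T 1) with h1 | h1
  · exact ⟨1, by linarith, h1⟩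
  · exact ⟨0, by linarith, h1⟩

/-- A triangle that does not meet the interface belongs to one of the subdomains. -/
theorem exists_side_of_uncut (R : K.Regular σ L) (hT : T ∈ K.mesh.cells)
    (hΓ : ¬ (hull T ∩ K.Γ).Nonempty) :
    ∃ k, K.weight T k = 1 ∧ K.weight T (1 - k) = 0 ∧ ∀ v ∈ hull T, v ∈ Ω → v ∈ K.sub k := by
  have hno : ∀ y ∈ hull T, y ∉ K.Γ := fun y hy h => hΓ ⟨y, hy, h⟩
  obtain ⟨z, hz⟩ := R.disc T hT
  have hzT : z ∈ hull T := hz (Metric.mem_closedBall_self (mul_pos R.σ_pos R.h_pos).le)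
  obtain ⟨k, hk⟩ := K.exists_side (hull_subset_closure hT hzT)
  have hall := side_of_preconnected (convex_hull T).isPreconnected (hull_subset_closure hT) hno hzT hk
  have h0 : K.weight T (1 - k) = 0 := by
    have : hull T ∩ K.sub (1 - k) = ∅ := by
      ext y
      simp only [Set.mem_inter_iff, Set.mem_empty_iff_false, iff_false]
      rintro ⟨hy, hyk⟩
      exact hno y hy (mem_interface_of_mem_closure (fin_two_ne k) (subset_closure hyk) (hall hy))
    rw [weight, this]
    simp
  refine ⟨k, ?_, h0, fun v hv hvΩ => mem_sub_of_mem_closure hvΩ (hno v hv) (hall hv)⟩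
  have := R.weight_add hT
  fin_cases k
  · change K.weight T 1 = 0 at h0
    change K.weight T 0 = 1
    linarith
  · change K.weight T 0 = 0 at h0
    change K.weight T 1 = 1
    linarith

theorem vertex_notMem_interface (R : K.Regular σ L) (hT : T ∈ K.mesh.cells) {v : Plane}
    (hv : v ∈ T) (hΩ : v ∈ Ω) : v ∉ K.Γ :=
  R.vertex_notMem v (by
    simp only [interiorVertices, Finset.mem_filter]
    exact ⟨mem_vertices hT hv, hΩ⟩)

end Regular

/-! ### Estimates on a cut triangle -/

namespace ArcCut

variable {hT : T ∈ K.mesh.cells} {x y z p q : Plane} {k : Fin 2}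

/-- Along the arc the coordinate of `z` goes continuously from 0 at `p` to its value at `q`. -/
theorem exists_bary_eq (A : K.ArcCut L hT x y z p q k) {ζ : ℝ}
    (hζ : ζ ∈ Set.Ioo 0 (bary hT z q)) : ∃ w ∈ hull T ∩ K.Γ, bary hT z w = ζ := by
  obtain ⟨γ, h0, h1, hΓ, hL⟩ := A.param
  have hc : ContinuousOn γ (Set.Icc 0 1) := by
    have : LipschitzOnWith (Real.toNNReal ((1 + L) * dist p q)) γ (Set.Icc 0 1) := by
      refine LipschitzOnWith.of_dist_le_mul fun s hs t ht => ?_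
      rw [Real.dist_eq]
      refine (hL s hs t ht).trans ?_
      gcongr
      exact Real.le_coe_toNNReal _
    exact this.continuousOn
  have hc2 := (bary_continuous hT z).comp_continuousOn hc
  have := intermediate_value_Icc zero_le_one hc2
  simp only [Function.comp, h0, h1, A.p_zero] at this
  obtain ⟨t, ht, h⟩ := this ⟨hζ.1.le, hζ.2.le⟩
  exact ⟨γ t, by rw [hΓ]; exact ⟨t, ht, rfl⟩, h⟩

/-- The edge from `x` to `z` up to `q` lies on the side of `x`, and every fibre over this part meets
the arc. -/
theorem integral_edge_le (R : K.Regular σ L) (A : K.ArcCut L hT x y z p q k)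
    (f : Plane →ᵃ[ℝ] ℝ) :
    ∫ ζ in (0 : ℝ)..bary hT z q, (f x + ζ * (f z - f x)) ^ 2 ≤
      2 / σ * K.ifc T f + 2 * (K.weight T k * (K.h ^ 2 * ‖agrad f‖ ^ 2)) := by
  rw [← mul_assoc (K.weight T k)]
  refine R.integral_edge_le hT A.mem_iff A.xy A.xz A.yz A.q_pos.le (fun ζ hζ => ?_)
    (fun ζ hζ => A.exists_bary_eq hζ) f
  have hq1 := bary_le_one hT z A.q_mem.1
  refine A.swap.side_edge A.side_x (lineMap_mem_hull (mem_hull_of_mem A.hx) (mem_hull_of_mem A.hz)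
    ⟨hζ.1.le, hζ.2.le.trans hq1⟩) ?_ ?_
  · rw [bary_homothety, A.bary_y_x, A.bary_y_z]
    ring
  · rw [bary_homothety, A.bary_z_x, bary_self hT A.hz]
    linarith [hζ.2]

/-- The same arc is seen from the edge from `y` to `z`: fibres now lead towards `x`, and the region
between the edge and the arc is on the side `1 - k`. -/
theorem integral_opposite_edge_le (R : K.Regular σ L) (A : K.ArcCut L hT x y z p q k)
    (f : Plane →ᵃ[ℝ] ℝ) :
    ∫ ζ in (0 : ℝ)..bary hT z q, (f y + ζ * (f z - f y)) ^ 2 ≤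
      2 / σ * K.ifc T f + 2 * (K.weight T (1 - k) * (K.h ^ 2 * ‖agrad f‖ ^ 2)) := by
  rw [← mul_assoc (K.weight T (1 - k))]
  refine R.integral_edge_le hT (B := x) (fun v => by rw [A.mem_iff]; tauto) A.xy.symm A.yz A.xz
    A.q_pos.le (fun ζ hζ => ?_) (fun ζ hζ => A.exists_bary_eq hζ) f
  have hq1 := bary_le_one hT z A.q_mem.1
  have hm := lineMap_mem_hull (mem_hull_of_mem A.hy) (mem_hull_of_mem A.hz)
    (t := ζ) ⟨hζ.1.le, hζ.2.le.trans hq1⟩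
  have hbx : bary hT x (AffineMap.lineMap (k := ℝ) y z ζ) = 0 := by
    rw [bary_homothety, A.bary_x_y, A.bary_x_z]
    ring
  have hbz : bary hT z (AffineMap.lineMap (k := ℝ) y z ζ) = ζ := by
    rw [bary_homothety, A.bary_z_y, bary_self hT A.hz]
    ring
  have hΓ : AffineMap.lineMap (k := ℝ) y z ζ ∉ K.Γ := by
    intro h
    rcases A.eq_or_of_bary_eq_zero hm h A.hx hbx with h | h
    · rw [h, A.p_zero] at hbz
      linarith [hζ.1]
    · rw [h] at hbz
      linarith [hζ.2]
  exact ⟨A.side_yz _ hm hΓ hbx, hΓ⟩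

/-- The traces on both sides are close to each other at a vertex if the arc is long. -/
theorem sq_jump_le (R : K.Regular σ L) (A : K.ArcCut L hT x y z p q k)
    (f : Fin 2 → Plane →ᵃ[ℝ] ℝ) {η : ℝ} (hη : 0 < η) (hlong : η ≤ bary hT z q) {i : Fin 2}
    (hi : K.weight T i ≤ K.weight T (1 - i)) {v : Plane} (hv : v ∈ T) (hvi : v ∈ K.sub i) :
    ((f 0 - f 1) v) ^ 2 ≤ (64 / σ + 256) / η ^ 3 * K.energy T f := by
  set w := f 0 - f 1 with hw
  have hσ := R.σ_pos
  have hvΓ := notMem_interface_of_mem_sub hvi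
  have hq1 := bary_le_one hT z A.q_mem.1
  have hq0 := A.q_pos.le
  have hJ := Regular.ifc_le_energy (K := K) T f
  have hG := R.weight_jump_le T f hi
  have hE := R.energy_nonneg T f
  have hη1 : η ≤ 1 := hlong.trans hq1
  rw [← hw] at hJ hG
  have hs : 2 / σ * K.ifc T w + 2 * (K.weight T i * (K.h ^ 2 * ‖agrad w‖ ^ 2)) ≤
      (2 / σ + 8) * K.energy T f := by
    have : 2 / σ * K.ifc T w ≤ 2 / σ * K.energy T f := by gcongr
    linarith
  rw [div_mul_eq_mul_div, le_div_iff₀ (by positivity)]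
  have hfin : ∀ a I : ℝ, bary hT z q ^ 3 * a ^ 2 ≤ 32 * I → I ≤ (2 / σ + 8) * K.energy T f →
      a ^ 2 * η ^ 3 ≤ (64 / σ + 256) * K.energy T f := by
    intro a I h1 h2
    have h3 : a ^ 2 * η ^ 3 ≤ a ^ 2 * bary hT z q ^ 3 := by gcongr
    have h4 : (64 / σ + 256) * K.energy T f = 32 * ((2 / σ + 8) * K.energy T f) := by ring
    linarith
  have hleft : ∀ α β : ℝ, bary hT z q ^ 3 * α ^ 2 ≤
      32 * ∫ t in (0 : ℝ)..bary hT z q, (α + t * β) ^ 2 := by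
    intro α β
    have h1 := sq_left_le_integral α β hq0
    have h3 : bary hT z q ^ 3 * α ^ 2 ≤ bary hT z q * α ^ 2 := by
      have : bary hT z q ^ 3 ≤ bary hT z q := by nlinarith [mul_nonneg hq0 hq0]
      gcongr
    have h4 : 0 ≤ bary hT z q * α ^ 2 := by positivity
    linarith
  -- The edge is chosen such that the region next to it lies on the side `i` of `v`, whose weight is
  -- the smaller one; only with this weight is the gradient of the jump under control.
  rcases (A.mem_iff v).1 hv with rfl | rfl | rfl
  · have hik : i = k := eq_of_mem_closure hvΓ (subset_closure hvi) A.side_x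
    subst hik
    exact hfin _ _ (hleft _ _) ((A.integral_edge_le R w).trans hs)
  · have hik : i = 1 - k := eq_of_mem_closure hvΓ (subset_closure hvi)
      (A.side_yz _ (mem_hull_of_mem hv) hvΓ A.bary_x_y)
    subst hik
    exact hfin _ _ (hleft _ _) ((A.integral_opposite_edge_le R w).trans hs)
  · have hik : i = 1 - k := eq_of_mem_closure hvΓ (subset_closure hvi)
      (A.side_yz _ (mem_hull_of_mem hv) hvΓ A.bary_x_z)
    subst hik
    have h1 := sq_right_le_integral (w y) (w v - w y) hq0 hq1
    rw [add_sub_cancel] at h1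
    exact hfin _ _ h1 ((A.integral_opposite_edge_le R w).trans hs)

end ArcCut

/-! ### The vertex values within one triangle -/

/-- The function `U` collects the values of a pair at the vertices in the respective subdomains;
the pair vanishes at the vertices on the boundary. -/
structure Compatible (K : CutMesh Ω) (T : Finset Plane) (U : Plane → ℝ)
    (f : Fin 2 → Plane →ᵃ[ℝ] ℝ) : Prop where
  eq_of_mem : ∀ v ∈ T, ∀ i, v ∈ K.sub i → U v = f i v
  eq_zero : ∀ v ∈ T, v ∉ Ω → U v = 0
  eq_zero' : ∀ v ∈ T, v ∉ Ω → ∀ i, f i v = 0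

theorem Regular.sq_sub_le_of_uncut (R : K.Regular σ L) (hT : T ∈ K.mesh.cells)
    (hΓ : ¬ (hull T ∩ K.Γ).Nonempty) {U : Plane → ℝ} {f : Fin 2 → Plane →ᵃ[ℝ] ℝ}
    (hU : K.Compatible T U f) {v w : Plane} (hv : v ∈ T) (hw : w ∈ T) :
    (U v - U w) ^ 2 ≤ K.energy T f := by
  obtain ⟨k, hk, -, hsub⟩ := R.exists_side_of_uncut hT hΓ
  have h : ∀ v ∈ T, U v = f k v := by
    intro v hv
    by_cases hvΩ : v ∈ Ω
    · exact hU.eq_of_mem v hv k (hsub v (mem_hull_of_mem hv) hvΩ)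
    · rw [hU.eq_zero v hv hvΩ, hU.eq_zero' v hv hvΩ]
  rw [h v hv, h w hw]
  simpa using R.sq_sub_le_of_weight hT f one_pos hk.ge (mem_hull_of_mem hv) (mem_hull_of_mem hw)

/-- All values are compared with the function of the major part, which is nearly constant as its
weight is at least 1/2. A vertex on the minor side deviates from it by the jump at this vertex,
which a long arc controls. -/
theorem ArcCut.sq_sub_le_of_long {hT : T ∈ K.mesh.cells} {x y z p q : Plane} {k : Fin 2}
    (R : K.Regular σ L) (A : K.ArcCut L hT x y z p q k) {U : Plane → ℝ}
    {f : Fin 2 → Plane →ᵃ[ℝ] ℝ} (hU : K.Compatible T U f) {η : ℝ} (hη : 0 < η)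
    (hlong : η ≤ bary hT y p ∨ η ≤ bary hT z q) {v w : Plane} (hv : v ∈ T) (hw : w ∈ T) :
    (U v - U w) ^ 2 ≤ (6 + 6 * ((64 / σ + 256) / η ^ 3)) * K.energy T f := by
  obtain ⟨m, hm, hm'⟩ := R.exists_major hT
  have hσ := R.σ_pos
  have hE := R.energy_nonneg T f
  have hc : 0 ≤ (64 / σ + 256) / η ^ 3 := by positivity
  have key : ∀ v ∈ T, (U v - f m v) ^ 2 ≤ (64 / σ + 256) / η ^ 3 * K.energy T f := by
    intro v hv
    have hnn : 0 ≤ (64 / σ + 256) / η ^ 3 * K.energy T f := mul_nonneg hc hE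
    by_cases hvΩ : v ∈ Ω
    · obtain ⟨i, hi⟩ := exists_mem_sub hvΩ (R.vertex_notMem_interface hT hv hvΩ)
      rw [hU.eq_of_mem v hv i hi]
      by_cases him : i = m
      · rw [him]
        simpa using hnn
      · have hi1 := fin_two_eq_of_ne him
        have hi2 : K.weight T i ≤ K.weight T (1 - i) := by rw [hi1]; simpa using hm'
        have h1 : ((f 0 - f 1) v) ^ 2 ≤ (64 / σ + 256) / η ^ 3 * K.energy T f := by
          rcases hlong with h | h
          · exact A.swap.sq_jump_le R f hη h hi2 hv hi
          · exact A.sq_jump_le R f hη h hi2 hv hi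
        have h2 : (f i v - f m v) ^ 2 = ((f 0 - f 1) v) ^ 2 := by
          simp only [AffineMap.coe_sub, Pi.sub_apply]
          fin_cases i <;> fin_cases m
          · exact absurd rfl him
          · rfl
          · change (f 1 v - f 0 v) ^ 2 = _
            ring
          · exact absurd rfl him
        rw [h2]
        exact h1
    · rw [hU.eq_zero v hv hvΩ, hU.eq_zero' v hv hvΩ]
      simpa using hnn
  have h1 := key v hv
  have h2 := key w hw
  have h3 := R.sq_sub_le_of_weight hT f (by norm_num) hm (mem_hull_of_mem hv) (mem_hull_of_mem hw)
  set a := U v - f m v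
  set b := U w - f m w
  set d := f m v - f m w
  have e : U v - U w = a + d - b := by simp only [a, b, d]; ring
  rw [e]
  have : (a + d - b) ^ 2 ≤ 3 * a ^ 2 + 3 * d ^ 2 + 3 * b ^ 2 := by
    nlinarith [sq_nonneg (a - d), sq_nonneg (a + b), sq_nonneg (d + b)]
  norm_num at h3
  nlinarith

/-- If the arc is short, it stays close to a vertex, and the major part of the triangle is on the
other side. -/
theorem ArcCut.of_short {hT : T ∈ K.mesh.cells} {x y z p q : Plane} {k : Fin 2}
    (R : K.Regular σ L) (A : K.ArcCut L hT x y z p q k) {η : ℝ}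
    (hησ : 6 * (1 + L) * η < σ) (h1 : bary hT y p < η) (h2 : bary hT z q < η) :
    (∀ w ∈ hull T ∩ K.Γ, dist x w ≤ 3 * (1 + L) * η * K.h) ∧ 1 / 4 ≤ K.weight T (1 - k) ∧
    ∀ v ∈ T, v ≠ x → v ∉ K.Γ ∧ v ∈ closure (K.sub (1 - k)) := by
  have hh := R.h_pos
  have hσ := R.σ_pos
  have hL := R.L_nonneg
  have hη : 0 < η := A.p_pos.trans h1
  have hend : ∀ {y z p q : Plane}, K.ArcCut L hT x y z p q k → bary hT y p < η →
      dist x p ≤ η * K.h := by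
    intro y z p q A h1
    have hp : p = AffineMap.lineMap (k := ℝ) x y (bary hT y p) := by
      refine A.eq_of_bary ?_ ?_
      · rw [bary_homothety, A.bary_y_x, bary_self hT A.hy]; ring
      · rw [bary_homothety, A.bary_z_x, A.bary_z_y, A.p_zero]; ring
    have hxy := R.diam_le T hT x (mem_hull_of_mem A.hx) y (mem_hull_of_mem A.hy)
    rw [hp, dist_comm, dist_lineMap_left, Real.norm_of_nonneg A.p_pos.le]
    exact mul_le_mul h1.le hxy dist_nonneg hη.le
  have hxp := hend A h1
  have hxq := hend A.swap h2
  have hpq : dist p q ≤ 2 * η * K.h := by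
    have := dist_triangle_left p q x
    linarith
  have hball : ∀ w ∈ hull T ∩ K.Γ, dist x w ≤ 3 * (1 + L) * η * K.h := by
    intro w hw
    obtain ⟨γ, h0, -, hΓ, hLip⟩ := A.param
    rw [hΓ] at hw
    obtain ⟨t, ht, rfl⟩ := hw
    have e1 := hLip 0 (by simp) t ht
    rw [h0, zero_sub, abs_neg, abs_of_nonneg ht.1] at e1
    have e2 : (1 + L) * dist p q * t ≤ (1 + L) * (2 * η * K.h) * 1 := by
      gcongr
      exacts [ht.1, ht.2]
    have e3 := dist_triangle x p (γ t)
    have e4 : 0 ≤ L * (η * K.h) := by positivity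
    nlinarith
  have hhalf : ∀ w ∈ hull T ∩ K.Γ, 1 / 2 < bary hT x w := by
    intro w hw
    have e1 := R.abs_bary_sub_le hT x x w
    have e2 := hball w hw
    rw [bary_self hT A.hx, le_div_iff₀ (by positivity)] at e1
    have e3 : 3 * (1 + L) * η * K.h < 1 / 2 * (σ * K.h) := by nlinarith
    have e4 : |1 - bary hT x w| < 1 / 2 := by
      by_contra hc
      push Not at hc
      have : 1 / 2 * (σ * K.h) ≤ |1 - bary hT x w| * (σ * K.h) := by gcongr
      linarith
    linarith [(abs_lt.1 e4).2]
  -- the part of the triangle away from `x`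
  set S : Set Plane := {w | w ∈ hull T ∧ bary hT x w ≤ 1 / 2} with hS
  have hSconv : Convex ℝ S := by
    refine (convex_hull T).inter ?_
    exact (convex_Iic (𝕜 := ℝ) (1 / 2 : ℝ)).affine_preimage (bary hT x)
  have hSΓ : ∀ w ∈ S, w ∉ K.Γ := fun w hw hΓ => absurd (hhalf w ⟨hw.1, hΓ⟩) (not_lt.2 hw.2)
  have hyS : y ∈ S := ⟨mem_hull_of_mem A.hy, by rw [A.bary_x_y]; norm_num⟩
  have hSk : S ⊆ closure (K.sub (1 - k)) :=
    side_of_preconnected hSconv.isPreconnected (fun w hw => hull_subset_closure hT hw.1) hSΓ hyS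
      (A.side_yz y hyS.1 (hSΓ y hyS) A.bary_x_y)
  refine ⟨hball, ?_, fun v hv hvx => ?_⟩
  · have hsub : AffineMap.homothety y (1 / 2 : ℝ) '' interior (hull T) ⊆ hull T ∩ K.sub (1 - k) := by
      rintro _ ⟨w, hw, rfl⟩
      have hwl : AffineMap.homothety y (1 / 2 : ℝ) w = AffineMap.lineMap (k := ℝ) y w (1 / 2 : ℝ) :=
        AffineMap.homothety_eq_lineMap _ _ _
      rw [hwl]
      have hwi := (mem_interior_hull hT).1 hw
      have hint : AffineMap.lineMap (k := ℝ) y w (1 / 2 : ℝ) ∈ interior (hull T) := by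
        refine (mem_interior_hull hT).2 fun v hv => ?_
        rw [bary_homothety]
        have e1 := bary_nonneg hT v (mem_hull_of_mem A.hy)
        have e2 := hwi v hv
        linarith
      have hmS : AffineMap.lineMap (k := ℝ) y w (1 / 2 : ℝ) ∈ S := by
        refine ⟨interior_subset hint, ?_⟩
        rw [bary_homothety, A.bary_x_y]
        have := bary_le_one hT x (interior_subset hw)
        linarith
      exact ⟨hmS.1, mem_sub_of_mem_closure (interior_hull_subset R.reg hT hint) (hSΓ _ hmS)
        (hSk hmS)⟩
    have hvol : volume (interior (hull T)) = volume (hull T) := by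
      refine measure_congr ?_
      refine interior_ae_eq_of_null_frontier ((convex_hull T).addHaar_frontier volume)
    have h3 := measure_mono (μ := volume) hsub
    rw [Measure.addHaar_image_homothety, hvol] at h3
    have h4 := ENNReal.toReal_mono (volume_hull_inter_ne_top _ _) h3
    rw [ENNReal.toReal_mul] at h4
    rw [weight, le_div_iff₀ (R.volume_hull_pos hT)]
    simp at h4
    norm_num at h4
    rw [measureReal_def, measureReal_def]
    linarith
  · have hvS : v ∈ S := by
      refine ⟨mem_hull_of_mem hv, ?_⟩
      rw [bary_of_ne hT hv hvx]
      norm_num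
    exact ⟨hSΓ v hvS, hSk hvS⟩

/-- The vertices other than `x` are on the side `1 - k`, whose weight is at least 1/4. A corner
outside Ω does no harm, because all values vanish there. -/
theorem ArcCut.sq_sub_le_of_short {hT : T ∈ K.mesh.cells} {x y z p q : Plane} {k : Fin 2}
    (R : K.Regular σ L) (A : K.ArcCut L hT x y z p q k) {U : Plane → ℝ}
    {f : Fin 2 → Plane →ᵃ[ℝ] ℝ} (hU : K.Compatible T U f) {η : ℝ}
    (hησ : 6 * (1 + L) * η < σ) (h1 : bary hT y p < η) (h2 : bary hT z q < η)
    {v w : Plane} (hv : v ∈ T) (hw : w ∈ T) (hvx : v ≠ x ∨ x ∉ Ω) (hwx : w ≠ x ∨ x ∉ Ω) :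
    (U v - U w) ^ 2 ≤ 4 * K.energy T f := by
  obtain ⟨-, hm, hs⟩ := A.of_short R hησ h1 h2
  have key : ∀ v ∈ T, (v ≠ x ∨ x ∉ Ω) → U v = f (1 - k) v := by
    intro v hv hvx
    by_cases hvΩ : v ∈ Ω
    · have hne : v ≠ x := by
        rcases hvx with h | h
        · exact h
        · rintro rfl
          exact h hvΩ
      obtain ⟨e1, e2⟩ := hs v hv hne
      exact hU.eq_of_mem v hv _ (mem_sub_of_mem_closure hvΩ e1 e2)
    · rw [hU.eq_zero v hv hvΩ, hU.eq_zero' v hv hvΩ]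
  rw [key v hv hvx, key w hw hwx]
  have := R.sq_sub_le_of_weight hT f (by norm_num) hm (mem_hull_of_mem hv) (mem_hull_of_mem hw)
  norm_num at this
  exact this

/-! ### Stability of the splitting into single degrees of freedom -/

theorem ifc_smul (K : CutMesh Ω) (T : Finset Plane) (c : ℝ) (w : Plane →ᵃ[ℝ] ℝ) :
    K.ifc T (c • w) = c ^ 2 * K.ifc T w := by
  unfold ifc
  have : ∀ y, (c • w) y ^ 2 = c ^ 2 * w y ^ 2 := fun y => by
    simp only [AffineMap.coe_smul, Pi.smul_apply, smul_eq_mul]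
    ring
  simp only [this]
  rw [integral_const_mul]
  ring

theorem ifc_neg (K : CutMesh Ω) (T : Finset Plane) (w : Plane →ᵃ[ℝ] ℝ) :
    K.ifc T (-w) = K.ifc T w := by
  have := ifc_smul K T (-1) w
  rw [neg_one_smul] at this
  rw [this]
  ring

theorem Regular.ifc_sub_le (R : K.Regular σ L) (hT : T ∈ K.mesh.cells) (v w : Plane →ᵃ[ℝ] ℝ) :
    K.ifc T (v - w) ≤ 2 * K.ifc T v + 2 * K.ifc T w := by
  rw [sub_eq_add_neg, ← ifc_neg K T w]
  exact R.ifc_add_le hT v (-w)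

theorem energy_single (K : CutMesh Ω) (T : Finset Plane) (i : Fin 2) (g : Plane →ᵃ[ℝ] ℝ) :
    K.energy T (Pi.single i g) =
      K.weight T i * (K.h ^ 2 * ‖agrad g‖ ^ 2) + K.ifc T g := by
  unfold energy
  fin_cases i
  · simp
  · simp [ifc_neg]

theorem eq_of_vertices {hT : T ∈ K.mesh.cells} {x y z p q : Plane}
    (E : K.Endpoints hT x y z p q) (f : Plane →ᵃ[ℝ] ℝ) :
    f = f x • bary hT x + f y • bary hT y + f z • bary hT z := by
  refine affine_ext hT fun v hv => ?_
  rw [eq_sum_bary hT f v, E.sum_eq]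
  simp only [AffineMap.coe_add, AffineMap.coe_smul, Pi.add_apply, Pi.smul_apply, smul_eq_mul]
  ring

/-- If the shorter of the two distances to the apex is on the edge `xy`, the parts of a function
that vanishes at `x` are controlled separately. -/
theorem ArcCut.ifc_split_le {hT : T ∈ K.mesh.cells} {x y z p q : Plane} {k : Fin 2}
    (R : K.Regular σ L) (A : K.ArcCut L hT x y z p q k) {g : Plane →ᵃ[ℝ] ℝ} (hx : g x = 0)
    (hle : bary hT y p ≤ bary hT z q) {a : ℝ} (hI : K.ifc T g ≤ a)
    (hG : K.weight T k * (K.h ^ 2 * ‖agrad g‖ ^ 2) ≤ a) :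
    g z ^ 2 * K.ifc T (bary hT z) ≤ 96 * (1 + L) ^ 3 / σ ^ 2 * (2 / σ + 2) * a ∧
    g y ^ 2 * K.ifc T (bary hT y) ≤ (2 + 2 * (96 * (1 + L) ^ 3 / σ ^ 2 * (2 / σ + 2))) * a := by
  have hh := R.h_pos
  have hσ := R.σ_pos
  have hL := R.L_nonneg
  set e := bary hT z q with he
  have he0 : 0 < e := A.q_pos
  -- The coordinate of `z` vanishes at `p`, hence it is of order `e` on the arc, and the length of
  -- the arc is of order `e * h`. Together this gives `e ^ 3`.
  have hJ : K.ifc T (bary hT z) ≤ 8 * (1 + L) ^ 3 / σ ^ 2 * e ^ 3 := by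
    have hpq : dist p q ≤ 2 * e * K.h := by
      have hend : ∀ {y z p q : Plane}, K.ArcCut L hT x y z p q k → bary hT y p ≤ e →
          dist x p ≤ e * K.h := by
        intro y z p q A h1
        have hp : p = AffineMap.lineMap (k := ℝ) x y (bary hT y p) := by
          refine A.eq_of_bary ?_ ?_
          · rw [bary_homothety, A.bary_y_x, bary_self hT A.hy]; ring
          · rw [bary_homothety, A.bary_z_x, A.bary_z_y, A.p_zero]; ring
        have hxy := R.diam_le T hT x (mem_hull_of_mem A.hx) y (mem_hull_of_mem A.hy)
        rw [hp, dist_comm, dist_lineMap_left, Real.norm_of_nonneg A.p_pos.le]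
        exact mul_le_mul h1 hxy dist_nonneg he0.le
      have h1 := hend A hle
      have h2 := hend A.swap le_rfl
      have := dist_triangle_left p q x
      linarith
    have hlen : (1 + L) * dist p q ≤ (1 + L) * (2 * e * K.h) := by gcongr
    have hb : ∀ w ∈ hull T ∩ K.Γ, |bary hT z w| ≤ 2 * (1 + L) * e / σ := by
      intro w hw
      obtain ⟨γ, h0, -, hΓ, hLip⟩ := A.param
      rw [hΓ] at hw
      obtain ⟨t, ht, rfl⟩ := hw
      have e1 := hLip t ht 0 (by simp)
      rw [h0, sub_zero, abs_of_nonneg ht.1] at e1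
      have e2 := R.abs_bary_sub_le hT z (γ t) p
      rw [A.p_zero, sub_zero] at e2
      refine e2.trans ?_
      rw [div_le_div_iff₀ (by positivity) hσ]
      have e3 : dist (γ t) p ≤ (1 + L) * (2 * e * K.h) := by
        refine e1.trans ((mul_le_of_le_one_right (by positivity) ht.2).trans hlen)
      nlinarith
    have h1 := R.ifc_le (w := bary hT z) (by positivity)
      ((A.measure_le hL).trans (ENNReal.ofReal_le_ofReal hlen)) hb
    refine h1.trans (le_of_eq ?_)
    field_simp
    ring
  have hC : 0 ≤ 96 * (1 + L) ^ 3 / σ ^ 2 * (2 / σ + 2) := by positivity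
  have h1 : g z ^ 2 * K.ifc T (bary hT z) ≤ 96 * (1 + L) ^ 3 / σ ^ 2 * (2 / σ + 2) * a := by
    have h2 := A.integral_edge_le R g
    -- Since `g x = 0`, the slope along this edge is `g z`. The factor `e ^ 3` lost here is the one
    -- gained in `hJ`.
    have h3 := sq_slope_le_integral (g x) (g z - g x) he0.le
    rw [hx, sub_zero] at h2 h3
    have h4 : 2 / σ * K.ifc T g ≤ 2 / σ * a := by gcongr
    have h5 : e ^ 3 * g z ^ 2 ≤ 12 * ((2 / σ + 2) * a) := by linarith
    calc g z ^ 2 * K.ifc T (bary hT z) ≤ g z ^ 2 * (8 * (1 + L) ^ 3 / σ ^ 2 * e ^ 3) := by gcongr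
      _ = 8 * (1 + L) ^ 3 / σ ^ 2 * (e ^ 3 * g z ^ 2) := by ring
      _ ≤ 8 * (1 + L) ^ 3 / σ ^ 2 * (12 * ((2 / σ + 2) * a)) := by gcongr
      _ = _ := by ring
  refine ⟨h1, ?_⟩
  have h2 := eq_of_vertices A.toEndpoints g
  rw [hx, zero_smul, zero_add] at h2
  -- The part at the nearer endpoint has no such estimate of its own; it is what remains of `g`.
  replace h2 : g y • bary hT y = g - g z • bary hT z := eq_sub_of_add_eq h2.symm
  have h3 := R.ifc_sub_le hT g (g z • bary hT z)
  rw [← h2, ifc_smul, ifc_smul] at h3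
  linarith

/-- The constant in the splitting estimate. -/
def splitConst (σ L : ℝ) : ℝ :=
  (σ⁻¹ ^ 2 + (2 + 2 * (96 * (1 + L) ^ 3 / σ ^ 2 * (2 / σ + 2))) * (2 + 36 * (1 + L)))

theorem splitConst_nonneg (hσ : 0 < σ) (hL : 0 ≤ L) : 0 ≤ splitConst σ L := by
  unfold splitConst
  positivity

/-- The energy of the parts of a pair of functions, each of which vanishes at the vertices in the
respective subdomain, is controlled by the energy of the pair. -/
theorem Regular.energy_single_le (R : K.Regular σ L) (hT : T ∈ K.mesh.cells)
    {f : Fin 2 → Plane →ᵃ[ℝ] ℝ} (hf : ∀ v ∈ T, ∀ i, v ∈ K.sub i → f i v = 0)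
    (hf' : ∀ v ∈ T, v ∉ Ω → ∀ i, f i v = 0) {v : Plane} (hv : v ∈ T) (i : Fin 2) :
    K.energy T (Pi.single i (f i v • bary hT v)) ≤ splitConst σ L * K.energy T f := by
  have hh := R.h_pos
  have hσ := R.σ_pos
  have hL := R.L_nonneg
  have hE := R.energy_nonneg T f
  have hsc := splitConst_nonneg hσ hL
  by_cases hne : (hull T ∩ K.Γ).Nonempty
  swap
  · obtain ⟨k, -, hk, hsub⟩ := R.exists_side_of_uncut hT hne
    have hempty := Set.not_nonempty_iff_eq_empty.1 hne
    -- Without interface, either `i` is the side of the triangle and `f i` vanishes at all vertices,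
    -- or its weight is 0.
    have hzero : K.energy T (Pi.single i (f i v • bary hT v)) = 0 := by
      rw [energy_single, ifc, hempty]
      simp only [Measure.restrict_empty, integral_zero_measure, mul_zero, add_zero]
      by_cases hik : i = k
      · have : f i v = 0 := by
          by_cases hvΩ : v ∈ Ω
          · exact hf v hv i (hik ▸ hsub v (mem_hull_of_mem hv) hvΩ)
          · exact hf' v hv hvΩ i
        rw [this]
        simp
      · rw [fin_two_eq_of_ne hik, hk, zero_mul]
    rw [hzero]
    positivity
  obtain ⟨-, x, y, z, p, q, k, A⟩ := R.exists_arcCut hT hne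
  have hfx : f k x = 0 := by
    by_cases h : x ∈ Ω
    · exact hf x A.hx k (mem_sub_of_mem_closure h (R.vertex_notMem_interface hT A.hx h) A.side_x)
    · exact hf' x A.hx h k
  have hfyz : ∀ v ∈ T, bary hT x v = 0 → f (1 - k) v = 0 := by
    intro v hv hvx
    by_cases h : v ∈ Ω
    · have hn := R.vertex_notMem_interface hT hv h
      exact hf v hv _ (mem_sub_of_mem_closure h hn (A.side_yz v (mem_hull_of_mem hv) hn hvx))
    · exact hf' v hv h _
  have hfy := hfyz y A.hy A.bary_x_y
  have hfz := hfyz z A.hz A.bary_x_z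
  -- the gradient part
  have hzero : ∀ i, ∃ w ∈ T, f i w = 0 := by
    intro i
    by_cases hik : i = k
    · exact ⟨x, A.hx, hik ▸ hfx⟩
    · exact ⟨y, A.hy, fin_two_eq_of_ne hik ▸ hfy⟩
  have hval : ∀ i, ∀ v ∈ T, f i v ^ 2 ≤ K.h ^ 2 * ‖agrad (f i)‖ ^ 2 := by
    intro i v hv
    obtain ⟨w, hw, hw0⟩ := hzero i
    have := sq_apply_sub_le (f i) (R.diam_le T hT v (mem_hull_of_mem hv) w (mem_hull_of_mem hw))
    rwa [hw0, sub_zero] at this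
  have hwval : ∀ i, ∀ v ∈ T, K.weight T i * f i v ^ 2 ≤ K.energy T f := fun i v hv =>
    (mul_le_mul_of_nonneg_left (hval i v hv) (K.weight_nonneg T i)).trans (R.weight_grad_le T f i)
  have hgrad : ∀ v, K.h ^ 2 * ‖agrad (bary hT v)‖ ^ 2 ≤ σ⁻¹ ^ 2 := by
    intro v
    have h1 := R.norm_agrad_bary_le hT v
    have h2 : K.h * ‖agrad (bary hT v)‖ ≤ σ⁻¹ := by
      calc _ ≤ K.h * (1 / (σ * K.h)) := by gcongr
        _ = σ⁻¹ := by field_simp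
    rw [← mul_pow]
    gcongr
  -- the part on the interface
  obtain ⟨m, hm, hm'⟩ := R.exists_major hT
  have hJ := R.ifc_bary_le hT
  have hJ0 : ∀ v, 0 ≤ K.ifc T (bary hT v) := fun v => R.ifc_nonneg T _
  have hmv : ∀ v ∈ T, f m v ^ 2 ≤ 2 * K.energy T f := by
    intro v hv
    have := hwval m v hv
    nlinarith [sq_nonneg (f m v)]
  have hmJ : ∀ v ∈ T, f m v ^ 2 * K.ifc T (bary hT v) ≤ 2 * (1 + L) * K.energy T f := by
    intro v hv
    calc _ ≤ (2 * K.energy T f) * (1 + L) := mul_le_mul (hmv v hv) (hJ v) (hJ0 v) (by positivity)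
      _ = _ := by ring
  have hmI : K.ifc T (f m) ≤ 18 * (1 + L) * K.energy T f := by
    have hb : ∀ w ∈ hull T ∩ K.Γ, |f m w| ≤ Real.sqrt (2 * K.energy T f) := by
      intro w hw
      rw [eq_sum_bary hT (f m) w]
      calc _ ≤ ∑ v ∈ T, |bary hT v w * f m v| := Finset.abs_sum_le_sum_abs _ _
        _ ≤ ∑ v ∈ T, bary hT v w * Real.sqrt (2 * K.energy T f) := by
          refine Finset.sum_le_sum fun v hv => ?_
          rw [abs_mul, abs_of_nonneg (bary_nonneg hT v hw.1)]
          exact mul_le_mul_of_nonneg_left (Real.abs_le_sqrt (hmv v hv)) (bary_nonneg hT v hw.1)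
        _ = _ := by rw [← Finset.sum_mul, sum_bary, one_mul]
    have h1 := R.ifc_le (w := f m) (by positivity) (R.measure_interface_le hT) hb
    rw [Real.sq_sqrt (by positivity)] at h1
    have h2 : K.h⁻¹ * ((1 + L) * K.h * (2 * K.energy T f)) = 2 * (1 + L) * K.energy T f := by
      field_simp
    rw [h2] at h1
    nlinarith [mul_nonneg hL hE]
  -- The trace from the minor part is the trace from the major part up to the jump.
  have hminor : K.ifc T (f (1 - m)) ≤ (2 + 36 * (1 + L)) * K.energy T f := by
    have h0 := Regular.ifc_le_energy (K := K) T f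
    have : K.ifc T (f (1 - m)) ≤ 2 * K.ifc T (f 0 - f 1) + 2 * K.ifc T (f m) := by
      fin_cases m
      · have h := R.ifc_sub_le hT (f 0) (f 0 - f 1)
        rw [sub_sub_cancel] at h
        change K.ifc T (f 1) ≤ 2 * K.ifc T (f 0 - f 1) + 2 * K.ifc T (f 0)
        linarith
      · have h := R.ifc_add_le hT (f 0 - f 1) (f 1)
        rw [sub_add_cancel] at h
        exact h
    linarith
  have hbig : 1 ≤ 2 + 2 * (96 * (1 + L) ^ 3 / σ ^ 2 * (2 / σ + 2)) := by
    have : 0 ≤ 96 * (1 + L) ^ 3 / σ ^ 2 * (2 / σ + 2) := by positivity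
    linarith
  have hbig0 : 0 ≤ (2 + 36 * (1 + L)) * K.energy T f := by positivity
  have hIpart : f i v ^ 2 * K.ifc T (bary hT v) ≤
      (2 + 2 * (96 * (1 + L) ^ 3 / σ ^ 2 * (2 / σ + 2))) * ((2 + 36 * (1 + L)) * K.energy T f) := by
    by_cases him : i = m
    · subst him
      have h1 := hmJ v hv
      have h2 : 2 * (1 + L) * K.energy T f ≤ (2 + 36 * (1 + L)) * K.energy T f := by
        nlinarith [mul_nonneg hL hE]
      nlinarith
    rw [fin_two_eq_of_ne him]
    -- The function on the side `k` has free values at `y` and `z`, which have to be separated. The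
    -- other one is a multiple of the coordinate of `x`, so its trace needs no splitting.
    by_cases hmk : 1 - m = k
    · -- two vertices on the minor part
      rw [hmk] at hminor ⊢
      have hG : K.weight T k * (K.h ^ 2 * ‖agrad (f k)‖ ^ 2) ≤ (2 + 36 * (1 + L)) * K.energy T f := by
        have h1 := R.weight_grad_le T f k
        nlinarith [mul_nonneg hL hE]
      rcases (A.mem_iff v).1 hv with rfl | rfl | rfl
      · rw [hfx]
        have : 0 ≤ 2 + 2 * (96 * (1 + L) ^ 3 / σ ^ 2 * (2 / σ + 2)) := by linarith
        nlinarith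
      · rcases le_total (bary hT v p) (bary hT z q) with h | h
        · exact (A.ifc_split_le R hfx h hminor hG).2
        · have := (A.swap.ifc_split_le R hfx h hminor hG).1
          nlinarith
      · rcases le_total (bary hT y p) (bary hT v q) with h | h
        · have := (A.ifc_split_le R hfx h hminor hG).1
          nlinarith
        · exact (A.swap.ifc_split_le R hfx h hminor hG).2
    · -- one vertex on the minor part
      have hmk' := fin_two_eq_of_ne hmk
      have h1 := eq_of_vertices A.toEndpoints (f (1 - k))
      rw [hfy, hfz, zero_smul, zero_smul, add_zero, add_zero] at h1
      rw [hmk'] at hminor ⊢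
      rcases (A.mem_iff v).1 hv with rfl | rfl | rfl
      · rw [← ifc_smul, ← h1]
        nlinarith
      · rw [hfy]
        nlinarith
      · rw [hfz]
        nlinarith
  rw [energy_single, map_smul, norm_smul, mul_pow, ifc_smul, Real.norm_eq_abs, sq_abs]
  have h1 := hwval i v hv
  have h2 : K.weight T i * (K.h ^ 2 * (f i v ^ 2 * ‖agrad (bary hT v)‖ ^ 2)) ≤
      σ⁻¹ ^ 2 * K.energy T f := by
    calc _ = (K.weight T i * f i v ^ 2) * (K.h ^ 2 * ‖agrad (bary hT v)‖ ^ 2) := by ring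
      _ ≤ K.energy T f * σ⁻¹ ^ 2 := mul_le_mul h1 (hgrad v) (by positivity) hE
      _ = _ := by ring
  unfold splitConst
  linarith

/-! ### Comparison of the values at neighbouring vertices -/

/-- The interface cuts off a small corner of the triangle at the vertex `x`. -/
def ShortAt (K : CutMesh Ω) (L η : ℝ) (T : Finset Plane) (x : Plane) : Prop :=
  ∃ (hT : T ∈ K.mesh.cells) (y z p q : Plane) (k : Fin 2),
    K.ArcCut L hT x y z p q k ∧ bary hT y p < η ∧ bary hT z q < η

/-- The constant in the comparison of values at the vertices of one triangle. -/
def cellConst (σ η : ℝ) : ℝ := 6 + 6 * ((64 / σ + 256) / η ^ 3)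

theorem cellConst_ge (hσ : 0 < σ) {η : ℝ} (hη : 0 < η) : 6 ≤ cellConst σ η := by
  have : 0 ≤ (64 / σ + 256) / η ^ 3 := by positivity
  unfold cellConst
  linarith

theorem ShortAt.mem {η : ℝ} {x : Plane} (h : K.ShortAt L η T x) : x ∈ T := by
  obtain ⟨hT, y, z, p, q, k, A, -, -⟩ := h
  exact A.hx

theorem ShortAt.mem_cells {η : ℝ} {x : Plane} (h : K.ShortAt L η T x) : T ∈ K.mesh.cells := h.1

theorem ShortAt.dist_le (R : K.Regular σ L) {η : ℝ} (hησ : 6 * (1 + L) * η < σ) {x : Plane}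
    (h : K.ShortAt L η T x) {w : Plane} (hw : w ∈ hull T) (hΓ : w ∈ K.Γ) :
    dist x w ≤ 3 * (1 + L) * η * K.h := by
  obtain ⟨hT, y, z, p, q, k, A, h1, h2⟩ := h
  exact (A.of_short R hησ h1 h2).1 w ⟨hw, hΓ⟩

theorem ShortAt.abs_sub_le (R : K.Regular σ L) {η : ℝ} (hη : 0 < η) (hησ : 6 * (1 + L) * η < σ)
    {x : Plane} (h : K.ShortAt L η T x) {U : Plane → ℝ} {f : Fin 2 → Plane →ᵃ[ℝ] ℝ}
    (hU : K.Compatible T U f) {e : ℝ} (he : K.energy T f ≤ e)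
    {v w : Plane} (hv : v ∈ T) (hw : w ∈ T) (hvx : v ≠ x) (hwx : w ≠ x) :
    |U v - U w| ≤ √(cellConst σ η * e) := by
  obtain ⟨hT, y, z, p, q, k, A, h1, h2⟩ := h
  refine Real.abs_le_sqrt ((A.sq_sub_le_of_short R hU hησ h1 h2 hv hw (.inl hvx) (.inl hwx)).trans ?_)
  have := cellConst_ge R.σ_pos hη
  have := R.energy_nonneg T f
  nlinarith

/-- Either all values on a triangle are comparable, or the interface cuts off a small corner. -/
theorem Regular.abs_sub_le_or_shortAt (R : K.Regular σ L) {η : ℝ} (hη : 0 < η)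
    (hησ : 6 * (1 + L) * η < σ) (hT : T ∈ K.mesh.cells) {U : Plane → ℝ}
    {f : Fin 2 → Plane →ᵃ[ℝ] ℝ} (hU : K.Compatible T U f) {e : ℝ} (he : K.energy T f ≤ e) :
    (∀ v ∈ T, ∀ w ∈ T, |U v - U w| ≤ √(cellConst σ η * e)) ∨
      ∃ x ∈ Ω, K.ShortAt L η T x := by
  have hE := R.energy_nonneg T f
  have hc := cellConst_ge R.σ_pos hη
  by_cases hne : (hull T ∩ K.Γ).Nonempty
  swap
  · left
    intro v hv w hw
    refine Real.abs_le_sqrt ((R.sq_sub_le_of_uncut hT hne hU hv hw).trans ?_)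
    nlinarith
  obtain ⟨-, x, y, z, p, q, k, A⟩ := R.exists_arcCut hT hne
  by_cases hlong : η ≤ bary hT y p ∨ η ≤ bary hT z q
  · left
    intro v hv w hw
    refine Real.abs_le_sqrt ((A.sq_sub_le_of_long R hU hη hlong hv hw).trans ?_)
    unfold cellConst
    gcongr
  push Not at hlong
  by_cases hx : x ∈ Ω
  · exact Or.inr ⟨x, hx, hT, y, z, p, q, k, A, hlong⟩
  · left
    intro v hv w hw
    refine Real.abs_le_sqrt
      ((A.sq_sub_le_of_short R hU hησ hlong.1 hlong.2 hv hw (.inr hx) (.inr hx)).trans ?_)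
    nlinarith

theorem exists_ne_mem (hT : T ∈ K.mesh.cells) (x : Plane) : ∃ v ∈ T, v ≠ x := by
  have h : 1 < T.card := by rw [(mem_cells.1 hT).2]; norm_num
  exact Finset.exists_mem_ne h x

open Classical in
/-- The triangles with the vertex `x`. -/
def star (K : CutMesh Ω) (x : Plane) : Finset (Finset Plane) := K.mesh.cells.filter (x ∈ ·)

open Classical in
/-- The triangles within the distance `m * h` of `x`. -/
def near (K : CutMesh Ω) (x : Plane) (m : ℝ) : Finset (Finset Plane) :=
  K.mesh.cells.filter fun T => (hull T ∩ Metric.closedBall x (m * K.h)).Nonempty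

theorem mem_near {x : Plane} {m : ℝ} :
    T ∈ K.near x m ↔ T ∈ K.mesh.cells ∧ ∃ y ∈ hull T, dist y x ≤ m * K.h := by
  simp only [near, Finset.mem_filter]
  rfl

theorem mem_star {x : Plane} : T ∈ K.star x ↔ T ∈ K.mesh.cells ∧ x ∈ T := by
  simp [star]

theorem Regular.card_star_le (R : K.Regular σ L) (x : Plane) :
    ((K.star x).card : ℝ) ≤ 4 / σ ^ 2 := by
  have h1 := R.card_near_le x (m := 0) le_rfl
  have h2 : (K.star x).card ≤ (K.near x 0).card := by
    refine Finset.card_le_card fun T hT => ?_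
    obtain ⟨hT, hx⟩ := mem_star.1 hT
    exact mem_near.2 ⟨hT, x, mem_hull_of_mem hx, by simp⟩
  have h3 : ((K.star x).card : ℝ) ≤ (K.near x 0).card := by exact_mod_cast h2
  refine h3.trans (h1.trans_eq ?_)
  norm_num

/-- The value at a vertex is comparable with the values at the neighbouring vertices even if the
interface cuts off a small corner: since the interface is connected and not small, it does not do
so in all triangles. -/
theorem Regular.abs_sub_le_of_shortAt (R : K.Regular σ L) {η d₀ : ℝ} (hη : 0 < η)
    (hησ : 6 * (1 + L) * η < σ) (hηd : 6 * (1 + L) * η < d₀)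
    (hd : d₀ * K.h ≤ Metric.diam K.Γ) {U : Plane → ℝ} {f : Finset Plane → Fin 2 → Plane →ᵃ[ℝ] ℝ}
    (hU : ∀ S ∈ K.mesh.cells, K.Compatible S U (f S)) {x : Plane} (hx : x ∈ Ω)
    (hTx : K.ShortAt L η T x) {e : ℝ} (he : ∀ S ∈ K.star x, K.energy S (f S) ≤ e)
    {v : Plane} (hv : v ∈ T) :
    |U x - U v| ≤ (8 / σ ^ 2 + 3) * √(cellConst σ η * e) := by
  classical
  have hh := R.h_pos
  have hσ := R.σ_pos
  have hL := R.L_nonneg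
  set δ := √(cellConst σ η * e) with hδ
  have hδ0 : 0 ≤ δ := Real.sqrt_nonneg _
  by_cases hvx : v = x
  · rw [hvx, sub_self, abs_zero]
    positivity
  have hT := hTx.mem_cells
  -- representatives
  have hrep : ∀ S : Finset Plane, ∃ v, S ∈ K.mesh.cells → v ∈ S ∧ v ≠ x := fun S => by
    by_cases hS : S ∈ K.mesh.cells
    · obtain ⟨v, hv⟩ := exists_ne_mem hS x
      exact ⟨v, fun _ => hv⟩
    · exact ⟨x, fun h => absurd h hS⟩
  choose rep hrep using hrep
  -- Neighbours in this relation share a vertex other than `x`, at which the values can be compared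
  -- without involving U(x).
  set Rel : Finset Plane → Finset Plane → Prop := fun S S' =>
    K.ShortAt L η S x ∧ K.ShortAt L η S' x ∧ ∃ y, y ≠ x ∧ y ∈ S ∧ y ∈ S' with hRel
  have hstar : ∀ S, K.ShortAt L η S x → S ∈ K.star x := fun S hS =>
    mem_star.2 ⟨hS.mem_cells, hS.mem⟩
  have hshort : ∀ S, K.ShortAt L η S x → ∀ v ∈ S, ∀ w ∈ S, v ≠ x → w ≠ x → |U v - U w| ≤ δ :=
    fun S hS v hv w hw hvx hwx => hS.abs_sub_le R hη hησ (hU S hS.mem_cells) (he S (hstar S hS))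
      hv hw hvx hwx
  have hreach : ∀ S, Relation.ReflTransGen Rel T S → K.ShortAt L η S x := by
    intro S hS
    rcases hS.cases_tail with h | ⟨c, -, hc⟩
    · rw [h]; exact hTx
    · exact hc.2.1
  -- a triangle in the star that is not of this kind
  obtain ⟨T', S, y, hT', hS, hSx, hSn, hyx, hyT', hyS⟩ : ∃ T' S y,
      Relation.ReflTransGen Rel T T' ∧ S ∈ K.mesh.cells ∧ x ∈ S ∧
      (∀ w ∈ S, ∀ w' ∈ S, |U w - U w'| ≤ δ) ∧ y ≠ x ∧ y ∈ T' ∧ y ∈ S := by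
    by_contra! hcon
    set 𝓡 := K.mesh.cells.filter fun S => Relation.ReflTransGen Rel T S with h𝓡
    set 𝓑 := K.mesh.cells.filter fun S => ¬ Relation.ReflTransGen Rel T S with h𝓑
    have hclosed : ∀ s : Finset (Finset Plane), IsClosed (⋃ S ∈ s, hull S) := fun s =>
      s.finite_toSet.isClosed_biUnion fun S _ => isClosed_hull S
    have hcover : K.Γ ⊆ (⋃ S ∈ 𝓡, hull S) ∪ ⋃ S ∈ 𝓑, hull S := by
      intro w hw
      obtain ⟨S, hS, hwS⟩ := exists_cell_of_mem_closure (M := K.mesh) (K.interface_subset hw)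
      by_cases h : Relation.ReflTransGen Rel T S
      · exact Or.inl (Set.mem_biUnion (Finset.mem_filter.2 ⟨hS, h⟩) hwS)
      · exact Or.inr (Set.mem_biUnion (Finset.mem_filter.2 ⟨hS, h⟩) hwS)
    have hxΓ : x ∉ K.Γ := R.vertex_notMem_interface hT hTx.mem hx
    -- If Γ meets triangles that are not reached, connectedness gives a point `p` of Γ where a
    -- reached triangle touches an unreached one.
    by_cases hB : (K.Γ ∩ ⋃ S ∈ 𝓑, hull S).Nonempty
    · have hA : (K.Γ ∩ ⋃ S ∈ 𝓡, hull S).Nonempty := by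
        obtain ⟨hT, y, z, p, q, k, A, -, -⟩ := hTx
        exact ⟨p, A.p_mem.2, Set.mem_biUnion (Finset.mem_filter.2 ⟨hT, .refl⟩) A.p_mem.1⟩
      obtain ⟨p, hpΓ, hp1, hp2⟩ := isPreconnected_closed_iff.1 K.isInterface.connected.isPreconnected
        _ _ (hclosed 𝓡) (hclosed 𝓑) hcover hA hB
      simp only [Set.mem_iUnion, exists_prop] at hp1 hp2
      obtain ⟨T', hT'm, hpT'⟩ := hp1
      obtain ⟨S, hSm, hpS⟩ := hp2
      obtain ⟨hT', hT'r⟩ := Finset.mem_filter.1 hT'm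
      obtain ⟨hS, hSr⟩ := Finset.mem_filter.1 hSm
      have hT's := hreach T' hT'r
      have hdist := hT's.dist_le R hησ hpT' hpΓ
      have hlt : dist x p < σ * K.h := by nlinarith
      have hxp : bary hT' x p ≠ 0 := by
        intro h0
        exact absurd (R.le_dist_vertices hT' hT's.mem h0) (not_le.2 hlt)
      have hxS : x ∈ S := by
        rw [bary_agree hT' hS x hpT' hpS] at hxp
        exact mem_of_bary_ne_zero hS hxp
      have hpx : p ≠ x := fun h => hxΓ (h ▸ hpΓ)
      obtain ⟨y, hyT', hyx, hyp⟩ : ∃ y ∈ T', y ≠ x ∧ bary hT' y p ≠ 0 := by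
        by_contra! h0
        refine hpx (eq_of_bary_eq hT' fun v hv => ?_)
        by_cases hvx : v = x
        · have := sum_bary hT' p
          rw [Finset.sum_eq_single x (fun w hw hwx => h0 w hw hwx)
            (fun h => absurd hT's.mem h)] at this
          rw [hvx, this, bary_self hT' hT's.mem]
        · rw [h0 v hv hvx, bary_of_ne hT' hT's.mem (Ne.symm hvx)]
      have hyS : y ∈ S := by
        rw [bary_agree hT' hS y hpT' hpS] at hyp
        exact mem_of_bary_ne_zero hS hyp
      rcases R.abs_sub_le_or_shortAt hη hησ hS (hU S hS) (he S (mem_star.2 ⟨hS, hxS⟩)) with h | h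
      · exact hcon T' S y hT'r hS hxS h hyx hyT' hyS
      · obtain ⟨x', -, hx'⟩ := h
        -- Otherwise `p` would be closer than σh/2 to each of two vertices whose distance is at
        -- least σh.
        have hxx : x' = x := by
          by_contra hne
          have h1 := hx'.dist_le R hησ hpS hpΓ
          have h2 := R.le_dist_vertices hS hxS (bary_of_ne hS hx'.mem hne)
          have h3 := dist_triangle_right x x' p
          nlinarith
        rw [hxx] at hx'
        exact hSr (hT'r.tail ⟨hT's, hx', y, hyx, hyT', hyS⟩)
    -- Otherwise all of Γ is contained in small corners at `x`, and its diameter is at most 6(1 +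
    -- L)ηh < d₀h.
    · have hsub : K.Γ ⊆ Metric.closedBall x (3 * (1 + L) * η * K.h) := by
        intro w hw
        rcases hcover hw with h | h
        · simp only [Set.mem_iUnion, exists_prop] at h
          obtain ⟨S, hSm, hwS⟩ := h
          rw [Metric.mem_closedBall, dist_comm]
          exact (hreach S (Finset.mem_filter.1 hSm).2).dist_le R hησ hwS hw
        · exact absurd ⟨w, hw, h⟩ hB
      have h1 := Metric.diam_mono hsub Metric.isBounded_closedBall
      have h2 := Metric.diam_closedBall (x := x) (r := 3 * (1 + L) * η * K.h) (by positivity)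
      nlinarith
  have hT's := hreach T' hT'
  have h1 : |U x - U y| ≤ δ := hSn x hSx y hyS
  obtain ⟨r1, r1x⟩ := hrep T' hT's.mem_cells
  obtain ⟨r2, r2x⟩ := hrep T hT
  have h2 := hshort T' hT's y hyT' (rep T') r1 hyx r1x
  have h3 := hshort T hTx (rep T) r2 v hv r2x hvx
  -- A step through a shared vertex costs 2δ, and the number of steps is bounded by the number of
  -- triangles at `x`.
  have h4 := abs_sub_le_of_reflTransGen (K.star x) Rel (fun S => U (rep S)) (ε := 2 * δ)
    (by positivity) (fun S S' h => ⟨hstar S h.1, hstar S' h.2.1⟩) (by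
      rintro S S' ⟨hS, hS', w, hwx, hw, hw'⟩
      obtain ⟨a1, a2⟩ := hrep S hS.mem_cells
      obtain ⟨b1, b2⟩ := hrep S' hS'.mem_cells
      have e1 := hshort S hS _ a1 w hw a2 hwx
      have e2 := hshort S' hS' w hw' _ b1 hwx b2
      have := abs_sub_le (U (rep S)) (U w) (U (rep S'))
      linarith) hT'
  rw [abs_sub_comm] at h4
  have h5 : ((K.star x).card : ℝ) * (2 * δ) ≤ 4 / σ ^ 2 * (2 * δ) := by
    have := R.card_star_le x
    gcongr
  have t1 := abs_sub_le (U x) (U y) (U v)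
  have t2 := abs_sub_le (U y) (U (rep T')) (U v)
  have t3 := abs_sub_le (U (rep T')) (U (rep T)) (U v)
  have e0 : (8 / σ ^ 2 + 3) * δ = 4 / σ ^ 2 * (2 * δ) + 3 * δ := by ring
  rw [e0]
  linarith

/-- The values at the vertices of one triangle are comparable. -/
theorem Regular.abs_vertex_sub_le (R : K.Regular σ L) {η d₀ : ℝ} (hη : 0 < η)
    (hησ : 6 * (1 + L) * η < σ) (hηd : 6 * (1 + L) * η < d₀)
    (hd : d₀ * K.h ≤ Metric.diam K.Γ) {U : Plane → ℝ} {f : Finset Plane → Fin 2 → Plane →ᵃ[ℝ] ℝ}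
    (hU : ∀ S ∈ K.mesh.cells, K.Compatible S U (f S)) (hT : T ∈ K.mesh.cells) {e : ℝ}
    (he : ∀ S ∈ K.mesh.cells, (∃ v ∈ T, v ∈ S) → K.energy S (f S) ≤ e)
    {v w : Plane} (hv : v ∈ T) (hw : w ∈ T) :
    |U v - U w| ≤ (8 / σ ^ 2 + 3) * √(cellConst σ η * e) := by
  have hδ0 : 0 ≤ √(cellConst σ η * e) := Real.sqrt_nonneg _
  have hσ := R.σ_pos
  have h8 : 0 ≤ 8 / σ ^ 2 := by positivity
  rcases R.abs_sub_le_or_shortAt hη hησ hT (hU T hT) (he T hT ⟨v, hv, hv⟩) with h | ⟨x, hx, hs⟩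
  · have := h v hv w hw
    nlinarith
  · have hst : ∀ S ∈ K.star x, K.energy S (f S) ≤ e := fun S hS =>
      he S (mem_star.1 hS).1 ⟨x, hs.mem, (mem_star.1 hS).2⟩
    by_cases hvx : v = x
    · rw [hvx]
      exact R.abs_sub_le_of_shortAt hη hησ hηd hd hU hx hs hst hw
    by_cases hwx : w = x
    · rw [hwx, abs_sub_comm]
      exact R.abs_sub_le_of_shortAt hη hησ hηd hd hU hx hs hst hv
    · have := hs.abs_sub_le R hη hησ (hU T hT) (he T hT ⟨v, hv, hv⟩) hv hw hvx hwx
      nlinarith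

/-! ### Chains of triangles to a vertex with value zero -/

/-- Each vertex at the interface can be joined by a segment of length at most `m * h` in the closure
of the domain to a triangle with a vertex that is not at the interface. -/
def Reaches (K : CutMesh Ω) (m : ℝ) : Prop :=
  ∀ x ∈ K.interfaceVertices, ∃ b, dist x b ≤ m * K.h ∧
    (∀ t ∈ Set.Icc (0 : ℝ) 1, AffineMap.lineMap (k := ℝ) x b t ∈ closure Ω) ∧
    ∃ T ∈ K.mesh.cells, b ∈ hull T ∧ ∃ v ∈ T, v ∉ K.interfaceVertices

/-- The triangles met by the segment form a chain in which neighbours share a vertex. The chain has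
bounded length by the count of areas, and it ends next to a vertex with value 0. Energies are needed
at the distance `m + 1` because the comparison within a triangle involves the triangles around it.
-/
theorem Regular.abs_le_of_reaches (R : K.Regular σ L) {η d₀ m : ℝ} (hη : 0 < η) (hm : 0 ≤ m)
    (hησ : 6 * (1 + L) * η < σ) (hηd : 6 * (1 + L) * η < d₀)
    (hd : d₀ * K.h ≤ Metric.diam K.Γ) (hreach : K.Reaches m)
    {U : Plane → ℝ} {f : Finset Plane → Fin 2 → Plane →ᵃ[ℝ] ℝ}
    (hU : ∀ S ∈ K.mesh.cells, K.Compatible S U (f S))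
    (hU0 : ∀ v, v ∉ K.interfaceVertices → U v = 0) {x : Plane} (hx : x ∈ K.interfaceVertices)
    {e : ℝ} (he : ∀ S ∈ K.near x (m + 1), K.energy S (f S) ≤ e) :
    |U x| ≤ (8 * (m + 1) ^ 2 / σ ^ 2 + 3) * ((8 / σ ^ 2 + 3) * √(cellConst σ η * e)) := by
  classical
  have hh := R.h_pos
  have hσ := R.σ_pos
  set D := (8 / σ ^ 2 + 3) * √(cellConst σ η * e) with hD
  have hD0 : 0 ≤ D := by positivity
  obtain ⟨b, hb, hseg, Tb, hTb, hbT, v0, hv0, hv0n⟩ := hreach x hx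
  set seg : Set Plane := (fun t : ℝ => AffineMap.lineMap (k := ℝ) x b t) '' Set.Icc 0 1 with hsegdef
  have hsegc : IsPreconnected seg :=
    isPreconnected_Icc.image _ AffineMap.lineMap_continuous.continuousOn
  have hsegd : ∀ w ∈ seg, dist w x ≤ m * K.h := by
    rintro _ ⟨t, ht, rfl⟩
    simp only
    rw [dist_lineMap_left, Real.norm_of_nonneg ht.1]
    exact (mul_le_of_le_one_left dist_nonneg ht.2).trans hb
  have hedge : ∀ T ∈ K.near x m, ∀ v ∈ T, ∀ w ∈ T, |U v - U w| ≤ D := by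
    intro T hT v hv w hw
    obtain ⟨hTc, y, hyT, hyx⟩ := mem_near.1 hT
    refine R.abs_vertex_sub_le hη hησ hηd hd hU hTc (fun S hS ⟨u, huT, huS⟩ => he S ?_) hv hw
    refine mem_near.2 ⟨hS, u, mem_hull_of_mem huS, ?_⟩
    have := R.diam_le T hTc u (mem_hull_of_mem huT) y hyT
    have := dist_triangle u y x
    linarith
  have hxv : x ∈ K.mesh.vertices := (Finset.mem_filter.1 hx).1
  obtain ⟨Ta, hTa, hxTa⟩ := exists_cell_of_mem_vertices hxv
  set Rel : Finset Plane → Finset Plane → Prop := fun S S' =>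
    S ∈ K.near x m ∧ S' ∈ K.near x m ∧ ∃ v ∈ S, v ∈ S' with hRel
  have hnear : ∀ S ∈ K.mesh.cells, (seg ∩ hull S).Nonempty → S ∈ K.near x m := by
    rintro S hS ⟨w, hw, hwS⟩
    exact mem_near.2 ⟨hS, w, hwS, hsegd w hw⟩
  have hxseg : x ∈ seg := ⟨0, by simp, by simp⟩
  have hbseg : b ∈ seg := ⟨1, by simp, by simp⟩
  -- Otherwise the reached and the unreached triangles cover the connected segment by two closed
  -- sets, which must meet on it; two triangles with a common point share a vertex.
  have hconn : ∃ T' ∈ K.mesh.cells, b ∈ hull T' ∧ Relation.ReflTransGen Rel Ta T' := by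
    by_contra! hcon
    set 𝓡 := K.mesh.cells.filter fun S => Relation.ReflTransGen Rel Ta S with h𝓡
    set 𝓑 := K.mesh.cells.filter fun S => ¬ Relation.ReflTransGen Rel Ta S with h𝓑
    have hclosed : ∀ s : Finset (Finset Plane), IsClosed (⋃ S ∈ s, hull S) := fun s =>
      s.finite_toSet.isClosed_biUnion fun S _ => isClosed_hull S
    have hcover : seg ⊆ (⋃ S ∈ 𝓡, hull S) ∪ ⋃ S ∈ 𝓑, hull S := by
      rintro _ ⟨t, ht, rfl⟩
      obtain ⟨S, hS, hwS⟩ := exists_cell_of_mem_closure (M := K.mesh) (hseg t ht)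
      by_cases h : Relation.ReflTransGen Rel Ta S
      · exact Or.inl (Set.mem_biUnion (Finset.mem_filter.2 ⟨hS, h⟩) hwS)
      · exact Or.inr (Set.mem_biUnion (Finset.mem_filter.2 ⟨hS, h⟩) hwS)
    obtain ⟨w, hw, hw1, hw2⟩ := isPreconnected_closed_iff.1 hsegc _ _ (hclosed 𝓡) (hclosed 𝓑) hcover
      ⟨x, hxseg, Set.mem_biUnion (Finset.mem_filter.2 ⟨hTa, .refl⟩) (mem_hull_of_mem hxTa)⟩
      ⟨b, hbseg, Set.mem_biUnion (Finset.mem_filter.2 ⟨hTb, hcon Tb hTb hbT⟩) hbT⟩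
    simp only [Set.mem_iUnion, exists_prop] at hw1 hw2
    obtain ⟨S, hSm, hwS⟩ := hw1
    obtain ⟨S', hSm', hwS'⟩ := hw2
    obtain ⟨hS, hSr⟩ := Finset.mem_filter.1 hSm
    obtain ⟨hS', hSr'⟩ := Finset.mem_filter.1 hSm'
    obtain ⟨u, huS, hu⟩ : ∃ u ∈ S, bary hS u w ≠ 0 := by
      by_contra! h0
      have := sum_bary hS w
      rw [Finset.sum_eq_zero h0] at this
      exact zero_ne_one this
    have huS' : u ∈ S' := by
      rw [bary_agree hS hS' u hwS hwS'] at hu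
      exact mem_of_bary_ne_zero hS' hu
    exact hSr' (hSr.tail ⟨hnear S hS ⟨w, hw, hwS⟩, hnear S' hS' ⟨w, hw, hwS'⟩, u, huS, huS'⟩)
  obtain ⟨T', hT', hbT', hchain⟩ := hconn
  have hrep : ∀ S : Finset Plane, ∃ v, S ∈ K.mesh.cells → v ∈ S := fun S => by
    by_cases hS : S ∈ K.mesh.cells
    · obtain ⟨v, hv, -⟩ := exists_ne_mem hS x
      exact ⟨v, fun _ => hv⟩
    · exact ⟨x, fun h => absurd h hS⟩
  choose rep hrep using hrep
  have hcell : ∀ S ∈ K.near x m, S ∈ K.mesh.cells := fun S hS => (mem_near.1 hS).1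
  have hstep : ∀ S ∈ K.near x m, ∀ S' ∈ K.near x m, (∃ v ∈ S, v ∈ S') →
      |U (rep S) - U (rep S')| ≤ 2 * D := by
    rintro S hS S' hS' ⟨w, hw, hw'⟩
    have e1 := hedge S hS _ (hrep S (hcell S hS)) w hw
    have e2 := hedge S' hS' w hw' _ (hrep S' (hcell S' hS'))
    have := abs_sub_le (U (rep S)) (U w) (U (rep S'))
    linarith
  have h4 := abs_sub_le_of_reflTransGen (K.near x m) Rel (fun S => U (rep S)) (ε := 2 * D)
    (by positivity) (fun S S' h => ⟨h.1, h.2.1⟩)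
    (fun S S' h => hstep S h.1 S' h.2.1 h.2.2) hchain
  have hTan := hnear Ta hTa ⟨x, hxseg, mem_hull_of_mem hxTa⟩
  have hTbn := hnear Tb hTb ⟨b, hbseg, hbT⟩
  have hTn := hnear T' hT' ⟨b, hbseg, hbT'⟩
  obtain ⟨u, huT', hub⟩ : ∃ u ∈ T', bary hT' u b ≠ 0 := by
    by_contra! h0
    have := sum_bary hT' b
    rw [Finset.sum_eq_zero h0] at this
    exact zero_ne_one this
  have huTb : u ∈ Tb := by
    rw [bary_agree hT' hTb u hbT' hbT] at hub
    exact mem_of_bary_ne_zero hTb hub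
  have h1 := hedge Ta hTan x hxTa _ (hrep Ta hTa)
  have h2 := hedge T' hTn _ (hrep T' hT') u huT'
  have h3 := hedge Tb hTbn u huTb v0 hv0
  rw [hU0 v0 hv0n] at h3
  have h5 : ((K.near x m).card : ℝ) * (2 * D) ≤ 4 * (m + 1) ^ 2 / σ ^ 2 * (2 * D) := by
    have := R.card_near_le x hm
    exact mul_le_mul_of_nonneg_right this (by positivity)
  have hlast : |U (rep Ta) - 0| ≤ ((K.near x m).card : ℝ) * (2 * D) + 2 * D := by
    have t1 := abs_sub_le (U (rep Ta)) (U (rep T')) 0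
    have t2 := abs_sub_le (U (rep T')) (U u) 0
    linarith
  have t0 := abs_sub_le (U x) (U (rep Ta)) 0
  rw [sub_zero] at t0
  have e0 : (8 * (m + 1) ^ 2 / σ ^ 2 + 3) * D = 4 * (m + 1) ^ 2 / σ ^ 2 * (2 * D) + 3 * D := by ring
  rw [e0]
  linarith

/-! ### The sum of the squares of the vertex values -/

theorem Regular.card_vertices_near_le (R : K.Regular σ L) {m : ℝ} (hm : 0 ≤ m)
    (hT : T ∈ K.mesh.cells) [∀ x, Decidable (T ∈ K.near x m)] :
    ((K.interfaceVertices.filter fun x => T ∈ K.near x m).card : ℝ) ≤ 12 * (m + 2) ^ 2 / σ ^ 2 := by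
  classical
  have hh := R.h_pos
  obtain ⟨s, hs, -⟩ := exists_ne_mem hT 0
  have h1 : K.interfaceVertices.filter (fun x => T ∈ K.near x m) ⊆
      (K.near s (m + 1)).biUnion id := by
    intro x hx
    obtain ⟨hx, hxT⟩ := Finset.mem_filter.1 hx
    obtain ⟨-, y, hyT, hy⟩ := mem_near.1 hxT
    obtain ⟨S, hS, hxS⟩ := exists_cell_of_mem_vertices (Finset.mem_filter.1 hx).1
    refine Finset.mem_biUnion.2 ⟨S, mem_near.2 ⟨hS, x, mem_hull_of_mem hxS, ?_⟩, hxS⟩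
    have h1 := R.diam_le T hT y hyT s (mem_hull_of_mem hs)
    have h2 := dist_triangle x y s
    rw [dist_comm x y] at h2
    linarith
  have h2 : ((K.near s (m + 1)).biUnion id).card ≤ (K.near s (m + 1)).card * 3 :=
    Finset.card_biUnion_le_card_mul _ _ _ fun S hS => (mem_cells.1 (mem_near.1 hS).1).2.le
  have h3 := R.card_near_le s (m := m + 1) (by linarith)
  have h4 : ((K.interfaceVertices.filter fun x => T ∈ K.near x m).card : ℝ) ≤
      ((K.near s (m + 1)).card : ℝ) * 3 := by
    exact_mod_cast (Finset.card_le_card h1).trans h2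
  calc _ ≤ _ := h4
    _ ≤ 4 * (m + 1 + 1) ^ 2 / σ ^ 2 * 3 := mul_le_mul_of_nonneg_right h3 (by norm_num)
    _ = 12 * (m + 2) ^ 2 / σ ^ 2 := by ring

/-- The constant in the estimate of the vertex values by the energy. -/
def valueConst (σ η m : ℝ) : ℝ :=
  ((8 * (m + 1) ^ 2 / σ ^ 2 + 3) * (8 / σ ^ 2 + 3)) ^ 2 * cellConst σ η *
    (12 * (m + 3) ^ 2 / σ ^ 2)

theorem valueConst_nonneg (hσ : 0 < σ) {η : ℝ} (hη : 0 < η) (m : ℝ) : 0 ≤ valueConst σ η m := by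
  have := cellConst_ge hσ hη
  unfold valueConst
  positivity

/-- Each U(x)² is bounded by the energies of the triangles near `x`. Since each triangle is near a
bounded number of vertices, summation costs only a constant. -/
theorem Regular.sum_sq_le (R : K.Regular σ L) {η d₀ m : ℝ} (hη : 0 < η) (hm : 0 ≤ m)
    (hησ : 6 * (1 + L) * η < σ) (hηd : 6 * (1 + L) * η < d₀)
    (hd : d₀ * K.h ≤ Metric.diam K.Γ) (hreach : K.Reaches m)
    {U : Plane → ℝ} {f : Finset Plane → Fin 2 → Plane →ᵃ[ℝ] ℝ}
    (hU : ∀ S ∈ K.mesh.cells, K.Compatible S U (f S))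
    (hU0 : ∀ v, v ∉ K.interfaceVertices → U v = 0) :
    ∑ x ∈ K.interfaceVertices, U x ^ 2 ≤
      valueConst σ η m * ∑ S ∈ K.mesh.cells, K.energy S (f S) := by
  classical
  have hE : ∀ S, 0 ≤ K.energy S (f S) := fun S => R.energy_nonneg S _
  have hc := cellConst_ge R.σ_pos hη
  set A := ((8 * (m + 1) ^ 2 / σ ^ 2 + 3) * (8 / σ ^ 2 + 3)) ^ 2 * cellConst σ η with hA
  have hA0 : 0 ≤ A := by positivity
  have h1 : ∀ x ∈ K.interfaceVertices, U x ^ 2 ≤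
      A * ∑ S ∈ K.mesh.cells, if S ∈ K.near x (m + 1) then K.energy S (f S) else 0 := by
    intro x hx
    have h0 : ∑ S ∈ K.near x (m + 1), K.energy S (f S) =
        ∑ S ∈ K.mesh.cells, if S ∈ K.near x (m + 1) then K.energy S (f S) else 0 := by
      rw [← Finset.sum_filter]
      refine Finset.sum_congr ?_ fun _ _ => rfl
      ext S
      simp only [Finset.mem_filter]
      exact ⟨fun h => ⟨(mem_near.1 h).1, h⟩, fun h => h.2⟩
    rw [← h0]
    set e := ∑ S ∈ K.near x (m + 1), K.energy S (f S) with he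
    have he0 : 0 ≤ e := Finset.sum_nonneg fun S _ => hE S
    have h2 := R.abs_le_of_reaches hη hm hησ hηd hd hreach hU hU0 hx (e := e)
      fun S hS => Finset.single_le_sum (f := fun S => K.energy S (f S)) (fun S _ => hE S) hS
    rw [← sq_abs]
    refine (pow_le_pow_left₀ (abs_nonneg _) h2 2).trans_eq ?_
    rw [mul_pow, mul_pow, Real.sq_sqrt (by positivity), hA]
    ring
  refine (Finset.sum_le_sum h1).trans ?_
  rw [← Finset.mul_sum, Finset.sum_comm]
  have h3 : ∀ S ∈ K.mesh.cells,
      (∑ x ∈ K.interfaceVertices, if S ∈ K.near x (m + 1) then K.energy S (f S) else 0) ≤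
        12 * (m + 3) ^ 2 / σ ^ 2 * K.energy S (f S) := by
    intro S hS
    rw [← Finset.sum_filter, Finset.sum_const, nsmul_eq_mul]
    refine mul_le_mul_of_nonneg_right ?_ (hE S)
    refine (R.card_vertices_near_le (m := m + 1) (by linarith) hS).trans_eq ?_
    ring
  have h4 := Finset.sum_le_sum h3
  rw [← Finset.mul_sum] at h4
  calc _ ≤ A * (12 * (m + 3) ^ 2 / σ ^ 2 * ∑ S ∈ K.mesh.cells, K.energy S (f S)) :=
        mul_le_mul_of_nonneg_left h4 hA0
    _ = _ := by rw [valueConst, hA]; ring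

/-! ### Triangles away from the interface -/

theorem mem_interfaceVertices {x : Plane} : x ∈ K.interfaceVertices ↔ x ∈ K.mesh.vertices ∧
    ∃ i j, i ≠ j ∧ x ∈ K.sub i ∧ ∃ T ∈ K.mesh.cells, x ∈ T ∧ (hull T ∩ K.sub j).Nonempty := by
  simp [interfaceVertices]

theorem mem_of_mem_interfaceVertices {x : Plane} (hx : x ∈ K.interfaceVertices) : x ∈ Ω := by
  obtain ⟨-, i, -, -, hi, -⟩ := mem_interfaceVertices.1 hx
  exact K.sub_subset i hi

/-- If Γ were farther away, the triangle that links `x` to the other subdomain would avoid Γ and,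
being connected, lie on the side of `x`. -/
theorem Regular.exists_interface_near (R : K.Regular σ L) {x : Plane}
    (hx : x ∈ K.interfaceVertices) : ∃ y ∈ K.Γ, dist x y ≤ K.h := by
  obtain ⟨-, i, j, hij, hi, T, hT, hxT, y, hyT, hyj⟩ := mem_interfaceVertices.1 hx
  by_contra! hcon
  have hno : ∀ w ∈ hull T, w ∉ K.Γ := fun w hw hwΓ =>
    absurd (R.diam_le T hT x (mem_hull_of_mem hxT) w hw) (not_le.2 (hcon w hwΓ))
  have := side_of_preconnected (convex_hull T).isPreconnected (hull_subset_closure hT) hno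
    (mem_hull_of_mem hxT) (subset_closure hi) hyT
  exact hno y hyT (mem_interface_of_mem_closure hij this (subset_closure hyj))

/-- The segment to `z` may leave Ω. Then its first exit point takes the place of `z`: a triangle
there has a vertex outside Ω, which is not an interface vertex. -/
theorem Regular.reaches_of_exists (R : K.Regular σ L) {m : ℝ}
    (h : ∀ x ∈ K.interfaceVertices, ∃ z, dist x z ≤ m * K.h ∧
      ∀ T ∈ K.mesh.cells, z ∈ hull T → ∃ v ∈ T, v ∉ K.interfaceVertices) : K.Reaches m := by
  intro x hx
  have hxΩ := mem_of_mem_interfaceVertices hx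
  have hΩo : IsOpen Ω := by rw [← R.reg]; exact isOpen_interior
  obtain ⟨z, hz, hzT⟩ := h x hx
  by_cases hall : ∀ t ∈ Set.Icc (0 : ℝ) 1, AffineMap.lineMap (k := ℝ) x z t ∈ Ω
  · have h1 : z ∈ Ω := by simpa using hall 1 (by simp)
    obtain ⟨T, hT, hzh⟩ := exists_cell_of_mem_closure (M := K.mesh) (subset_closure h1)
    exact ⟨z, hz, fun t ht => subset_closure (hall t ht), T, hT, hzh, hzT T hT hzh⟩
  push Not at hall
  obtain ⟨t₀, ht₀, hout⟩ := hall
  obtain ⟨t, ht, htn, hin⟩ := exists_first_exit hΩo hxΩ hout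
  set w := AffineMap.lineMap (k := ℝ) x z t₀ with hw
  set b := AffineMap.lineMap (k := ℝ) x w t with hb
  have hseg : ∀ s ∈ Set.Ico (0 : ℝ) 1, AffineMap.lineMap (k := ℝ) x b s ∈ Ω := by
    intro s hs
    have : AffineMap.lineMap (k := ℝ) x b s = AffineMap.lineMap (k := ℝ) x w (s * t) := by
      rw [hb]
      simp only [AffineMap.lineMap_apply, vsub_eq_sub, vadd_eq_add, add_sub_cancel_right, smul_smul]
    rw [this]
    refine hin _ ⟨mul_nonneg hs.1 ht.1.le, ?_⟩
    nlinarith [hs.2, ht.1]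
  have hcl : ∀ s ∈ Set.Icc (0 : ℝ) 1, AffineMap.lineMap (k := ℝ) x b s ∈ closure Ω := by
    have hcont : Continuous fun s : ℝ => AffineMap.lineMap (k := ℝ) x b s :=
      AffineMap.lineMap_continuous
    have h1 : Set.Icc (0 : ℝ) 1 = closure (Set.Ico 0 1) := (closure_Ico zero_ne_one).symm
    intro s hs
    rw [h1] at hs
    exact (Set.MapsTo.closure (s := Set.Ico (0 : ℝ) 1) (t := Ω) hseg hcont) hs
  have hbcl : b ∈ closure Ω := by simpa using hcl 1 (by simp)
  obtain ⟨T, hT, hbT⟩ := exists_cell_of_mem_closure (M := K.mesh) hbcl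
  obtain ⟨v, hv, hvΩ⟩ := exists_vertex_notMem R.reg hT hbT htn
  refine ⟨b, ?_, hcl, T, hT, hbT, v, hv, fun h => hvΩ (mem_of_mem_interfaceVertices h)⟩
  rw [hb, dist_left_lineMap, hw, dist_left_lineMap, Real.norm_of_nonneg ht.1.le,
    Real.norm_of_nonneg ht₀.1]
  have h1 : t₀ * dist x z ≤ dist x z := mul_le_of_le_one_left dist_nonneg ht₀.2
  have h2 : t * (t₀ * dist x z) ≤ t₀ * dist x z :=
    mul_le_of_le_one_left (mul_nonneg ht₀.1 dist_nonneg) ht.2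
  linarith

end CutMesh

/-! ### Families -/

open Triangulation

variable {Ω : Set Plane}

theorem IsGraphOverChord.mono {Γ : Set Plane} {L L' : ℝ} {T : Finset Plane}
    (h : IsGraphOverChord Γ L T) (hL : L ≤ L') : IsGraphOverChord Γ L' T := by
  obtain ⟨p, q, ν, g, h1, h2, h3, h4, h5, h6, h7, h8, h9⟩ := h
  refine ⟨p, q, ν, g, h1, h2, h3, h4, h5, h6, h7, fun s hs t ht => (h8 s hs t ht).trans ?_, h9⟩
  gcongr

/-- The constant `|L|` is used since no sign of `L` is assumed. The mesh size is positive because a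
triangle has two distinct vertices. -/
theorem UnfittedFamily.Admissible.regular {F : UnfittedFamily Ω} {σ L c d₀ θ r₀ : ℝ}
    (A : F.Admissible σ L c d₀ θ r₀) (hΩ : IsConnected Ω) (hreg : interior (closure Ω) = Ω)
    (hσ : 0 < σ) (l : ℕ) : (F.level l).Regular σ |L| := by
  have hdiam : ∀ T ∈ (F.level l).mesh.cells, ∀ x ∈ hull T, ∀ y ∈ hull T,
      dist x y ≤ (F.level l).h := fun T hT x hx y hy =>
    (Metric.dist_le_diam_of_mem (isCompact_hull T).isBounded hx hy).trans (A.quasiUniform l T hT).1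
  refine ⟨hreg, hσ, abs_nonneg L, ?_, hdiam, fun T hT => (A.quasiUniform l T hT).2,
    A.vertex_notMem l, fun T hT h => (A.graph l T hT h).mono (le_abs_self L)⟩
  obtain ⟨T, hT⟩ := cells_nonempty (F.level l).mesh hΩ.nonempty
  obtain ⟨v, hv, -⟩ := CutMesh.exists_ne_mem hT 0
  obtain ⟨w, hw, hne⟩ := CutMesh.exists_ne_mem hT v
  exact (dist_pos.2 hne).trans_le (hdiam T hT w (mem_hull_of_mem hw) v (mem_hull_of_mem hv))

/-- The number of mesh sizes within which the triangles away from the interface are reached. -/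
def reachConst (Ω : Set Plane) (c θ r₀ : ℝ) : ℝ :=
  (3 + 6 / θ) + (Metric.diam (closure Ω) + 1) / min (θ * r₀ / 6) (1 / (|c| + 1))

theorem reachConst_nonneg (Ω : Set Plane) (c : ℝ) {θ r₀ : ℝ} (hθ : 0 < θ) (hr₀ : 0 < r₀) :
    0 ≤ reachConst Ω c θ r₀ := by
  have h1 : 0 < min (θ * r₀ / 6) (1 / (|c| + 1)) := lt_min (by positivity) (by positivity)
  have h2 : 0 ≤ Metric.diam (closure Ω) := Metric.diam_nonneg
  unfold reachConst
  positivity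

/-- On fine meshes porosity yields, at a distance of order h/θ, a disc of radius 6h free of the
exact interface. A triangle at its centre has no interface vertex: such a vertex is within h of the
discrete interface, which is within 2h of the exact one, so the latter would come within 4h of the
centre. On coarse meshes all of Ω measures a bounded number of mesh sizes. -/
theorem UnfittedFamily.Admissible.reaches {F : UnfittedFamily Ω} {σ L c d₀ θ r₀ : ℝ}
    (A : F.Admissible σ L c d₀ θ r₀) (hΩ : IsConnected Ω) (hreg : interior (closure Ω) = Ω)
    (hσ : 0 < σ) (hθ : 0 < θ) (hr₀ : 0 < r₀) (l : ℕ) :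
    (F.level l).Reaches (reachConst Ω c θ r₀) := by
  set K := F.level l with hK
  have R : K.Regular σ |L| := A.regular hΩ hreg hσ l
  have hh := R.h_pos
  have hD0 : 0 ≤ Metric.diam (closure Ω) := Metric.diam_nonneg
  have hmin : 0 < min (θ * r₀ / 6) (1 / (|c| + 1)) := lt_min (by positivity) (by positivity)
  have hbd : Bornology.IsBounded (closure Ω) := (isCompact_closure K.mesh).isBounded
  refine R.reaches_of_exists fun x hx => ?_
  have hxcl : x ∈ closure Ω := subset_closure (CutMesh.mem_of_mem_interfaceVertices hx)
  -- Below the threshold, 6h/θ ≤ r₀ makes porosity applicable, and (|c| + 1)h ≤ 1 makes the distance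
  -- of the interfaces less than 2h.
  rcases le_or_gt K.h (min (θ * r₀ / 6) (1 / (|c| + 1))) with hle | hgt
  · have hle1 := hle.trans (min_le_left _ _)
    have hle2 := hle.trans (min_le_right _ _)
    rw [le_div_iff₀ (by positivity)] at hle2
    have hdist : Metric.hausdorffDist F.Γ K.Γ < 2 * K.h := by
      have h1 := A.dist_le l
      rw [← hK] at h1
      have h2 : c * K.h ^ 2 ≤ |c| * K.h ^ 2 := by
        have := le_abs_self c
        gcongr
      nlinarith
    have hΓsub : F.Γ ⊆ closure Ω := by
      rw [F.isInterface.eq_inter]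
      refine Set.inter_subset_left.trans (closure_mono fun w hw => ?_)
      have : w ∈ F.sub 0 ∪ F.sub 1 := Or.inl hw
      rw [F.isInterface.union_eq] at this
      exact this.1
    have hfin : Metric.hausdorffEDist F.Γ K.Γ ≠ ⊤ :=
      Metric.hausdorffEDist_ne_top_of_nonempty_of_bounded F.isInterface.connected.nonempty
        K.isInterface.connected.nonempty (hbd.subset hΓsub) (hbd.subset K.interface_subset)
    obtain ⟨y₀, hy₀, hxy₀⟩ := R.exists_interface_near hx
    obtain ⟨y₁, hy₁, hy₀₁⟩ := Metric.exists_dist_lt_of_hausdorffDist_lt' hy₀ hdist hfin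
    have hr : 6 * K.h / θ ≤ r₀ := by
      rw [div_le_iff₀ hθ]
      linarith
    obtain ⟨z, hz⟩ := A.porous y₁ hy₁ (6 * K.h / θ) (by positivity) hr
    rw [mul_div_cancel₀ _ hθ.ne'] at hz
    have hzy : dist z y₁ ≤ 6 * K.h / θ := (hz (Metric.mem_closedBall_self (by positivity))).1
    refine ⟨z, ?_, fun T hT hzT => ?_⟩
    · have h1 := dist_triangle x y₀ z
      have h2 := dist_triangle y₀ y₁ z
      rw [dist_comm y₁ z] at h2
      rw [dist_comm] at hy₀₁
      have h3 : 0 ≤ (Metric.diam (closure Ω) + 1) / min (θ * r₀ / 6) (1 / (|c| + 1)) * K.h := by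
        positivity
      have h4 : reachConst Ω c θ r₀ * K.h = 3 * K.h + 6 * K.h / θ +
          (Metric.diam (closure Ω) + 1) / min (θ * r₀ / 6) (1 / (|c| + 1)) * K.h := by
        rw [reachConst]
        ring
      rw [h4]
      linarith
    · obtain ⟨v, hv, -⟩ := CutMesh.exists_ne_mem hT 0
      refine ⟨v, hv, fun hvi => ?_⟩
      obtain ⟨w, hw, hvw⟩ := R.exists_interface_near hvi
      obtain ⟨w', hw', hww'⟩ := Metric.exists_dist_lt_of_hausdorffDist_lt' hw hdist hfin
      have h0 := R.diam_le T hT z hzT v (mem_hull_of_mem hv)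
      have h1 := dist_triangle z v w
      have h2 := dist_triangle z w w'
      rw [dist_comm] at hww'
      have hmem : w' ∈ Metric.closedBall z (6 * K.h) := by
        rw [Metric.mem_closedBall, dist_comm]
        linarith [dist_comm w w']
      exact (hz hmem).2 hw'
  -- On coarse meshes a point outside the closure of Ω is taken, so that no triangle contains it.
  · have hxz : dist x (x + (Metric.diam (closure Ω) + 1) • EuclideanSpace.single 0 1) =
        Metric.diam (closure Ω) + 1 := by
      rw [dist_self_add_right, norm_smul, PiLp.norm_single, norm_one, mul_one,
        Real.norm_of_nonneg (by positivity)]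
    refine ⟨x + (Metric.diam (closure Ω) + 1) • EuclideanSpace.single 0 1, ?_, fun T hT hzT => ?_⟩
    · rw [hxz]
      have h3 : Metric.diam (closure Ω) + 1 ≤
          (Metric.diam (closure Ω) + 1) / min (θ * r₀ / 6) (1 / (|c| + 1)) * K.h := by
        rw [div_mul_eq_mul_div, le_div_iff₀ hmin]
        exact mul_le_mul_of_nonneg_left hgt.le (by positivity)
      have h4 : 0 ≤ (3 + 6 / θ) * K.h := by positivity
      rw [reachConst, add_mul]
      linarith
    · exfalso
      have := Metric.dist_le_diam_of_mem hbd hxcl (hull_subset_closure hT hzT)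
      rw [hxz] at this
      linarith

namespace CutMesh

open Triangulation

variable {Ω : Set Plane} {K : CutMesh Ω} {σ L : ℝ} {T : Finset Plane}

/-! ### The contributions of one triangle in terms of affine functions -/

/-- On the triangle `T`, the pair `u` coincides with the pair `f` of affine functions. -/
def Represents (T : Finset Plane) (u : Fin 2 → Plane → ℝ) (f : Fin 2 → Plane →ᵃ[ℝ] ℝ) : Prop :=
  ∀ i, Set.EqOn (u i) (f i) (hull T)

/-- The integral of the jump times the normal over the interface in `T`. -/
def jumpNormal (K : CutMesh Ω) (T : Finset Plane) (f : Fin 2 → Plane →ᵃ[ℝ] ℝ) : Plane :=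
  ∫ y in hull T ∩ K.Γ, (f 0 - f 1) y • K.normal y ∂μH[1]

theorem ae_mem_interior_volume (T : Finset Plane) {S : Set Plane} (hS : MeasurableSet (hull T ∩ S)) :
    ∀ᵐ y ∂(volume.restrict (hull T ∩ S)), y ∈ interior (hull T) := by
  rw [ae_restrict_iff' hS]
  have h := (convex_hull T).addHaar_frontier volume
  filter_upwards [measure_eq_zero_iff_ae_notMem.1 h] with y hy hyT
  rw [(isClosed_hull T).frontier_eq] at hy
  by_contra hn
  exact hy ⟨hyT.1, hn⟩

/-- The arc meets the frontier of the triangle only at its endpoints, and points have no length. So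
on almost all of Γ the gradient is that of the affine function on the triangle. -/
theorem Regular.ae_mem_interior (R : K.Regular σ L) (hT : T ∈ K.mesh.cells) :
    ∀ᵐ y ∂((μH[1] : Measure Plane).restrict (hull T ∩ K.Γ)), y ∈ interior (hull T) := by
  rw [ae_restrict_iff' (K.isCompact_hull_inter T).measurableSet]
  by_cases hne : (hull T ∩ K.Γ).Nonempty
  · obtain ⟨-, x, y, z, p, q, k, A⟩ := R.exists_arcCut hT hne
    have : NullSingletonClass (μH[1] : Measure Plane) :=
      Measure.nullSingletonClass_hausdorff Plane one_pos
    have hp : ∀ a : Plane, ∀ᵐ w ∂(μH[1] : Measure Plane), w ≠ a := fun a => by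
      rw [ae_iff]
      simp
    filter_upwards [hp p, hp q] with w h1 h2 hw
    rcases A.interior_or w hw with h | h | h
    exacts [h, absurd h h1, absurd h h2]
  · exact Filter.Eventually.of_forall fun y hy => absurd ⟨y, hy⟩ hne

theorem Regular.weight_mul_volume (R : K.Regular σ L) (hT : T ∈ K.mesh.cells) (i : Fin 2) :
    K.weight T i * volume.real (hull T) = volume.real (hull T ∩ K.sub i) :=
  div_mul_cancel₀ _ (R.volume_hull_pos hT).ne'

theorem Regular.aCell_eq (R : K.Regular σ L) (hT : T ∈ K.mesh.cells) (μ : Fin 2 → ℝ)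
    {u v : Fin 2 → Plane → ℝ} {f g : Fin 2 → Plane →ᵃ[ℝ] ℝ} (hu : Represents T u f)
    (hv : Represents T v g) :
    K.aCell μ T u v = ∑ i, μ i * (K.weight T i * volume.real (hull T)) *
      inner ℝ (agrad (f i)) (agrad (g i)) := by
  refine Finset.sum_congr rfl fun i _ => ?_
  have h1 : ∫ y in hull T ∩ K.sub i, μ i * inner ℝ (gradient (u i) y) (gradient (v i) y) =
      ∫ y in hull T ∩ K.sub i, μ i * inner ℝ (agrad (f i)) (agrad (g i)) := by
    refine integral_congr_ae ?_
    filter_upwards [ae_mem_interior_volume T (K.measurableSet_hull_inter_sub T i)] with y hy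
    rw [gradient_eq_agrad (hu i) hy, gradient_eq_agrad (hv i) hy]
  rw [h1, setIntegral_const, R.weight_mul_volume hT, smul_eq_mul]
  ring

theorem norm_normal_le (y : Plane) : ‖K.normal y‖ ≤ 1 := norm_normalField_le _ _ y

theorem Regular.integrableOn_smul_normal (R : K.Regular σ L) (hT : T ∈ K.mesh.cells)
    (w : Plane →ᵃ[ℝ] ℝ) : IntegrableOn (fun y => w y • K.normal y) (hull T ∩ K.Γ) μH[1] := by
  obtain ⟨b, hb⟩ := (isCompact_hull T).exists_bound_of_continuousOn (continuous_affine w).continuousOn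
  refine R.integrableOn_bounded hT (b := b) ?_ fun y hy => ?_
  · exact ((continuous_affine w).measurable.smul
      (measurable_normalField K.isInterface.disjoint)).aestronglyMeasurable
  · rw [norm_smul]
    exact (mul_le_of_le_one_right (norm_nonneg _) (norm_normal_le y)).trans (hb y hy)

/-- The gradients are constant on the triangle, and the only integral that is left is the vector
`jumpNormal`. -/
theorem Regular.ncCell_eq (R : K.Regular σ L) (hT : T ∈ K.mesh.cells) (μ : Fin 2 → ℝ)
    {u v : Fin 2 → Plane → ℝ} {f g : Fin 2 → Plane →ᵃ[ℝ] ℝ} (hu : Represents T u f)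
    (hv : Represents T v g) :
    K.ncCell μ T u v =
      -∑ i, μ i * K.weight T i * inner ℝ (agrad (f i)) (K.jumpNormal T g) := by
  set G : Plane := ∑ i, (μ i * K.weight T i) • agrad (f i) with hG
  have h1 : K.ncCell μ T u v =
      ∫ y in hull T ∩ K.Γ, -inner ℝ G ((g 0 - g 1) y • K.normal y) ∂μH[1] := by
    refine integral_congr_ae ?_
    filter_upwards [R.ae_mem_interior hT] with y hy
    have hyT := interior_subset hy
    simp only [meanFlux, jump, hG, Fin.sum_univ_two, gradient_eq_agrad (hu 0) hy,
      gradient_eq_agrad (hu 1) hy, hv 0 hyT, hv 1 hyT, inner_add_left, inner_smul_left,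
      inner_smul_right, AffineMap.coe_sub, Pi.sub_apply]
    simp only [conj_trivial]
    ring
  rw [h1, integral_neg, integral_inner (R.integrableOn_smul_normal hT _), jumpNormal, hG,
    sum_inner]
  simp only [inner_smul_left, conj_trivial]

theorem nsCell_eq (lam : ℝ) {u v : Fin 2 → Plane → ℝ} {f g : Fin 2 → Plane →ᵃ[ℝ] ℝ}
    (hu : Represents T u f) (hv : Represents T v g) :
    K.nsCell lam T u v =
      lam / K.h * ∫ y in hull T ∩ K.Γ, (f 0 - f 1) y * (g 0 - g 1) y ∂μH[1] := by
  unfold nsCell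
  congr 1
  refine setIntegral_congr_fun (K.isCompact_hull_inter T).measurableSet fun y hy => ?_
  simp only [jump, hu 0 hy.1, hu 1 hy.1, hv 0 hy.1, hv 1 hy.1, AffineMap.coe_sub, Pi.sub_apply]

theorem setIntegral_linAt {S : Set Plane} (hS : volume S ≠ ⊤) (hi : IntegrableOn id S volume)
    (G : Plane) :
    ∫ y in S, linAt G ((volume.real S)⁻¹ • ∫ y in S, y) y = 0 := by
  set m := (volume.real S)⁻¹ • ∫ y in S, y with hm
  simp only [linAt_apply]
  have hc : IntegrableOn (fun _ : Plane => m) S volume := integrableOn_const hS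
  have hi' : IntegrableOn (fun y : Plane => y) S volume := hi
  have hs : IntegrableOn (fun y : Plane => y - m) S volume := hi'.sub hc
  rw [integral_inner hs, integral_sub hi' hc, setIntegral_const, hm, smul_smul]
  by_cases h0 : volume.real S = 0
  · have : volume.restrict S = 0 := by
      rw [Measure.restrict_eq_zero]
      exact (measureReal_eq_zero_iff hS).1 h0
    simp [this, h0]
  · rw [mul_inv_cancel₀ h0, one_smul, sub_self, inner_zero_right]

/-- An affine function with a prescribed gradient and mean value zero. -/
def centred (K : CutMesh Ω) (T : Finset Plane) (i : Fin 2) (G : Plane) : Plane →ᵃ[ℝ] ℝ :=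
  linAt G ((volume.real (hull T ∩ K.sub i))⁻¹ • ∫ y in hull T ∩ K.sub i, y)

theorem integral_centred (T : Finset Plane) (i : Fin 2) (G : Plane) :
    ∫ y in hull T ∩ K.sub i, K.centred T i G y = 0 :=
  setIntegral_linAt (volume_hull_inter_ne_top _ _)
    ((continuousOn_id.integrableOn_compact (isCompact_hull T)).mono_set Set.inter_subset_left) G

theorem agrad_centred (T : Finset Plane) (i : Fin 2) (G : Plane) :
    agrad (K.centred T i G) = G := agrad_linAt _ _

theorem Represents.of_coe (T : Finset Plane) (f : Fin 2 → Plane →ᵃ[ℝ] ℝ) :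
    Represents T (fun i => f i) f := fun _ _ _ => rfl

/-- The weights of the average cancel the areas of the parts in the local form, so the same gradient
-J/|T| solves the problem on both parts. -/
theorem Regular.exists_isLifting (R : K.Regular σ L) (hT : T ∈ K.mesh.cells) (μ : Fin 2 → ℝ)
    {u : Fin 2 → Plane → ℝ} {f : Fin 2 → Plane →ᵃ[ℝ] ℝ} (hu : Represents T u f) :
    ∃ w, K.IsLifting μ T u w := by
  have hV := R.volume_hull_pos hT
  refine ⟨fun i => K.centred T i (-((volume.real (hull T))⁻¹ • K.jumpNormal T f)),
    fun i => ⟨⟨_, rfl⟩, integral_centred T i _⟩, fun v hv => ?_⟩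
  choose g hg using fun i => (hv i).1
  have hvg : Represents T v g := fun i y _ => by rw [hg i]
  rw [R.aCell_eq hT μ (Represents.of_coe T _) hvg, R.ncCell_eq hT μ hvg hu, ← Finset.sum_neg_distrib]
  refine Finset.sum_congr rfl fun i _ => ?_
  rw [agrad_centred, inner_neg_left, inner_smul_left, real_inner_comm, conj_trivial]
  field_simp

/-- Test functions on one part with mean value zero and arbitrary gradient determine the gradient of
every solution on a part of positive area. Hence the choice made in `lifting` does not matter. -/
theorem Regular.agrad_of_isLifting (R : K.Regular σ L) (hT : T ∈ K.mesh.cells) {μ : Fin 2 → ℝ}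
    (hμ : ∀ i, 0 < μ i) {u w : Fin 2 → Plane → ℝ} {f g : Fin 2 → Plane →ᵃ[ℝ] ℝ}
    (hu : Represents T u f) (hw : K.IsLifting μ T u w) (hg : ∀ i, w i = g i) (k : Fin 2)
    (hk : K.weight T k ≠ 0) :
    agrad (g k) = -((volume.real (hull T))⁻¹ • K.jumpNormal T f) := by
  have hV := R.volume_hull_pos hT
  refine ext_inner_right ℝ fun G => ?_
  set v : Fin 2 → Plane →ᵃ[ℝ] ℝ := Pi.single k (K.centred T k G) with hv
  have hvm : (fun i => (v i : Plane → ℝ)) ∈ K.localSpace T := by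
    intro i
    refine ⟨⟨_, rfl⟩, ?_⟩
    by_cases hik : i = k
    · subst hik
      simp only [hv, Pi.single_eq_same]
      exact integral_centred T i G
    · simp [hv, Pi.single_eq_of_ne hik]
  have h := hw.2 _ hvm
  rw [R.aCell_eq hT μ (fun i y _ => by rw [hg i]) (Represents.of_coe T v),
    R.ncCell_eq hT μ (Represents.of_coe T v) hu, ← Finset.sum_neg_distrib,
    Finset.sum_eq_single k (fun i _ hik => by simp [hv, Pi.single_eq_of_ne hik])
      (fun h => absurd (Finset.mem_univ k) h),
    Finset.sum_eq_single k (fun i _ hik => by simp [hv, Pi.single_eq_of_ne hik])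
      (fun h => absurd (Finset.mem_univ k) h)] at h
  rw [hv, Pi.single_eq_same, agrad_centred, real_inner_comm] at h
  rw [inner_neg_left, inner_smul_left, conj_trivial, real_inner_comm, real_inner_comm G]
  have hμk := (hμ k).ne'
  have h2 : μ k * K.weight T k * (volume.real (hull T) * inner ℝ G (agrad (g k))) =
      μ k * K.weight T k * -(inner ℝ G (K.jumpNormal T f)) := by linarith
  have h3 := mul_left_cancel₀ (mul_ne_zero hμk hk) h2
  field_simp
  linarith

theorem Regular.aCell_lifting (R : K.Regular σ L) (hT : T ∈ K.mesh.cells) {μ : Fin 2 → ℝ}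
    (hμ : ∀ i, 0 < μ i) {u v : Fin 2 → Plane → ℝ} {f g : Fin 2 → Plane →ᵃ[ℝ] ℝ}
    (hu : Represents T u f) (hv : Represents T v g) :
    K.aCell μ T (K.lifting μ T u) (K.lifting μ T v) =
      ∑ i, μ i * K.weight T i * inner ℝ (K.jumpNormal T f) (K.jumpNormal T g) /
        volume.real (hull T) := by
  have hV := R.volume_hull_pos hT
  by_cases hcut : K.IsCut T
  · have h1 : K.IsLifting μ T u (K.lifting μ T u) := by
      rw [lifting, if_pos hcut]
      exact Classical.epsilon_spec (R.exists_isLifting hT μ hu)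
    have h2 : K.IsLifting μ T v (K.lifting μ T v) := by
      rw [lifting, if_pos hcut]
      exact Classical.epsilon_spec (R.exists_isLifting hT μ hv)
    choose f' hf' using fun i => (h1.1 i).1
    choose g' hg' using fun i => (h2.1 i).1
    rw [R.aCell_eq hT μ (f := f') (g := g') (fun i y _ => by rw [hf' i]) (fun i y _ => by rw [hg' i])]
    refine Finset.sum_congr rfl fun i _ => ?_
    by_cases hi : K.weight T i = 0
    · simp [hi]
    rw [R.agrad_of_isLifting hT hμ hu h1 hf' i hi, R.agrad_of_isLifting hT hμ hv h2 hg' i hi,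
      inner_neg_neg, inner_smul_left, inner_smul_right, conj_trivial]
    field_simp
  -- If Γ has no length in the triangle, the lifting is 0 by definition, and J vanishes too.
  · have h0 : (μH[1] : Measure Plane).restrict (hull T ∩ K.Γ) = 0 := by
      rw [Measure.restrict_eq_zero]
      exact not_lt.1 hcut |>.antisymm zero_le
    have hz : Represents T (0 : Fin 2 → Plane → ℝ) 0 := fun i y _ => rfl
    rw [lifting, if_neg hcut, lifting, if_neg hcut, R.aCell_eq hT μ hz hz]
    simp [jumpNormal, h0]

/-! ### The local bilinear form -/

theorem Regular.jumpNormal_add (R : K.Regular σ L) (hT : T ∈ K.mesh.cells)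
    (f g : Fin 2 → Plane →ᵃ[ℝ] ℝ) :
    K.jumpNormal T (f + g) = K.jumpNormal T f + K.jumpNormal T g := by
  unfold jumpNormal
  rw [← integral_add (R.integrableOn_smul_normal hT _) (R.integrableOn_smul_normal hT _)]
  congr 1
  ext1 y
  rw [← add_smul]
  congr 1
  simp only [Pi.add_apply, AffineMap.coe_sub, AffineMap.coe_add, Pi.sub_apply]
  ring

theorem jumpNormal_smul (K : CutMesh Ω) (T : Finset Plane) (c : ℝ) (f : Fin 2 → Plane →ᵃ[ℝ] ℝ) :
    K.jumpNormal T (c • f) = c • K.jumpNormal T f := by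
  unfold jumpNormal
  rw [← integral_smul]
  congr 1
  ext1 y
  rw [smul_smul]
  congr 1
  simp only [Pi.smul_apply, AffineMap.coe_sub, AffineMap.coe_smul, Pi.sub_apply, smul_eq_mul]
  ring

/-- The product of the jumps, integrated over the interface in `T`. -/
def jumpProd (K : CutMesh Ω) (T : Finset Plane) (f g : Fin 2 → Plane →ᵃ[ℝ] ℝ) : ℝ :=
  ∫ y in hull T ∩ K.Γ, (f 0 - f 1) y * (g 0 - g 1) y ∂μH[1]

theorem jumpProd_comm (K : CutMesh Ω) (T : Finset Plane) (f g : Fin 2 → Plane →ᵃ[ℝ] ℝ) :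
    K.jumpProd T f g = K.jumpProd T g f := by
  simp only [jumpProd, mul_comm]

theorem jumpProd_smul (K : CutMesh Ω) (T : Finset Plane) (c : ℝ) (f g : Fin 2 → Plane →ᵃ[ℝ] ℝ) :
    K.jumpProd T (c • f) g = c * K.jumpProd T f g := by
  unfold jumpProd
  rw [← integral_const_mul]
  congr 1
  ext1 y
  simp only [Pi.smul_apply, AffineMap.coe_sub, AffineMap.coe_smul, Pi.sub_apply, smul_eq_mul]
  ring

theorem Regular.jumpProd_add (R : K.Regular σ L) (hT : T ∈ K.mesh.cells)
    (f f' g : Fin 2 → Plane →ᵃ[ℝ] ℝ) :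
    K.jumpProd T (f + f') g = K.jumpProd T f g + K.jumpProd T f' g := by
  have hi : ∀ v w : Plane →ᵃ[ℝ] ℝ, IntegrableOn (fun y => v y * w y) (hull T ∩ K.Γ) μH[1] :=
    fun v w => R.integrableOn_continuous hT ((continuous_affine v).mul (continuous_affine w))
  unfold jumpProd
  rw [← integral_add (hi _ _) (hi _ _)]
  congr 1
  ext1 y
  simp only [Pi.add_apply, AffineMap.coe_sub, AffineMap.coe_add, Pi.sub_apply]
  ring

theorem Regular.jumpProd_self (R : K.Regular σ L) (T : Finset Plane)
    (f : Fin 2 → Plane →ᵃ[ℝ] ℝ) : K.jumpProd T f f = K.h * K.ifc T (f 0 - f 1) := by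
  have hh := R.h_pos
  unfold jumpProd ifc
  rw [mul_inv_cancel_left₀ hh.ne']
  simp only [sq]

/-- The contribution of a triangle to the bilinear forms, `s` is the coefficient of the lifting
term. -/
def cellForm (K : CutMesh Ω) (μ : Fin 2 → ℝ) (s lam : ℝ) (T : Finset Plane)
    (f g : Fin 2 → Plane →ᵃ[ℝ] ℝ) : ℝ :=
  ∑ i, μ i * K.weight T i * (volume.real (hull T) * inner ℝ (agrad (f i)) (agrad (g i))
    - inner ℝ (agrad (f i)) (K.jumpNormal T g) - inner ℝ (agrad (g i)) (K.jumpNormal T f)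
    + s * (inner ℝ (K.jumpNormal T f) (K.jumpNormal T g) / volume.real (hull T)))
  + lam / K.h * K.jumpProd T f g

theorem cellForm_comm (K : CutMesh Ω) (μ : Fin 2 → ℝ) (s lam : ℝ) (T : Finset Plane)
    (f g : Fin 2 → Plane →ᵃ[ℝ] ℝ) : K.cellForm μ s lam T f g = K.cellForm μ s lam T g f := by
  unfold cellForm
  rw [jumpProd_comm]
  congr 1
  refine Finset.sum_congr rfl fun i _ => ?_
  rw [real_inner_comm (agrad (f i)) (agrad (g i)),
    real_inner_comm (K.jumpNormal T f) (K.jumpNormal T g)]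
  ring

theorem Regular.cellForm_add (R : K.Regular σ L) (hT : T ∈ K.mesh.cells) (μ : Fin 2 → ℝ)
    (s lam : ℝ) (f f' g : Fin 2 → Plane →ᵃ[ℝ] ℝ) :
    K.cellForm μ s lam T (f + f') g = K.cellForm μ s lam T f g + K.cellForm μ s lam T f' g := by
  unfold cellForm
  simp only [R.jumpNormal_add hT, R.jumpProd_add hT, Pi.add_apply, map_add, inner_add_left,
    inner_add_right, Fin.sum_univ_two]
  ring

theorem cellForm_smul (K : CutMesh Ω) (μ : Fin 2 → ℝ) (s lam : ℝ) (T : Finset Plane) (c : ℝ)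
    (f g : Fin 2 → Plane →ᵃ[ℝ] ℝ) :
    K.cellForm μ s lam T (c • f) g = c * K.cellForm μ s lam T f g := by
  unfold cellForm
  simp only [jumpNormal_smul, jumpProd_smul, Pi.smul_apply, map_smul, inner_smul_left,
    inner_smul_right, Fin.sum_univ_two, conj_trivial]
  ring

theorem Regular.sq_norm_jumpNormal_le (R : K.Regular σ L) (hT : T ∈ K.mesh.cells)
    (f : Fin 2 → Plane →ᵃ[ℝ] ℝ) :
    ‖K.jumpNormal T f‖ ^ 2 ≤ (1 + L) * K.h ^ 2 * K.ifc T (f 0 - f 1) := by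
  have hh := R.h_pos
  have hL := R.L_nonneg
  set w := f 0 - f 1 with hw
  set ν : Measure Plane := (μH[1] : Measure Plane).restrict (hull T ∩ K.Γ) with hν
  have hfin : IsFiniteMeasure ν := ⟨by rw [hν, Measure.restrict_apply_univ]; exact R.measure_interface_lt_top hT⟩
  have hi1 : Integrable (fun y => |w y|) ν :=
    R.integrableOn_continuous hT (continuous_affine w).abs
  have hi2 : Integrable (fun y => w y ^ 2) ν := R.integrableOn_sq hT w
  set J := ∫ y, |w y| ∂ν with hJ
  set I := ∫ y, w y ^ 2 ∂ν with hI
  have h1 : ‖K.jumpNormal T f‖ ≤ J := by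
    refine norm_integral_le_of_norm_le hi1 (Filter.Eventually.of_forall fun y => ?_)
    rw [norm_smul]
    exact mul_le_of_le_one_right (norm_nonneg _) (norm_normal_le y)
  -- The Cauchy-Schwarz inequality, as the sign of the discriminant of the integral of (t - |w|)².
  have hq : ∀ t : ℝ, 0 ≤ ν.real Set.univ * (t * t) + (-2 * J) * t + I := by
    intro t
    have h : 0 ≤ ∫ y, (t - |w y|) ^ 2 ∂ν := integral_nonneg fun _ => sq_nonneg _
    have e : ∀ y, (t - |w y|) ^ 2 = (t ^ 2 + (-2 * t) * |w y|) + w y ^ 2 := fun y => by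
      rw [sub_sq, sq_abs]
      ring
    simp only [e] at h
    have hi3 : Integrable (fun y => t ^ 2 + (-2 * t) * |w y|) ν :=
      (integrable_const _).add (hi1.const_mul _)
    rw [integral_add hi3 hi2, integral_add (integrable_const _) (hi1.const_mul _), integral_const_mul, integral_const,
      smul_eq_mul] at h
    linarith
  have hd := discrim_le_zero hq
  rw [discrim] at hd
  have hm : ν.real Set.univ ≤ (1 + L) * K.h := by
    rw [measureReal_def, hν, Measure.restrict_apply_univ,
      ← ENNReal.toReal_ofReal (by positivity : 0 ≤ (1 + L) * K.h)]
    exact ENNReal.toReal_mono ENNReal.ofReal_ne_top (R.measure_interface_le hT)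
  have hI0 : 0 ≤ I := integral_nonneg fun _ => sq_nonneg _
  have hIe : I = K.h * K.ifc T w := by
    unfold ifc
    rw [mul_inv_cancel_left₀ hh.ne']
  have h2 : ‖K.jumpNormal T f‖ ^ 2 ≤ J ^ 2 := pow_le_pow_left₀ (norm_nonneg _) h1 2
  have h3 : ν.real Set.univ * I ≤ (1 + L) * K.h * I := mul_le_mul_of_nonneg_right hm hI0
  calc _ ≤ (1 + L) * K.h * I := by nlinarith
    _ = _ := by rw [hIe]; ring

/-- The factor in the inverse estimate for the flux. -/
def fluxConst (μ : Fin 2 → ℝ) (σ L : ℝ) : ℝ := (μ 0 + μ 1) * (1 + L) / σ ^ 2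

/-- Only the length of Γ in the triangle and the area of the whole triangle enter; of the weights
only that they are at most 1. -/
theorem Regular.sum_flux_le (R : K.Regular σ L) (hT : T ∈ K.mesh.cells) {μ : Fin 2 → ℝ}
    (hμ : ∀ i, 0 < μ i) (f : Fin 2 → Plane →ᵃ[ℝ] ℝ) :
    ∑ i, μ i * K.weight T i * (‖K.jumpNormal T f‖ ^ 2 / volume.real (hull T)) ≤
      fluxConst μ σ L * K.ifc T (f 0 - f 1) := by
  have hh := R.h_pos
  have hσ := R.σ_pos
  have hL := R.L_nonneg
  have hV := R.volume_hull_pos hT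
  have hI := R.ifc_nonneg T (f 0 - f 1)
  have h1 : ‖K.jumpNormal T f‖ ^ 2 / volume.real (hull T) ≤
      (1 + L) / σ ^ 2 * K.ifc T (f 0 - f 1) := by
    rw [div_le_iff₀ hV]
    have h2 := R.volume_hull_ge hT
    calc _ ≤ _ := R.sq_norm_jumpNormal_le hT f
      _ = (1 + L) / σ ^ 2 * K.ifc T (f 0 - f 1) * (σ * K.h) ^ 2 := by field_simp
      _ ≤ _ := by gcongr
  have h2 : ∀ i, μ i * K.weight T i * (‖K.jumpNormal T f‖ ^ 2 / volume.real (hull T)) ≤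
      μ i * ((1 + L) / σ ^ 2 * K.ifc T (f 0 - f 1)) := fun i => by
    have h3 := R.weight_le_one hT i
    have h4 := hμ i
    have h5 := K.weight_nonneg T i
    calc _ ≤ μ i * 1 * ((1 + L) / σ ^ 2 * K.ifc T (f 0 - f 1)) := by gcongr
      _ = _ := by ring
  rw [Fin.sum_univ_two]
  calc _ ≤ _ := add_le_add (h2 0) (h2 1)
    _ = _ := by rw [fluxConst]; ring

theorem two_inner_le {a V : ℝ} (ha : 0 < a) (hV : 0 < V) (x y : Plane) :
    2 * |inner ℝ x y| ≤ a * (V * ‖x‖ ^ 2) + a⁻¹ * (‖y‖ ^ 2 / V) := by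
  have h1 := abs_real_inner_le_norm x y
  have h2 : 0 ≤ (a * V * ‖x‖ - ‖y‖) ^ 2 / (a * V) := by positivity
  have h3 : (a * V * ‖x‖ - ‖y‖) ^ 2 / (a * V) =
      a * (V * ‖x‖ ^ 2) + a⁻¹ * (‖y‖ ^ 2 / V) - 2 * (‖x‖ * ‖y‖) := by
    field_simp
    ring
  linarith

/-- Young's inequality with parameter `a` trades the flux terms for the share `a` of the gradient
terms and a multiple `a⁻¹` of Σ μ_i κ_i |J|²/|T|. The lifting pays the multiple `s` of it, the
penalty the rest. With `a = 1 / 2` and `s = 2` nothing is left to pay. -/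
theorem Regular.cellForm_ge (R : K.Regular σ L) (hT : T ∈ K.mesh.cells) {μ : Fin 2 → ℝ}
    (hμ : ∀ i, 0 < μ i) {s lam a : ℝ} (ha : 0 < a)
    (hlam : 1 + (a⁻¹ - s) * fluxConst μ σ L ≤ lam) (has : s ≤ a⁻¹)
    (f : Fin 2 → Plane →ᵃ[ℝ] ℝ) :
    (1 - a) * ∑ i, μ i * K.weight T i * (volume.real (hull T) * ‖agrad (f i)‖ ^ 2) +
      K.ifc T (f 0 - f 1) ≤ K.cellForm μ s lam T f f := by
  have hh := R.h_pos
  have hV := R.volume_hull_pos hT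
  have hI := R.ifc_nonneg T (f 0 - f 1)
  have hF := R.sum_flux_le hT hμ f
  have h1 : ∀ i, (1 - a) * (μ i * K.weight T i * (volume.real (hull T) * ‖agrad (f i)‖ ^ 2)) -
      (a⁻¹ - s) * (μ i * K.weight T i * (‖K.jumpNormal T f‖ ^ 2 / volume.real (hull T))) ≤
      μ i * K.weight T i * (volume.real (hull T) * inner ℝ (agrad (f i)) (agrad (f i))
        - inner ℝ (agrad (f i)) (K.jumpNormal T f) - inner ℝ (agrad (f i)) (K.jumpNormal T f)
        + s * (inner ℝ (K.jumpNormal T f) (K.jumpNormal T f) / volume.real (hull T))) := by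
    intro i
    have h2 := two_inner_le ha hV (agrad (f i)) (K.jumpNormal T f)
    have h3 := le_abs_self (inner ℝ (agrad (f i)) (K.jumpNormal T f))
    rw [real_inner_self_eq_norm_sq, real_inner_self_eq_norm_sq]
    have h4 : 0 ≤ μ i * K.weight T i := mul_nonneg (hμ i).le (K.weight_nonneg T i)
    have h5 : (1 - a) * (volume.real (hull T) * ‖agrad (f i)‖ ^ 2) -
      (a⁻¹ - s) * (‖K.jumpNormal T f‖ ^ 2 / volume.real (hull T)) ≤
      volume.real (hull T) * ‖agrad (f i)‖ ^ 2
        - inner ℝ (agrad (f i)) (K.jumpNormal T f) - inner ℝ (agrad (f i)) (K.jumpNormal T f)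
        + s * (‖K.jumpNormal T f‖ ^ 2 / volume.real (hull T)) := by linarith
    calc _ = μ i * K.weight T i * ((1 - a) * (volume.real (hull T) * ‖agrad (f i)‖ ^ 2) -
      (a⁻¹ - s) * (‖K.jumpNormal T f‖ ^ 2 / volume.real (hull T))) := by ring
      _ ≤ _ := mul_le_mul_of_nonneg_left h5 h4
  have h2 := Finset.sum_le_sum fun i (_ : i ∈ Finset.univ) => h1 i
  rw [Finset.sum_sub_distrib, ← Finset.mul_sum, ← Finset.mul_sum] at h2
  have h3 : lam / K.h * K.jumpProd T f f = lam * K.ifc T (f 0 - f 1) := by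
    rw [R.jumpProd_self]
    field_simp
  unfold cellForm
  rw [h3]
  have h4 : (a⁻¹ - s) * ∑ i, μ i * K.weight T i * (‖K.jumpNormal T f‖ ^ 2 / volume.real (hull T)) ≤
      (a⁻¹ - s) * (fluxConst μ σ L * K.ifc T (f 0 - f 1)) :=
    mul_le_mul_of_nonneg_left hF (by linarith)
  have h5 := mul_le_mul_of_nonneg_right hlam hI
  linarith

theorem Regular.le_cellForm (R : K.Regular σ L) (hT : T ∈ K.mesh.cells) {μ : Fin 2 → ℝ}
    (hμ : ∀ i, 0 < μ i) {s lam a : ℝ} (ha : 0 < a) (ha1 : a ≤ 1)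
    (hlam : 1 + (a⁻¹ - s) * fluxConst μ σ L ≤ lam) (has : s ≤ a⁻¹)
    (f : Fin 2 → Plane →ᵃ[ℝ] ℝ) :
    min 1 ((1 - a) * min (μ 0) (μ 1) * σ ^ 2) * K.energy T f ≤ K.cellForm μ s lam T f f := by
  have hh := R.h_pos
  have hI := R.ifc_nonneg T (f 0 - f 1)
  have h0 := R.cellForm_ge hT hμ ha hlam has f
  have hVg := R.volume_hull_ge hT
  have hw : ∀ i, 0 ≤ K.weight T i * (K.h ^ 2 * ‖agrad (f i)‖ ^ 2) := fun i =>
    mul_nonneg (K.weight_nonneg T i) (by positivity)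
  have hmin : ∀ i, min (μ 0) (μ 1) ≤ μ i := fun i => by
    fin_cases i
    exacts [min_le_left _ _, min_le_right _ _]
  have hmin0 : 0 < min (μ 0) (μ 1) := lt_min (hμ 0) (hμ 1)
  have h1 : ∀ i, (min (μ 0) (μ 1) * σ ^ 2) * (K.weight T i * (K.h ^ 2 * ‖agrad (f i)‖ ^ 2)) ≤
      μ i * K.weight T i * (volume.real (hull T) * ‖agrad (f i)‖ ^ 2) := fun i => by
    have h4 := K.weight_nonneg T i
    have h5 := hmin i
    have h6 : 0 ≤ μ i * K.weight T i := mul_nonneg (hμ i).le h4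
    calc _ = min (μ 0) (μ 1) * K.weight T i * ((σ * K.h) ^ 2 * ‖agrad (f i)‖ ^ 2) := by ring
      _ ≤ _ := by gcongr
  have h2 := Finset.sum_le_sum fun i (_ : i ∈ Finset.univ) => h1 i
  rw [← Finset.mul_sum] at h2
  have hS : 0 ≤ ∑ i, K.weight T i * (K.h ^ 2 * ‖agrad (f i)‖ ^ 2) :=
    Finset.sum_nonneg fun i _ => hw i
  have h3 := mul_le_mul_of_nonneg_left h2 (by linarith : 0 ≤ 1 - a)
  have m1 := mul_le_mul_of_nonneg_right
    (min_le_right 1 ((1 - a) * min (μ 0) (μ 1) * σ ^ 2)) hS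
  have m2 := mul_le_mul_of_nonneg_right
    (min_le_left 1 ((1 - a) * min (μ 0) (μ 1) * σ ^ 2)) hI
  unfold energy
  rw [mul_add]
  linarith

theorem Regular.cellForm_le (R : K.Regular σ L) (hT : T ∈ K.mesh.cells) {μ : Fin 2 → ℝ}
    (hμ : ∀ i, 0 < μ i) {s lam : ℝ} (hs : 0 ≤ s) (hlam : 0 ≤ lam)
    (f : Fin 2 → Plane →ᵃ[ℝ] ℝ) :
    K.cellForm μ s lam T f f ≤
      (8 * (μ 0 + μ 1) + (1 + s) * fluxConst μ σ L + lam) * K.energy T f := by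
  have hh := R.h_pos
  have hσ := R.σ_pos
  have hL := R.L_nonneg
  have hV := R.volume_hull_pos hT
  have hVl := R.volume_hull_le hT
  have hI := R.ifc_nonneg T (f 0 - f 1)
  have hF := R.sum_flux_le hT hμ f
  have hμs : ∀ i, μ i ≤ μ 0 + μ 1 := fun i => by
    have := hμ 0
    have := hμ 1
    fin_cases i
    · change μ 0 ≤ _; linarith
    · change μ 1 ≤ _; linarith
  have hμ0 : 0 ≤ μ 0 + μ 1 := (hμ 0).le.trans (hμs 0)
  have hf0 : 0 ≤ fluxConst μ σ L := by
    unfold fluxConst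
    positivity
  have h1 : ∀ i, μ i * K.weight T i * (volume.real (hull T) * inner ℝ (agrad (f i)) (agrad (f i))
        - inner ℝ (agrad (f i)) (K.jumpNormal T f) - inner ℝ (agrad (f i)) (K.jumpNormal T f)
        + s * (inner ℝ (K.jumpNormal T f) (K.jumpNormal T f) / volume.real (hull T))) ≤
      8 * (μ 0 + μ 1) * (K.weight T i * (K.h ^ 2 * ‖agrad (f i)‖ ^ 2)) +
      (1 + s) * (μ i * K.weight T i * (‖K.jumpNormal T f‖ ^ 2 / volume.real (hull T))) := by
    intro i
    have h2 := two_inner_le one_pos hV (agrad (f i)) (K.jumpNormal T f)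
    have h3 := neg_abs_le (inner ℝ (agrad (f i)) (K.jumpNormal T f))
    rw [real_inner_self_eq_norm_sq, real_inner_self_eq_norm_sq]
    have h6 := K.weight_nonneg T i
    have h4 : 0 ≤ μ i * K.weight T i := mul_nonneg (hμ i).le h6
    have h5 : volume.real (hull T) * ‖agrad (f i)‖ ^ 2
        - inner ℝ (agrad (f i)) (K.jumpNormal T f) - inner ℝ (agrad (f i)) (K.jumpNormal T f)
        + s * (‖K.jumpNormal T f‖ ^ 2 / volume.real (hull T)) ≤
        2 * (volume.real (hull T) * ‖agrad (f i)‖ ^ 2) +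
          (1 + s) * (‖K.jumpNormal T f‖ ^ 2 / volume.real (hull T)) := by
      rw [inv_one] at h2
      linarith
    have h7 : μ i * K.weight T i * (2 * (volume.real (hull T) * ‖agrad (f i)‖ ^ 2)) ≤
        8 * (μ 0 + μ 1) * (K.weight T i * (K.h ^ 2 * ‖agrad (f i)‖ ^ 2)) := by
      have := hμs i
      calc _ ≤ (μ 0 + μ 1) * K.weight T i * (2 * (4 * K.h ^ 2 * ‖agrad (f i)‖ ^ 2)) := by gcongr
        _ = _ := by ring
    have h8 := mul_le_mul_of_nonneg_left h5 h4
    rw [mul_add (μ i * K.weight T i)] at h8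
    linarith
  have h2 := Finset.sum_le_sum fun i (_ : i ∈ Finset.univ) => h1 i
  rw [Finset.sum_add_distrib, ← Finset.mul_sum, ← Finset.mul_sum] at h2
  have h3 : lam / K.h * K.jumpProd T f f = lam * K.ifc T (f 0 - f 1) := by
    rw [R.jumpProd_self]
    field_simp
  have hS : 0 ≤ ∑ i, K.weight T i * (K.h ^ 2 * ‖agrad (f i)‖ ^ 2) :=
    Finset.sum_nonneg fun i _ => mul_nonneg (K.weight_nonneg T i) (by positivity)
  have h4 := mul_le_mul_of_nonneg_left hF (by linarith : 0 ≤ 1 + s)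
  have h5 : 0 ≤ ((1 + s) * fluxConst μ σ L + lam) *
      ∑ i, K.weight T i * (K.h ^ 2 * ‖agrad (f i)‖ ^ 2) := by positivity
  have h6 : 0 ≤ 8 * (μ 0 + μ 1) * K.ifc T (f 0 - f 1) := by positivity
  unfold cellForm energy
  rw [h3]
  linarith

theorem Regular.cell_nitsche (R : K.Regular σ L) (hT : T ∈ K.mesh.cells) (μ : Fin 2 → ℝ)
    (lam : ℝ) {u v : Fin 2 → Plane → ℝ} {f g : Fin 2 → Plane →ᵃ[ℝ] ℝ} (hu : Represents T u f)
    (hv : Represents T v g) :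
    K.aCell μ T u v + K.ncCell μ T u v + K.ncCell μ T v u + K.nsCell lam T u v =
      K.cellForm μ 0 lam T f g := by
  rw [R.aCell_eq hT μ hu hv, R.ncCell_eq hT μ hu hv, R.ncCell_eq hT μ hv hu, nsCell_eq lam hu hv]
  simp only [cellForm, jumpProd, Fin.sum_univ_two]
  ring

theorem Regular.cell_paramFree (R : K.Regular σ L) (hT : T ∈ K.mesh.cells) {μ : Fin 2 → ℝ}
    (hμ : ∀ i, 0 < μ i) {u v : Fin 2 → Plane → ℝ} {f g : Fin 2 → Plane →ᵃ[ℝ] ℝ}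
    (hu : Represents T u f) (hv : Represents T v g) :
    K.aCell μ T u v + K.ncCell μ T u v + K.ncCell μ T v u
      + 2 * K.aCell μ T (K.lifting μ T u) (K.lifting μ T v) + K.nsCell 1 T u v =
      K.cellForm μ 2 1 T f g := by
  rw [R.aCell_eq hT μ hu hv, R.ncCell_eq hT μ hu hv, R.ncCell_eq hT μ hv hu, nsCell_eq 1 hu hv,
    R.aCell_lifting hT hμ hu hv]
  simp only [cellForm, jumpProd, Fin.sum_univ_two]
  ring

/-! ### The energy as a quadratic form -/

theorem energy_smul (K : CutMesh Ω) (T : Finset Plane) (c : ℝ) (f : Fin 2 → Plane →ᵃ[ℝ] ℝ) :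
    K.energy T (c • f) = c ^ 2 * K.energy T f := by
  unfold energy
  rw [Pi.smul_apply, Pi.smul_apply, ← smul_sub, ifc_smul, mul_add, Finset.mul_sum]
  congr 1
  refine Finset.sum_congr rfl fun i _ => ?_
  rw [Pi.smul_apply, map_smul, norm_smul, mul_pow, Real.norm_eq_abs, sq_abs]
  ring

theorem energy_zero (K : CutMesh Ω) (T : Finset Plane) : K.energy T 0 = 0 := by
  have := energy_smul K T 0 0
  simpa using this

theorem sum_affine_apply {ι : Type*} (s : Finset ι) (w : ι → Plane →ᵃ[ℝ] ℝ) (y : Plane) :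
    (∑ r ∈ s, w r) y = ∑ r ∈ s, w r y := by
  classical
  induction s using Finset.induction_on with
  | empty => simp
  | insert a s ha ih => rw [Finset.sum_insert ha, Finset.sum_insert ha, AffineMap.coe_add,
      Pi.add_apply, ih]

theorem Regular.ifc_sum_le (R : K.Regular σ L) (hT : T ∈ K.mesh.cells) {ι : Type*} (s : Finset ι)
    (w : ι → Plane →ᵃ[ℝ] ℝ) : K.ifc T (∑ r ∈ s, w r) ≤ s.card * ∑ r ∈ s, K.ifc T (w r) := by
  have h1 : ∫ y in hull T ∩ K.Γ, (∑ r ∈ s, w r) y ^ 2 ∂μH[1] ≤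
      ∫ y in hull T ∩ K.Γ, (s.card : ℝ) * ∑ r ∈ s, w r y ^ 2 ∂μH[1] := by
    refine integral_mono (R.integrableOn_sq hT _)
      ((integrable_finsetSum _ fun r _ => R.integrableOn_sq hT (w r)).const_mul _) fun y => ?_
    simp only [sum_affine_apply]
    exact sq_sum_le_card_mul_sum_sq
  rw [integral_const_mul, integral_finsetSum _ fun r _ => R.integrableOn_sq hT (w r)] at h1
  have := mul_le_mul_of_nonneg_left h1 (inv_nonneg.2 R.h_pos.le)
  unfold ifc
  rw [← Finset.mul_sum]
  linarith

theorem Regular.energy_sum_le (R : K.Regular σ L) (hT : T ∈ K.mesh.cells) {ι : Type*}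
    (s : Finset ι) (f : ι → Fin 2 → Plane →ᵃ[ℝ] ℝ) :
    K.energy T (∑ r ∈ s, f r) ≤ s.card * ∑ r ∈ s, K.energy T (f r) := by
  have h1 : ∀ i, K.weight T i * (K.h ^ 2 * ‖agrad ((∑ r ∈ s, f r) i)‖ ^ 2) ≤
      s.card * ∑ r ∈ s, K.weight T i * (K.h ^ 2 * ‖agrad (f r i)‖ ^ 2) := by
    intro i
    rw [Finset.sum_apply, map_sum, ← Finset.mul_sum, ← Finset.mul_sum]
    have h2 : ‖∑ r ∈ s, agrad (f r i)‖ ^ 2 ≤ s.card * ∑ r ∈ s, ‖agrad (f r i)‖ ^ 2 :=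
      (pow_le_pow_left₀ (norm_nonneg _) (norm_sum_le _ _) 2).trans sq_sum_le_card_mul_sum_sq
    have := K.weight_nonneg T i
    calc _ ≤ K.weight T i * (K.h ^ 2 * (s.card * ∑ r ∈ s, ‖agrad (f r i)‖ ^ 2)) := by gcongr
      _ = _ := by ring
  have h2 : K.ifc T ((∑ r ∈ s, f r) 0 - (∑ r ∈ s, f r) 1) ≤
      s.card * ∑ r ∈ s, K.ifc T (f r 0 - f r 1) := by
    rw [Finset.sum_apply, Finset.sum_apply, ← Finset.sum_sub_distrib]
    exact R.ifc_sum_le hT s _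
  unfold energy
  rw [Finset.sum_add_distrib, mul_add]
  refine add_le_add ?_ h2
  rw [Finset.sum_comm, Finset.mul_sum]
  exact Finset.sum_le_sum fun i _ => h1 i

theorem Regular.energy_sub_le (R : K.Regular σ L) (hT : T ∈ K.mesh.cells)
    (f g : Fin 2 → Plane →ᵃ[ℝ] ℝ) :
    K.energy T (f - g) ≤ 2 * K.energy T f + 2 * K.energy T g := by
  have hn := energy_smul K T (-1) g
  have h := R.energy_sum_le hT Finset.univ ![f, (-1 : ℝ) • g]
  simp only [Fin.sum_univ_two, Matrix.cons_val_zero, Matrix.cons_val_one,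
    Finset.card_univ, Fintype.card_fin, neg_one_smul, ← sub_eq_add_neg] at h hn
  push_cast at h
  linarith

/-! ### The basis functions on one triangle -/

open Classical in
/-- The barycentric coordinate of `x` on `T`, zero if `T` is not in the triangulation. -/
def cellBary (K : CutMesh Ω) (T : Finset Plane) (x : Plane) : Plane →ᵃ[ℝ] ℝ :=
  if hT : T ∈ K.mesh.cells then bary hT x else 0

theorem cellBary_eq (hT : T ∈ K.mesh.cells) (x : Plane) : K.cellBary T x = bary hT x := dif_pos hT

theorem cellBary_of_notMem {x : Plane} (hx : x ∉ T) : K.cellBary T x = 0 := by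
  unfold cellBary
  split_ifs with h
  · rw [bary, dif_neg hx]
  · rfl

/-- The vertex that belongs to an index. -/
def vert (K : CutMesh Ω) : K.LocalIndex → Plane := Sum.elim (fun x => x.1) (fun x => x.1)

open Classical in
/-- The basis functions on the triangle `T`. -/
def basisPair (K : CutMesh Ω) (T : Finset Plane) : K.LocalIndex → Fin 2 → Plane →ᵃ[ℝ] ℝ
  | .inl x => fun _ => K.cellBary T x
  | .inr x => fun i => if (x : Plane) ∈ K.sub i then 0 else K.cellBary T x

theorem basisPair_of_notMem {r : K.LocalIndex} (hr : K.vert r ∉ T) : K.basisPair T r = 0 := by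
  rcases r with x | x
  · ext1 i
    exact cellBary_of_notMem hr
  · ext1 i
    simp only [basisPair]
    split_ifs
    · rfl
    · exact cellBary_of_notMem hr

theorem Regular.represents_basis (R : K.Regular σ L) (hT : T ∈ K.mesh.cells) (r : K.LocalIndex) :
    Represents T (K.xfemBasis (K.localToGlobal r)) (K.basisPair T r) := by
  rcases r with x | x
  · intro i
    have := nodal_eqOn R.reg hT (mem_of_mem_interfaceVertices x.2)
    simpa [localToGlobal, xfemBasis, basisPair, cellBary_eq hT] using this
  · intro i
    have := nodal_eqOn R.reg hT (mem_of_mem_interfaceVertices x.2)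
    by_cases hx : (x : Plane) ∈ K.sub i
    · intro y _
      simp [localToGlobal, xfemBasis, basisPair, hx]
    · simpa [localToGlobal, xfemBasis, basisPair, cellBary_eq hT, hx] using this

/-- The pair of functions with the given coefficients on the triangle `T`. -/
def pairOf (K : CutMesh Ω) (T : Finset Plane) (v : K.LocalIndex → ℝ) : Fin 2 → Plane →ᵃ[ℝ] ℝ :=
  ∑ r, v r • K.basisPair T r

theorem pairOf_sub (K : CutMesh Ω) (T : Finset Plane) (v w : K.LocalIndex → ℝ) :
    K.pairOf T (v - w) = K.pairOf T v - K.pairOf T w := by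
  simp only [pairOf, Pi.sub_apply, sub_smul, Finset.sum_sub_distrib]

open Classical in
/-- The extension by zero of values at the interface vertices. -/
def extendZero (K : CutMesh Ω) (a : {x // x ∈ K.interfaceVertices} → ℝ) (w : Plane) : ℝ :=
  if h : w ∈ K.interfaceVertices then a ⟨w, h⟩ else 0

theorem extendZero_coe (a : {x // x ∈ K.interfaceVertices} → ℝ) (x : {x // x ∈ K.interfaceVertices}) :
    K.extendZero a x = a x := dif_pos x.2

theorem extendZero_of_notMem (a : {x // x ∈ K.interfaceVertices} → ℝ) {w : Plane}
    (h : w ∉ K.interfaceVertices) : K.extendZero a w = 0 := dif_neg h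

open Classical in
theorem pairOf_apply (hT : T ∈ K.mesh.cells) (v : K.LocalIndex → ℝ) (i : Fin 2) {w : Plane}
    (hw : w ∈ T) : K.pairOf T v i w = K.extendZero (fun x => v (.inl x)) w +
      if w ∈ K.sub i then 0 else K.extendZero (fun x => v (.inr x)) w := by
  have h0 : K.pairOf T v i w = ∑ r, v r * K.basisPair T r i w := by
    rw [pairOf, Finset.sum_apply, sum_affine_apply]
    rfl
  have key : ∀ (c : {x // x ∈ K.interfaceVertices} → ℝ),
      ∑ x, c x * (if w = (x : Plane) then (1 : ℝ) else 0) = K.extendZero c w := by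
    intro c
    by_cases h : w ∈ K.interfaceVertices
    · rw [Finset.sum_eq_single ⟨w, h⟩]
      · rw [if_pos rfl, mul_one, extendZero, dif_pos h]
      · intro x _ hx
        rw [if_neg (fun e => hx (Subtype.ext e.symm)), mul_zero]
      · exact fun h => absurd (Finset.mem_univ _) h
    · rw [extendZero_of_notMem c h]
      refine Finset.sum_eq_zero fun x _ => ?_
      rw [if_neg (fun e => h (by rw [e]; exact x.2)), mul_zero]
  rw [h0, Fintype.sum_sum_type]
  congr 1
  · rw [← key]
    refine Finset.sum_congr rfl fun x _ => ?_
    simp only [basisPair, cellBary_eq hT, bary_vertex hT _ hw]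
  · have h1 : ∀ x : {x // x ∈ K.interfaceVertices}, v (.inr x) * K.basisPair T (.inr x) i w =
        if w ∈ K.sub i then 0 else v (.inr x) * (if w = (x : Plane) then (1 : ℝ) else 0) := by
      intro x
      by_cases hwx : w = x
      · simp only [basisPair, if_pos hwx]
        rw [← hwx]
        split_ifs with h2
        · simp
        · rw [cellBary_eq hT, bary_vertex hT _ hw, if_pos rfl]
      · simp only [basisPair, if_neg hwx, mul_zero, ite_self]
        split_ifs with h2
        · simp
        · rw [cellBary_eq hT, bary_vertex hT _ hw, if_neg hwx, mul_zero]
    rw [Finset.sum_congr rfl fun x _ => h1 x]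
    split_ifs
    · exact Finset.sum_const_zero
    · exact key _

theorem pairOf_apply_of_notMem (hT : T ∈ K.mesh.cells) (v : K.LocalIndex → ℝ) (i : Fin 2)
    {w : Plane} (hw : w ∈ T) (hΩ : w ∉ Ω) : K.pairOf T v i w = 0 := by
  have h : w ∉ K.interfaceVertices := fun h => hΩ (mem_of_mem_interfaceVertices h)
  rw [pairOf_apply hT v i hw, extendZero_of_notMem _ h, extendZero_of_notMem _ h, ite_self, add_zero]

/-- The cut function of a vertex vanishes on the side of this vertex, so there the pair takes the
nodal coefficient as its value. -/
theorem compatible_pairOf (hT : T ∈ K.mesh.cells) (v : K.LocalIndex → ℝ) :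
    K.Compatible T (K.extendZero fun x => v (.inl x)) (K.pairOf T v) where
  eq_of_mem w hw i hi := by rw [pairOf_apply hT v i hw, if_pos hi, add_zero]
  eq_zero w _ hΩ := extendZero_of_notMem _ fun h => hΩ (mem_of_mem_interfaceVertices h)
  eq_zero' w hw hΩ i := pairOf_apply_of_notMem hT v i hw hΩ

/-! ### Energies of the basis functions -/

/-- The energy of a basis function. -/
def basisEnergy (K : CutMesh Ω) (r : K.LocalIndex) : ℝ :=
  ∑ T ∈ K.mesh.cells, K.energy T (K.basisPair T r)

theorem Regular.energy_const_pair (R : K.Regular σ L) (hT : T ∈ K.mesh.cells)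
    (g : Plane →ᵃ[ℝ] ℝ) : K.energy T (fun _ => g) = K.h ^ 2 * ‖agrad g‖ ^ 2 := by
  have h := R.weight_add hT
  have h0 : K.ifc T (g - g) = 0 := by simp [ifc]
  unfold energy
  rw [Fin.sum_univ_two, h0, add_zero, ← add_mul, h, one_mul]

/-- Nodal functions have no jump, h²|∇φ|² is at most σ⁻² on each triangle, and a vertex belongs to
at most 4/σ² triangles. -/
theorem Regular.basisEnergy_inl_le (R : K.Regular σ L) (x : {x // x ∈ K.interfaceVertices}) :
    K.basisEnergy (.inl x) ≤ 4 / σ ^ 4 := by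
  classical
  have hh := R.h_pos
  have hσ := R.σ_pos
  have h1 : ∀ T ∈ K.star x, K.energy T (K.basisPair T (.inl x)) ≤ (σ ^ 2)⁻¹ := by
    intro T hT
    obtain ⟨hT, -⟩ := mem_star.1 hT
    have h2 : K.basisPair T (.inl x) = fun _ => bary hT x := by
      ext1 i
      simp only [basisPair, cellBary_eq hT]
    rw [h2, R.energy_const_pair hT]
    calc _ ≤ K.h ^ 2 * (1 / (σ * K.h)) ^ 2 := by
          have := R.norm_agrad_bary_le hT (x : Plane)
          gcongr
      _ = (σ ^ 2)⁻¹ := by field_simp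
  have h2 : K.basisEnergy (.inl x) = ∑ T ∈ K.star x, K.energy T (K.basisPair T (.inl x)) := by
    unfold basisEnergy star
    rw [Finset.sum_filter]
    refine Finset.sum_congr rfl fun T _ => ?_
    split_ifs with h
    · rfl
    · rw [basisPair_of_notMem (r := .inl x) h, energy_zero]
  rw [h2]
  refine (Finset.sum_le_sum h1).trans ?_
  rw [Finset.sum_const, nsmul_eq_mul]
  calc _ ≤ 4 / σ ^ 2 * (σ ^ 2)⁻¹ := by
        have := R.card_star_le (x : Plane)
        gcongr
    _ = _ := by field_simp

theorem agrad_bary_ne_zero (hT : T ∈ K.mesh.cells) {x : Plane} (hx : x ∈ T) :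
    agrad (bary hT x) ≠ 0 := by
  intro h
  obtain ⟨y, hy, hne⟩ := exists_ne_mem hT x
  have := apply_sub_apply (bary hT x) x y
  rw [h, inner_zero_left, bary_self hT hx, bary_of_ne hT hy hne] at this
  norm_num at this

/-- A triangle is the closure of its interior, so an open subdomain that touches it also contains an
open piece of its interior. -/
theorem Regular.weight_pos (R : K.Regular σ L) (hT : T ∈ K.mesh.cells) {k : Fin 2}
    (h : (hull T ∩ K.sub k).Nonempty) : 0 < K.weight T k := by
  obtain ⟨y, hy, hyk⟩ := h
  have hint : (interior (hull T)).Nonempty := by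
    obtain ⟨z, hz⟩ := R.disc T hT
    exact ⟨z, mem_interior_iff_mem_nhds.2
      (Filter.mem_of_superset (Metric.closedBall_mem_nhds z (mul_pos R.σ_pos R.h_pos)) hz)⟩
  have hcl : y ∈ closure (interior (hull T)) := by
    rw [(convex_hull T).closure_interior_eq_closure_of_nonempty_interior hint]
    exact subset_closure hy
  have ho := K.isInterface.isOpen k
  obtain ⟨w, hwk, hwi⟩ := mem_closure_iff.1 hcl _ ho hyk
  have hpos : 0 < volume (hull T ∩ K.sub k) :=
    ((isOpen_interior.inter ho).measure_pos volume ⟨w, hwi, hwk⟩).trans_le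
      (measure_mono (Set.inter_subset_inter_left _ interior_subset))
  exact div_pos (ENNReal.toReal_pos hpos.ne' (volume_hull_inter_ne_top _ _)) (R.volume_hull_pos hT)

theorem Regular.basisEnergy_pos (R : K.Regular σ L) (r : K.LocalIndex) : 0 < K.basisEnergy r := by
  classical
  have hh := R.h_pos
  suffices h : ∃ T ∈ K.mesh.cells, 0 < K.energy T (K.basisPair T r) by
    obtain ⟨T, hT, h⟩ := h
    exact h.trans_le (Finset.single_le_sum (f := fun T => K.energy T (K.basisPair T r))
      (fun T _ => R.energy_nonneg T _) hT)
  rcases r with x | x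
  · obtain ⟨hx, -⟩ := mem_interfaceVertices.1 x.2
    obtain ⟨T, hT, hxT⟩ := exists_cell_of_mem_vertices hx
    refine ⟨T, hT, ?_⟩
    have h2 : K.basisPair T (.inl x) = fun _ => bary hT x := by
      ext1 i
      simp only [basisPair, cellBary_eq hT]
    rw [h2, R.energy_const_pair hT]
    have := norm_pos_iff.2 (agrad_bary_ne_zero hT hxT)
    positivity
  · obtain ⟨-, i, j, hij, hi, T, hT, hxT, hne⟩ := mem_interfaceVertices.1 x.2
    refine ⟨T, hT, lt_of_lt_of_le ?_ (R.weight_grad_le T _ j)⟩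
    have hxj : (x : Plane) ∉ K.sub j := fun h => Set.disjoint_left.1 (sub_disjoint K hij) hi h
    have h2 : K.basisPair T (.inr x) j = bary hT x := by
      simp only [basisPair, if_neg hxj, cellBary_eq hT]
    rw [h2]
    have h3 := norm_pos_iff.2 (agrad_bary_ne_zero hT hxT)
    have h4 := R.weight_pos hT hne
    positivity

/-! ### Stability of the basis -/

theorem card_index_le (hT : T ∈ K.mesh.cells) [DecidablePred fun r : K.LocalIndex => K.vert r ∈ T] :
    (Finset.univ.filter fun r : K.LocalIndex => K.vert r ∈ T).card ≤ 6 := by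
  classical
  have h : (Finset.univ.filter fun r : K.LocalIndex => K.vert r ∈ T).card ≤ (T.disjSum T).card := by
    refine Finset.card_le_card_of_injOn (Sum.map (fun x => x.1) (fun x => x.1)) ?_ ?_
    · rintro (x | x) hx
      · have := (Finset.mem_filter.1 hx).2
        exact Finset.inl_mem_disjSum.2 this
      · have := (Finset.mem_filter.1 hx).2
        exact Finset.inr_mem_disjSum.2 this
    · exact (Sum.map_injective.2 ⟨Subtype.val_injective, Subtype.val_injective⟩).injOn
  rw [Finset.card_disjSum, (mem_cells.1 hT).2] at h
  exact h

/-- At most six basis functions live on a triangle, two for each vertex. -/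
theorem Regular.energy_pairOf_le (R : K.Regular σ L) (hT : T ∈ K.mesh.cells)
    (v : K.LocalIndex → ℝ) :
    K.energy T (K.pairOf T v) ≤ 6 * ∑ r, v r ^ 2 * K.energy T (K.basisPair T r) := by
  classical
  set s := Finset.univ.filter fun r : K.LocalIndex => K.vert r ∈ T with hs
  have h0 : ∀ r, r ∉ s → K.basisPair T r = 0 := fun r hr =>
    basisPair_of_notMem fun h => hr (Finset.mem_filter.2 ⟨Finset.mem_univ _, h⟩)
  have h1 : K.pairOf T v = ∑ r ∈ s, v r • K.basisPair T r :=
    (Finset.sum_subset (Finset.subset_univ s) fun r _ hr => by rw [h0 r hr, smul_zero]).symm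
  have hE : ∀ r, 0 ≤ v r ^ 2 * K.energy T (K.basisPair T r) := fun r =>
    mul_nonneg (sq_nonneg _) (R.energy_nonneg T _)
  have hcard : (s.card : ℝ) ≤ 6 := by exact_mod_cast card_index_le hT
  rw [h1]
  refine (R.energy_sum_le hT s _).trans ?_
  simp only [energy_smul]
  have h2 : ∑ r ∈ s, v r ^ 2 * K.energy T (K.basisPair T r) ≤
      ∑ r, v r ^ 2 * K.energy T (K.basisPair T r) :=
    Finset.sum_le_sum_of_subset_of_nonneg (Finset.subset_univ s) fun r _ _ => hE r
  have h3 := Finset.sum_nonneg fun r (_ : r ∈ s) => hE r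
  nlinarith

/-- The total energy of the function with the given coefficients. -/
def totalEnergy (K : CutMesh Ω) (v : K.LocalIndex → ℝ) : ℝ :=
  ∑ T ∈ K.mesh.cells, K.energy T (K.pairOf T v)

theorem Regular.totalEnergy_nonneg (R : K.Regular σ L) (v : K.LocalIndex → ℝ) :
    0 ≤ K.totalEnergy v := Finset.sum_nonneg fun T _ => R.energy_nonneg T _

theorem Regular.totalEnergy_le (R : K.Regular σ L) (v : K.LocalIndex → ℝ) :
    K.totalEnergy v ≤ 6 * ∑ r, v r ^ 2 * K.basisEnergy r := by
  unfold totalEnergy basisEnergy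
  refine (Finset.sum_le_sum fun T hT => R.energy_pairOf_le hT v).trans_eq ?_
  rw [← Finset.mul_sum, Finset.sum_comm]
  simp only [Finset.mul_sum]

theorem Regular.sum_inl_le (R : K.Regular σ L) {C : ℝ} (v : K.LocalIndex → ℝ)
    (hv : ∑ x ∈ K.interfaceVertices, K.extendZero (fun x => v (.inl x)) x ^ 2 ≤
      C * K.totalEnergy v) :
    ∑ x, v (.inl x) ^ 2 * K.basisEnergy (.inl x) ≤ 4 / σ ^ 4 * (C * K.totalEnergy v) := by
  have hσ := R.σ_pos
  have h1 : ∑ x, v (.inl x) ^ 2 ≤ C * K.totalEnergy v := by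
    refine le_trans (le_of_eq ?_) hv
    refine Eq.trans ?_ (Finset.sum_coe_sort K.interfaceVertices _)
    exact Finset.sum_congr rfl fun x _ =>
      congrArg (· ^ 2) (extendZero_coe (fun x => v (.inl x)) x).symm
  calc _ ≤ ∑ x, 4 / σ ^ 4 * v (.inl x) ^ 2 := by
        refine Finset.sum_le_sum fun x _ => ?_
        rw [mul_comm]
        exact mul_le_mul_of_nonneg_right (R.basisEnergy_inl_le x) (sq_nonneg _)
    _ ≤ _ := by
        rw [← Finset.mul_sum]
        exact mul_le_mul_of_nonneg_left h1 (by positivity)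

/-- The estimate of the coefficients of the cut functions if the other coefficients vanish. -/
theorem Regular.sum_inr_le (R : K.Regular σ L) (v : K.LocalIndex → ℝ)
    (hv : ∀ x, v (.inl x) = 0) :
    ∑ x, v (.inr x) ^ 2 * K.basisEnergy (.inr x) ≤ 3 * splitConst σ L * K.totalEnergy v := by
  classical
  have hsc := splitConst_nonneg R.σ_pos R.L_nonneg
  have hz : ∀ w, K.extendZero (fun x => v (.inl x)) w = 0 := fun w => by
    unfold extendZero
    split_ifs
    · exact hv _
    · rfl
  unfold basisEnergy totalEnergy
  simp only [Finset.mul_sum]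
  rw [Finset.sum_comm]
  refine Finset.sum_le_sum fun T hT => ?_
  have h1 : ∀ x : {x // x ∈ K.interfaceVertices}, (x : Plane) ∈ T →
      v (.inr x) ^ 2 * K.energy T (K.basisPair T (.inr x)) ≤
        splitConst σ L * K.energy T (K.pairOf T v) := by
    intro x hxT
    obtain ⟨-, i, j, hij, hi, -⟩ := mem_interfaceVertices.1 x.2
    have hxj : (x : Plane) ∉ K.sub j := fun h => Set.disjoint_left.1 (sub_disjoint K hij) hi h
    have hval : K.pairOf T v j x = v (.inr x) := by
      rw [pairOf_apply hT v j hxT, hz, if_neg hxj, zero_add, extendZero_coe]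
    -- The cut function of `x` lives only on the side that does not contain `x`; its coefficient is
    -- the value at `x` of the pair on that side.
    have hb : v (.inr x) • K.basisPair T (.inr x) =
        Pi.single j (K.pairOf T v j x • bary hT x) := by
      ext1 k
      rw [hval]
      by_cases hk : k = j
      · subst hk
        rw [Pi.single_eq_same, Pi.smul_apply]
        simp only [basisPair, if_neg hxj, cellBary_eq hT]
      · have hki : k = i := by rw [fin_two_eq_of_ne hk, fin_two_eq_of_ne hij]
        rw [Pi.single_eq_of_ne hk, Pi.smul_apply, hki]
        simp only [basisPair, if_pos hi, smul_zero]
    rw [← energy_smul, hb]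
    refine R.energy_single_le hT (fun w hw i hi => ?_)
      (fun w hw hΩ i => pairOf_apply_of_notMem hT v i hw hΩ) hxT j
    rw [pairOf_apply hT v i hw, hz, if_pos hi, add_zero]
  set s := Finset.univ.filter fun x : {x // x ∈ K.interfaceVertices} => (x : Plane) ∈ T with hs
  have h2 : ∑ x, v (.inr x) ^ 2 * K.energy T (K.basisPair T (.inr x)) =
      ∑ x ∈ s, v (.inr x) ^ 2 * K.energy T (K.basisPair T (.inr x)) := by
    refine (Finset.sum_subset (Finset.subset_univ s) fun x _ hx => ?_).symm
    have : K.vert (.inr x) ∉ T := fun h => hx (Finset.mem_filter.2 ⟨Finset.mem_univ _, h⟩)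
    rw [basisPair_of_notMem this, energy_zero, mul_zero]
  have h3 : s.card ≤ T.card :=
    Finset.card_le_card_of_injOn (fun x => x.1) (fun x hx => (Finset.mem_filter.1 hx).2)
      Subtype.val_injective.injOn
  rw [(mem_cells.1 hT).2] at h3
  have h4 : (s.card : ℝ) ≤ 3 := by exact_mod_cast h3
  rw [h2]
  refine (Finset.sum_le_sum fun x hx => h1 x (Finset.mem_filter.1 hx).2).trans ?_
  rw [Finset.sum_const, nsmul_eq_mul, mul_assoc]
  exact mul_le_mul_of_nonneg_right h4 (mul_nonneg hsc (R.energy_nonneg T _))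

/-- The constant in the stability estimate of the basis. -/
def stabConst (σ L C : ℝ) : ℝ :=
  4 / σ ^ 4 * C + 3 * splitConst σ L * (2 + 48 / σ ^ 4 * C)

/-- The nodal part `w` is estimated first; its energy is thereby controlled as well. The remainder
`v - w` has only cut functions, to which the local splitting applies. -/
theorem Regular.sum_basisEnergy_le (R : K.Regular σ L) {C : ℝ} (v : K.LocalIndex → ℝ)
    (hv : ∑ x ∈ K.interfaceVertices, K.extendZero (fun x => v (.inl x)) x ^ 2 ≤
      C * K.totalEnergy v) :
    ∑ r, v r ^ 2 * K.basisEnergy r ≤ stabConst σ L C * K.totalEnergy v := by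
  have hσ := R.σ_pos
  have hsc := splitConst_nonneg R.σ_pos R.L_nonneg
  have h1 := R.sum_inl_le v hv
  set w : K.LocalIndex → ℝ := Sum.elim (fun x => v (.inl x)) 0 with hw
  have h2 : K.totalEnergy w ≤ 6 * (4 / σ ^ 4 * (C * K.totalEnergy v)) := by
    refine (R.totalEnergy_le w).trans ?_
    rw [Fintype.sum_sum_type]
    simp only [hw, Sum.elim_inl, Sum.elim_inr, Pi.zero_apply]
    simp only [ne_eq, OfNat.ofNat_ne_zero, not_false_eq_true, zero_pow, zero_mul,
      Finset.sum_const_zero, add_zero]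
    linarith
  have h3 : K.totalEnergy (v - w) ≤ 2 * K.totalEnergy v + 2 * K.totalEnergy w := by
    unfold totalEnergy
    rw [Finset.mul_sum, Finset.mul_sum, ← Finset.sum_add_distrib]
    refine Finset.sum_le_sum fun T hT => ?_
    rw [pairOf_sub]
    exact R.energy_sub_le hT _ _
  have h4 := R.sum_inr_le (v - w) fun x => by simp [hw]
  have h5 : ∀ x, (v - w) (.inr x) = v (.inr x) := fun x => by simp [hw]
  simp only [h5] at h4
  rw [Fintype.sum_sum_type]
  have h6 : 3 * splitConst σ L * K.totalEnergy (v - w) ≤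
      3 * splitConst σ L * (2 * K.totalEnergy v + 2 * (6 * (4 / σ ^ 4 * (C * K.totalEnergy v)))) :=
    mul_le_mul_of_nonneg_left (by linarith) (by positivity)
  calc _ ≤ _ := add_le_add h1 (h4.trans h6)
    _ = _ := by rw [stabConst]; ring

/-! ### The interface matrix -/

/-- The contribution of a triangle as a bilinear form. -/
def Regular.cellBilin (R : K.Regular σ L) (hT : T ∈ K.mesh.cells) (μ : Fin 2 → ℝ) (s lam : ℝ) :
    LinearMap.BilinForm ℝ (Fin 2 → Plane →ᵃ[ℝ] ℝ) :=
  LinearMap.mk₂ ℝ (K.cellForm μ s lam T) (R.cellForm_add hT μ s lam) (K.cellForm_smul μ s lam T)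
    (fun f g g' => by
      rw [cellForm_comm, R.cellForm_add hT, cellForm_comm, K.cellForm_comm μ s lam T g'])
    (fun c f g => by rw [cellForm_comm, cellForm_smul, cellForm_comm, smul_eq_mul])

theorem Regular.cellForm_pairOf (R : K.Regular σ L) (hT : T ∈ K.mesh.cells) (μ : Fin 2 → ℝ)
    (s lam : ℝ) (v : K.LocalIndex → ℝ) :
    K.cellForm μ s lam T (K.pairOf T v) (K.pairOf T v) =
      ∑ r, ∑ t, v r * v t * K.cellForm μ s lam T (K.basisPair T t) (K.basisPair T r) := by
  have h : K.cellForm μ s lam T (K.pairOf T v) (K.pairOf T v) =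
      R.cellBilin hT μ s lam (K.pairOf T v) (K.pairOf T v) := rfl
  have h' : ∀ f g, R.cellBilin hT μ s lam f g = K.cellForm μ s lam T f g := fun _ _ => rfl
  rw [h, pairOf]
  simp only [map_sum, LinearMap.sum_apply, map_smul, LinearMap.smul_apply, smul_eq_mul, h']
  rw [Finset.sum_comm]
  refine Finset.sum_congr rfl fun r _ => ?_
  rw [Finset.mul_sum]
  refine Finset.sum_congr rfl fun t _ => ?_
  rw [K.cellForm_comm μ s lam T (K.basisPair T r)]
  ring

/-- The bilinear form `b` is the sum of the contributions of the triangles. -/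
def IsCellSum (K : CutMesh Ω) (μ : Fin 2 → ℝ) (s lam : ℝ)
    (b : (Fin 2 → Plane → ℝ) → (Fin 2 → Plane → ℝ) → ℝ) : Prop :=
  ∀ (u v : Fin 2 → Plane → ℝ) (f g : Finset Plane → Fin 2 → Plane →ᵃ[ℝ] ℝ),
    (∀ T ∈ K.mesh.cells, Represents T u (f T)) → (∀ T ∈ K.mesh.cells, Represents T v (g T)) →
    b u v = ∑ T ∈ K.mesh.cells, K.cellForm μ s lam T (f T) (g T)

theorem Regular.isCellSum_nitsche (R : K.Regular σ L) (μ : Fin 2 → ℝ) (lam : ℝ) :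
    K.IsCellSum μ 0 lam (K.nitscheForm μ lam) := fun _ _ _ _ hu hv =>
  Finset.sum_congr rfl fun T hT => R.cell_nitsche hT μ lam (hu T hT) (hv T hT)

theorem Regular.isCellSum_paramFree (R : K.Regular σ L) {μ : Fin 2 → ℝ} (hμ : ∀ i, 0 < μ i) :
    K.IsCellSum μ 2 1 (K.paramFreeForm μ) := fun _ _ _ _ hu hv =>
  Finset.sum_congr rfl fun T hT => R.cell_paramFree hT hμ (hu T hT) (hv T hT)

theorem Regular.interfaceMatrix_apply (R : K.Regular σ L) {μ : Fin 2 → ℝ} {s lam : ℝ}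
    {b : (Fin 2 → Plane → ℝ) → (Fin 2 → Plane → ℝ) → ℝ} (hb : K.IsCellSum μ s lam b)
    (r t : K.LocalIndex) : K.interfaceMatrix b r t =
      ∑ T ∈ K.mesh.cells, K.cellForm μ s lam T (K.basisPair T t) (K.basisPair T r) :=
  hb _ _ (fun T => K.basisPair T t) (fun T => K.basisPair T r)
    (fun _ hT => R.represents_basis hT t) (fun _ hT => R.represents_basis hT r)

theorem Regular.dotProduct_mulVec (R : K.Regular σ L) {μ : Fin 2 → ℝ} {s lam : ℝ}
    {b : (Fin 2 → Plane → ℝ) → (Fin 2 → Plane → ℝ) → ℝ} (hb : K.IsCellSum μ s lam b)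
    (v : K.LocalIndex → ℝ) : v ⬝ᵥ (K.interfaceMatrix b).mulVec v =
      ∑ T ∈ K.mesh.cells, K.cellForm μ s lam T (K.pairOf T v) (K.pairOf T v) := by
  rw [Finset.sum_congr rfl fun T hT => R.cellForm_pairOf hT μ s lam v, Finset.sum_comm]
  refine Finset.sum_congr rfl fun r _ => ?_
  rw [Finset.sum_comm, Matrix.mulVec, dotProduct, Finset.mul_sum]
  refine Finset.sum_congr rfl fun t _ => ?_
  rw [R.interfaceMatrix_apply hb, Finset.sum_mul, Finset.mul_sum]
  refine Finset.sum_congr rfl fun T _ => ?_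
  ring

theorem Regular.wellConditioned (R : K.Regular σ L) {μ : Fin 2 → ℝ} (hμ : ∀ i, 0 < μ i)
    {s lam : ℝ} (hs : 0 ≤ s) (hs2 : s ≤ 2) (hlam : 1 + (2 - s) * fluxConst μ σ L ≤ lam)
    (hlam0 : 0 ≤ lam) {b : (Fin 2 → Plane → ℝ) → (Fin 2 → Plane → ℝ) → ℝ}
    (hb : K.IsCellSum μ s lam b) {C c₁ c₂ : ℝ} (hC : 0 ≤ C)
    (hc₁ : c₁ = min 1 ((1 - 1 / 2) * min (μ 0) (μ 1) * σ ^ 2))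
    (hc₂ : c₂ = 8 * (μ 0 + μ 1) + (1 + s) * fluxConst μ σ L + lam)
    (hval : ∀ v : K.LocalIndex → ℝ,
      ∑ x ∈ K.interfaceVertices, K.extendZero (fun x => v (.inl x)) x ^ 2 ≤ C * K.totalEnergy v) :
    WellConditioned (K.interfaceMatrix b) ((1 + 6 * c₂ / c₁ + c₂ * stabConst σ L C / c₁) ^ 2) := by
  have hσ := R.σ_pos
  have hL := R.L_nonneg
  have hμ0 := hμ 0
  have hμ1 := hμ 1
  have hsc := splitConst_nonneg hσ hL
  have hst : 0 ≤ stabConst σ L C := by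
    unfold stabConst
    positivity
  have hc₁0 : 0 < c₁ := by
    rw [hc₁]
    have := lt_min hμ0 hμ1
    exact lt_min one_pos (by positivity)
  have hc₂0 : 0 ≤ c₂ := by
    rw [hc₂, fluxConst]
    positivity
  have hlow : ∀ T ∈ K.mesh.cells, ∀ f, c₁ * K.energy T f ≤ K.cellForm μ s lam T f f := by
    intro T hT f
    rw [hc₁]
    -- The parameter of Young's inequality is a = 1/2, for which the largest admissible coefficient
    -- of the lifting term is 2.
    refine R.le_cellForm hT hμ (by norm_num) (by norm_num) ?_ ?_ f
    · norm_num
      exact hlam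
    · norm_num
      exact hs2
  have hup : ∀ T ∈ K.mesh.cells, ∀ f, K.cellForm μ s lam T f f ≤ c₂ * K.energy T f := by
    intro T hT f
    rw [hc₂]
    exact R.cellForm_le hT hμ hs hlam0 f
  have hvlow : ∀ v, c₁ * K.totalEnergy v ≤ v ⬝ᵥ (K.interfaceMatrix b).mulVec v := by
    intro v
    rw [R.dotProduct_mulVec hb, totalEnergy, Finset.mul_sum]
    exact Finset.sum_le_sum fun T hT => hlow T hT _
  have hvup : ∀ v, v ⬝ᵥ (K.interfaceMatrix b).mulVec v ≤ c₂ * K.totalEnergy v := by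
    intro v
    rw [R.dotProduct_mulVec hb, totalEnergy, Finset.mul_sum]
    exact Finset.sum_le_sum fun T hT => hup T hT _
  have hdlow : ∀ r, c₁ * K.basisEnergy r ≤ K.interfaceMatrix b r r := by
    intro r
    rw [R.interfaceMatrix_apply hb, basisEnergy, Finset.mul_sum]
    exact Finset.sum_le_sum fun T hT => hlow T hT _
  have hdup : ∀ r, K.interfaceMatrix b r r ≤ c₂ * K.basisEnergy r := by
    intro r
    rw [R.interfaceMatrix_apply hb, basisEnergy, Finset.mul_sum]
    exact Finset.sum_le_sum fun T hT => hup T hT _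
  have hD0 : ∀ v : K.LocalIndex → ℝ, 0 ≤ ∑ r, K.interfaceMatrix b r r * v r ^ 2 := fun v =>
    Finset.sum_nonneg fun r _ => mul_nonneg
      ((mul_nonneg hc₁0.le (R.basisEnergy_pos r).le).trans (hdlow r)) (sq_nonneg _)
  have q1 : 0 ≤ 6 * c₂ / c₁ := by positivity
  have q2 : 0 ≤ c₂ * stabConst σ L C / c₁ := by positivity
  refine WellConditioned.of_bounds (by linarith) ?_ ?_ ?_ ?_
  · ext r t
    rw [Matrix.transpose_apply, R.interfaceMatrix_apply hb, R.interfaceMatrix_apply hb]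
    exact Finset.sum_congr rfl fun T _ => cellForm_comm _ _ _ _ _ _ _
  · exact fun r => (mul_pos hc₁0 (R.basisEnergy_pos r)).trans_le (hdlow r)
  · intro v
    have hE := R.totalEnergy_nonneg v
    have h0 := hvlow v
    have h1 : ∑ r, K.interfaceMatrix b r r * v r ^ 2 ≤ c₂ * ∑ r, v r ^ 2 * K.basisEnergy r := by
      rw [Finset.mul_sum]
      refine Finset.sum_le_sum fun r _ => ?_
      have := mul_le_mul_of_nonneg_right (hdup r) (sq_nonneg (v r))
      linarith
    have h2 := R.sum_basisEnergy_le v (hval v)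
    have h3 : c₂ * stabConst σ L C * K.totalEnergy v ≤
        c₂ * stabConst σ L C / c₁ * (v ⬝ᵥ (K.interfaceMatrix b).mulVec v) := by
      rw [div_mul_eq_mul_div, le_div_iff₀ hc₁0]
      have := mul_le_mul_of_nonneg_left h0 (mul_nonneg hc₂0 hst)
      linarith
    have h4 := mul_le_mul_of_nonneg_left h2 hc₂0
    have h5 : 0 ≤ v ⬝ᵥ (K.interfaceMatrix b).mulVec v := (mul_nonneg hc₁0.le hE).trans h0
    have h6 := mul_nonneg q1 h5
    linarith
  · intro v
    have h1 : c₁ * ∑ r, v r ^ 2 * K.basisEnergy r ≤ ∑ r, K.interfaceMatrix b r r * v r ^ 2 := by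
      rw [Finset.mul_sum]
      refine Finset.sum_le_sum fun r _ => ?_
      have := mul_le_mul_of_nonneg_right (hdlow r) (sq_nonneg (v r))
      linarith
    have h2 := mul_le_mul_of_nonneg_left (R.totalEnergy_le v) hc₂0
    have h3 : c₂ * (6 * ∑ r, v r ^ 2 * K.basisEnergy r) ≤
        6 * c₂ / c₁ * ∑ r, K.interfaceMatrix b r r * v r ^ 2 := by
      rw [div_mul_eq_mul_div, le_div_iff₀ hc₁0]
      have := mul_le_mul_of_nonneg_left h1 (mul_nonneg (by norm_num : (0 : ℝ) ≤ 6) hc₂0)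
      linarith
    have h4 := mul_nonneg q2 (hD0 v)
    linarith [hvup v, hD0 v]

end CutMesh

/-! ### Constants that do not depend on the level -/

variable {Ω : Set Plane}

/-- The coefficients of the nodal functions are controlled by the energy, with a constant that does
not depend on the level. -/
theorem UnfittedFamily.Admissible.sum_sq_le {F : UnfittedFamily Ω} {σ L c d₀ θ r₀ : ℝ}
    (A : F.Admissible σ L c d₀ θ r₀) (hΩ : IsConnected Ω) (hreg : interior (closure Ω) = Ω)
    (hσ : 0 < σ) (hd₀ : 0 < d₀) (hθ : 0 < θ) (hr₀ : 0 < r₀) (l : ℕ)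
    (v : (F.level l).LocalIndex → ℝ) :
    ∑ x ∈ (F.level l).interfaceVertices, (F.level l).extendZero (fun x => v (.inl x)) x ^ 2 ≤
      CutMesh.valueConst σ (min σ d₀ / (12 * (1 + |L|))) (reachConst Ω c θ r₀) *
        (F.level l).totalEnergy v := by
  have hL := abs_nonneg L
  have hmin : 0 < min σ d₀ := lt_min hσ hd₀
  -- The threshold η for short arcs: 6(1 + |L|)η is below σ, so that a short arc stays at its
  -- corner, and below d₀, so that Γ does not fit into the corners at one vertex.
  have h6 : 6 * (1 + |L|) * (min σ d₀ / (12 * (1 + |L|))) = min σ d₀ / 2 := by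
    field_simp
    norm_num
  refine (A.regular hΩ hreg hσ l).sum_sq_le (d₀ := d₀) (by positivity)
    (reachConst_nonneg Ω c hθ hr₀) ?_ ?_ (A.diam_ge l) (A.reaches hΩ hreg hσ hθ hr₀ l)
    (fun S hS => CutMesh.compatible_pairOf hS v)
    (fun w hw => CutMesh.extendZero_of_notMem _ hw)
  · rw [h6]
    linarith [min_le_left σ d₀]
  · rw [h6]
    linarith [min_le_right σ d₀]

/-- The constant is read off from `Regular.wellConditioned`. It is built from the data alone and
fixed before the family and the level are chosen. -/
theorem exists_wellConditioned (hΩ : IsConnected Ω) (hreg : interior (closure Ω) = Ω)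
    {μ : Fin 2 → ℝ} (hμ : ∀ i, 0 < μ i) {σ : ℝ} (hσ : 0 < σ) {L s lam : ℝ} (hs : 0 ≤ s)
    (hs2 : s ≤ 2) (hlam : 1 + (2 - s) * CutMesh.fluxConst μ σ |L| ≤ lam) (hlam0 : 0 ≤ lam)
    (c : ℝ) {d₀ θ r₀ : ℝ} (hd₀ : 0 < d₀) (hθ : 0 < θ) (hr₀ : 0 < r₀) :
    ∃ C > 0, ∀ F : UnfittedFamily Ω, F.Admissible σ L c d₀ θ r₀ → ∀ l : ℕ,
      ∀ b, (F.level l).IsCellSum μ s lam b →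
        WellConditioned ((F.level l).interfaceMatrix b) C := by
  have hη : 0 < min σ d₀ / (12 * (1 + |L|)) := by
    have := lt_min hσ hd₀
    positivity
  have hC := CutMesh.valueConst_nonneg hσ hη (reachConst Ω c θ r₀)
  have hμ0 := hμ 0
  have hμ1 := hμ 1
  have hμm := lt_min hμ0 hμ1
  have hsc := CutMesh.splitConst_nonneg hσ (abs_nonneg L)
  refine ⟨_, ?_, fun F A l b hb => (A.regular hΩ hreg hσ l).wellConditioned hμ hs hs2 hlam hlam0 hb
    hC rfl rfl (A.sum_sq_le hΩ hreg hσ hd₀ hθ hr₀ l)⟩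
  unfold CutMesh.stabConst CutMesh.fluxConst
  positivity

end CutFEM
end

theorem mainTheorem3 (Ω : Set CutFEM.Plane) (hΩ : IsConnected Ω)
    (hreg : interior (closure Ω) = Ω) (μ : Fin 2 → ℝ) (hμ : ∀ i, 0 < μ i)
    (σ : ℝ) (hσ : 0 < σ) (L : ℝ) :
    (∃ lam₀ > 0, ∀ lam ≥ lam₀, ∀ c d₀ θ r₀ : ℝ, 0 < d₀ → 0 < θ → 0 < r₀ →
      ∃ C > 0, ∀ F : CutFEM.UnfittedFamily Ω, F.Admissible σ L c d₀ θ r₀ → ∀ l : ℕ,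
        CutFEM.WellConditioned
          ((F.level l).interfaceMatrix ((F.level l).nitscheForm μ lam)) C) ∧
    (∀ c d₀ θ r₀ : ℝ, 0 < d₀ → 0 < θ → 0 < r₀ →
      ∃ C > 0, ∀ F : CutFEM.UnfittedFamily Ω, F.Admissible σ L c d₀ θ r₀ → ∀ l : ℕ,
        CutFEM.WellConditioned
          ((F.level l).interfaceMatrix ((F.level l).paramFreeForm μ)) C) := by
  have hμ0 := hμ 0
  have hμ1 := hμ 1
  have hL := abs_nonneg L
  have hflux : 0 ≤ CutFEM.CutMesh.fluxConst μ σ |L| := by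
    unfold CutFEM.CutMesh.fluxConst
    positivity
  -- Without lifting (s = 0), the penalty must pay 2 * `fluxConst`, the remainder in Young's
  -- inequality, and leave 1 for the jump.
  refine ⟨⟨1 + 2 * CutFEM.CutMesh.fluxConst μ σ |L|, by positivity,
    fun lam hlam c d₀ θ r₀ hd₀ hθ hr₀ => ?_⟩, fun c d₀ θ r₀ hd₀ hθ hr₀ => ?_⟩
  · obtain ⟨C, hC, h⟩ := CutFEM.exists_wellConditioned hΩ hreg hμ hσ (L := L) (s := 0) (lam := lam)
      le_rfl (by norm_num) (by linarith) (by linarith) c hd₀ hθ hr₀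
    exact ⟨C, hC, fun F A l => h F A l _ ((A.regular hΩ hreg hσ l).isCellSum_nitsche μ lam)⟩
  -- For s = 2 the requirement on the penalty parameter reduces to 1 ≤ lam.
  · obtain ⟨C, hC, h⟩ := CutFEM.exists_wellConditioned hΩ hreg hμ hσ (L := L) (s := 2) (lam := 1)
      (by norm_num) le_rfl (by linarith) zero_le_one c hd₀ hθ hr₀
    exact ⟨C, hC, fun F A l => h F A l _ ((A.regular hΩ hreg hσ l).isCellSum_paramFree hμ)⟩
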